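/- Let $U$ be a structure (for instance a monster model of a complete theory) whose theory has uniform elimination of imaginaries, let $K\subseteq U$ be a set of parameters and let $A$ be a $K$-definable Abelian group. Write $\bar K=\operatorname{acl}(K)$. Let $G_K=\operatorname{Aut}(\operatorname{acl}(K)/\operatorname{dcl}(K))$ be the group of elementary permutations of $\bar K$ fixing $\operatorname{dcl}(K)$ pointwise, with the profinite topology in which the stabilisers of finite subsets of $\bar K$ form a basis of neighbourhoods of $1$. It acts on the discrete group $A(\bar K)$ of tuples of $A$ with coordinates in $\bar K$; $H^2(G_K,A(\bar K))$ denotes continuous cohomology, i.e. continuous inhomogeneous $2$-cocycles modulo coboundaries of continuous $1$-cochains. A $K$-definable groupoid $X_\bullet=(X_1\rightrightarrows X_0)$ is *bounded by $A$* if it is equipped with group isomorphisms $\iota_x\colon A\to\operatorname{Mor}(x,x)$, $x\in X_0$, definable over $K$ uniformly in $x$ and satisfying $m\,\iota_x(a)=\iota_y(a)\,m$ for all $m\in\operatorname{Mor}(x,y)$ and $a\in A$. It is *connected* if it has exactly one isomorphism class of objects. A *Morita morphism* is a $K$-definable functor that is surjective on objects, bijective on all sets $\operatorname{Mor}(x,y)$,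 and compatible with the maps $\iota$; $X_\bullet$ and $Y_\bullet$ are *Morita equivalent* if there are Morita morphisms $Z_\bullet\to X_\bullet$ and $Z_\bullet\to Y_\bullet$ from some $K$-definable groupoid $Z_\bullet$ bounded by $A$. A *torsor* for a connected $X_\bullet$ is a non-empty definable set $P$ with a definable anchor map $a\colon P\to X_0$ and a definable action of $X_\bullet$ along $a$ such that for all $p,q\in P$ there is a unique $m\in X_1$ with $m\cdot p=q$. It is *split* over $\bar K$ if it has a point with coordinates in $\bar K$, and $X_\bullet$ is *eliminable* over a parameter set $C$ if it has a torsor definable over $C$ (*eliminable* means eliminable over $K$). Assume that torsors under $A$ split over $\bar K$: every principal homogeneous space of $A$ that is definable over $\bar K$ has a point with coordinates in $\bar K$ (for instance, this holds whenever $\bar K$ is a model). Consider the connected $K$-definable groupoids bounded by $A$ that have a $\bar K$-definable torsor which is split over $\bar K$. Then there is a bijection $\Phi$ from the set of Morita equivalence classes of these groupoids to $H^2(G_K,A(\bar K))$, and $X_\bullet$ is eliminable if and only if $\Phi([X_\bullet])=0$. Moreover, $\Phi$ is given as follows. For each such $X_\bullet$ there are a point $x\in X_0(\bar K)$, a continuous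 (locally constant) family of arrows $u_\sigma\in\operatorname{Mor}(x,\sigma x)$, $\sigma\in G_K$, with coordinates in $\bar K$, and a continuous $2$-cocycle $h$ with $\sigma(u_\tau)\circ u_\sigma=u_{\sigma\tau}\circ\iota_x(h(\sigma,\tau))$ for all $\sigma,\tau\in G_K$; and for every choice of such $x$, $u$ and $h$ the class $\Phi([X_\bullet])$ is the class of $h$. -/

import Mathlib

open FirstOrder

universe u v w

namespace ModelGalois

section Closure

variable (L : FirstOrder.Language.{u, v}) {U : Type w} [L.Structure U]

/-- Uniform elimination of imaginaries for the theory of `U`: the quotient of a finite power of `U`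
by a `∅`-definable equivalence relation is in `∅`-definable bijection with a definable set, namely
with the image of a `∅`-definable map whose fibres are the classes. -/
def EliminatesImaginaries (U : Type w) [L.Structure U] : Prop :=
  ∀ (n : ℕ) (E : Setoid (Fin n → U)),
    (∅ : Set U).Definable L {z : Fin n ⊕ Fin n → U | E (z ∘ Sum.inl) (z ∘ Sum.inr)} →
    ∃ (m : ℕ) (f : (Fin n → U) → (Fin m → U)),
      (∅ : Set U).Definable L (Set.range fun x => Sum.elim x (f x)) ∧
      ∀ x y, f x = f y ↔ E x y

/-- The model-theoretic definable closure: elements whose singleton is definable over `K`. -/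
def dcl (K : Set U) : Set U := {a | K.Definable₁ L {a}}

/-- The model-theoretic algebraic closure: elements of finite `K`-definable sets. -/
def acl (K : Set U) : Set U := {a | ∃ s : Set U, s.Finite ∧ K.Definable₁ L s ∧ a ∈ s}

variable {L}

theorem subset_dcl (K : Set U) : K ⊆ dcl L K := fun _ ha =>
  Set.Definable.singleton_of_mem L ha

theorem dcl_subset_acl (K : Set U) : dcl L K ⊆ acl L K := fun a ha =>
  ⟨{a}, Set.finite_singleton a, ha, rfl⟩

theorem subset_acl (K : Set U) : K ⊆ acl L K := (subset_dcl K).trans (dcl_subset_acl K)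

/-- Coordinates of points of a finite definable set are algebraic. -/
theorem mem_acl_of_finite {K : Set U} {α : Type} [Finite α] {D : Set (α → U)}
    (hD : K.Definable L D) (hfin : D.Finite) {x : α → U} (hx : x ∈ D) (i : α) :
    x i ∈ acl L K := by
  refine ⟨(fun y : α → U => y i) '' D, hfin.image _, ?_, ⟨x, hx, rfl⟩⟩
  have h := hD.image_comp (fun _ : Fin 1 => i)
  have e : {z : Fin 1 → U | z 0 ∈ (fun y : α → U => y i) '' D}
      = (fun g : α → U => g ∘ fun _ : Fin 1 => i) '' D := ?_
  · rw [Set.Definable₁, e]; exact h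
  ext z
  simp only [Set.mem_image, Set.mem_ofPred_eq]
  constructor
  · rintro ⟨y, hy, hz⟩
    refine ⟨y, hy, ?_⟩
    funext j
    rw [Subsingleton.elim j 0]
    exact hz
  · rintro ⟨y, hy, rfl⟩
    exact ⟨y, hy, rfl⟩

/-- The value of a definable (partial) function at an algebraic tuple is algebraic. -/
theorem mem_acl_of_graph {K : Set U} {α β : Type} [Finite α] [Finite β]
    {R : Set (α ⊕ β → U)} (hR : K.Definable L R)
    (hfun : ∀ x y y', Sum.elim x y ∈ R → Sum.elim x y' ∈ R → y = y')
    {x : α → U} {y : β → U} (hxy : Sum.elim x y ∈ R) (hx : ∀ i, x i ∈ acl L K) (j : β) :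
    y j ∈ acl L K := by
  choose s hfin hdef hmem using hx
  let R' : Set (α ⊕ β → U) := R ∩ ⋂ i, {z | z (Sum.inl i) ∈ s i}
  have hR' : K.Definable L R' := by
    refine hR.inter (Set.definable_iInter_of_finite fun i => ?_)
    exact (hdef i).preimage_comp (fun _ : Fin 1 => (Sum.inl i : α ⊕ β))
  have hfin' : R'.Finite := by
    have hpi : (Set.univ.pi s).Finite := Set.Finite.pi' hfin |>.subset (fun z hz i => hz i trivial)
    refine Set.Finite.of_finite_image (f := fun z => z ∘ Sum.inl) (hpi.subset ?_) ?_
    · rintro _ ⟨z, hz, rfl⟩ i -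
      exact Set.mem_iInter.1 hz.2 i
    · intro z hz z' hz' h
      have h2 : z ∘ Sum.inr = z' ∘ Sum.inr := by
        apply hfun (z ∘ Sum.inl)
        · rw [Sum.elim_comp_inl_inr]; exact hz.1
        · have h' : z ∘ Sum.inl = z' ∘ Sum.inl := h
          rw [h', Sum.elim_comp_inl_inr]; exact hz'.1
      rw [← Sum.elim_comp_inl_inr z, ← Sum.elim_comp_inl_inr z', h2]
      congr 1
  exact mem_acl_of_finite hR' hfin' (x := Sum.elim x y)
    ⟨hxy, Set.mem_iInter.2 fun i => hmem i⟩ (Sum.inr j)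

end Closure

section Galois

variable (L : FirstOrder.Language.{u, v}) {U : Type w} [L.Structure U]

/-- The group `G_K = Aut(acl(K)/dcl(K))`: the elementary permutations of `acl(K)` (elementary in
the sense of the ambient structure `U`) which fix `dcl(K)` pointwise. In the first condition the
elements of `acl(K)` serve as variables, and `φ` is evaluated at them and at their images. -/
def galoisGroup (K : Set U) : Subgroup (Equiv.Perm (acl L K)) where
  carrier := {σ |
    (∀ φ : L.Formula (acl L K),
      φ.Realize (fun a => (a : U)) ↔ φ.Realize (fun a => (σ a : U))) ∧
    ∀ a : acl L K, (a : U) ∈ dcl L K → σ a = a}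
  one_mem' := ⟨fun _ => Iff.rfl, fun _ _ => rfl⟩
  mul_mem' := by
    rintro σ τ ⟨hσ, hσ'⟩ ⟨hτ, hτ'⟩
    refine ⟨fun φ => ?_, fun a ha => ?_⟩
    · rw [hτ φ]
      have h := hσ (φ.relabel τ)
      simp only [FirstOrder.Language.Formula.realize_relabel] at h
      exact h
    · rw [Equiv.Perm.mul_apply, hτ' a ha, hσ' a ha]
  inv_mem' := by
    rintro σ ⟨hσ, hσ'⟩
    refine ⟨fun φ => ?_, fun a ha => ?_⟩
    · have h := hσ (φ.relabel (σ⁻¹ : Equiv.Perm _))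
      simp only [FirstOrder.Language.Formula.realize_relabel] at h
      have e : ((fun a : acl L K => (σ a : U)) ∘ (σ⁻¹ : Equiv.Perm _))
          = fun a : acl L K => (a : U) := by
        funext a; simp
      rw [e] at h
      exact h.symm
    · rw [Equiv.Perm.inv_eq_iff_eq, hσ' a ha]

/-- The profinite topology of `G_K`, that is, the topology of pointwise convergence on the discrete
set `acl(K)`: the stabilisers of finite subsets form a neighbourhood basis of the identity. -/
instance (K : Set U) : TopologicalSpace (galoisGroup L K) :=
  TopologicalSpace.induced (fun σ (a : acl L K) => σ.1 a)
    (@Pi.topologicalSpace _ (fun _ => acl L K) fun _ => ⊥)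

variable {L}

theorem galois_mem_iff {K : Set U} (σ : galoisGroup L K) {α : Type} {D : Set (α → U)}
    (hD : K.Definable L D) (x : α → acl L K) :
    (fun i => (x i : U)) ∈ D ↔ (fun i => (σ.1 (x i) : U)) ∈ D := by
  obtain ⟨φ, rfl⟩ := Set.definable_iff_exists_formula_sum.1 hD
  have h := σ.2.1 (φ.relabel (Sum.elim (fun k : K => (⟨k, subset_acl K k.2⟩ : acl L K)) x))
  simp only [FirstOrder.Language.Formula.realize_relabel] at h
  have e1 : (fun a : acl L K => (a : U)) ∘
      (Sum.elim (fun k : K => (⟨k, subset_acl K k.2⟩ : acl L K)) x)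
      = Sum.elim (fun k : K => (k : U)) (fun i => (x i : U)) := by
    funext i; rcases i with i | i <;> rfl
  have e2 : (fun a : acl L K => (σ.1 a : U)) ∘
      (Sum.elim (fun k : K => (⟨k, subset_acl K k.2⟩ : acl L K)) x)
      = Sum.elim (fun k : K => (k : U)) (fun i => (σ.1 (x i) : U)) := by
    funext i
    rcases i with i | i
    · simp only [Function.comp_apply, Sum.elim_inl]
      rw [σ.2.2 _ (subset_dcl K i.2)]
    · rfl
  rw [e1, e2] at h
  exact h

end Galois

/-- A subset of a finite power of `U`, definable over the parameter set `C`. -/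
structure DefSet (L : FirstOrder.Language.{u, v}) {U : Type w} [L.Structure U] (C : Set U) where
  arity : ℕ
  carrier : Set (Fin arity → U)
  definable : C.Definable L carrier

namespace DefSet

variable {L : FirstOrder.Language.{u, v}} {U : Type w} [L.Structure U] {K : Set U}

instance : CoeSort (DefSet L K) (Type w) := ⟨fun D => D.carrier⟩

/-- The `acl(K)`-points of a definable set, i.e. its tuples with coordinates in `acl(K)`. -/
def Pts (D : DefSet L K) : Type w := {x : D // ∀ i, x.1 i ∈ acl L K}

/-- `G_K` acts on the `acl(K)`-points of a `K`-definable set coordinatewise. -/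
instance (D : DefSet L K) : MulAction (galoisGroup L K) D.Pts where
  smul σ x := ⟨⟨fun i => σ.1 ⟨x.1.1 i, x.2 i⟩,
    (galois_mem_iff σ D.definable fun i => ⟨x.1.1 i, x.2 i⟩).1 x.1.2⟩, fun _ => Subtype.coe_prop _⟩
  one_smul _ := rfl
  mul_smul _ _ _ := rfl

theorem smul_coe (D : DefSet L K) (σ : galoisGroup L K) (x : D.Pts) :
    ((σ • x).1.1 : Fin D.arity → U) = fun i => (σ.1 ⟨x.1.1 i, x.2 i⟩ : U) := rfl

end DefSet

section Groups

/-- A map between definable sets is definable over `C` when its graph is. -/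
def IsDefMap {L : FirstOrder.Language.{u, v}} {U : Type w} [L.Structure U] (C : Set U) {m n : ℕ}
    {D : Set (Fin m → U)} {E : Set (Fin n → U)} (f : D → E) : Prop :=
  C.Definable L (Set.range fun x : D => Sum.elim x.1 (f x).1)

/-- The two-variable version of `IsDefMap`. -/
def IsDefMap₂ {L : FirstOrder.Language.{u, v}} {U : Type w} [L.Structure U] (C : Set U) {l m n : ℕ}
    {D : Set (Fin l → U)} {E : Set (Fin m → U)} {F : Set (Fin n → U)} (f : D → E → F) : Prop :=
  C.Definable L (Set.range fun p : D × E => Sum.elim (Sum.elim p.1.1 p.2.1) (f p.1 p.2).1)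

/-- An Abelian group definable over `K`, written additively. -/
structure DefAbGroup (L : FirstOrder.Language.{u, v}) {U : Type w} [L.Structure U] (K : Set U) extends
    DefSet L K where
  [group : AddCommGroup carrier]
  zero_def : K.Definable L {((0 : carrier) : Fin arity → U)}
  neg_def : IsDefMap (L := L) K fun a : carrier => -a
  add_def : IsDefMap₂ (L := L) K fun a b : carrier => a + b

attribute [instance] DefAbGroup.group

variable {L : FirstOrder.Language.{u, v}} {U : Type w} [L.Structure U] {K : Set U}

instance : CoeSort (DefAbGroup L K) (Type w) := ⟨fun A => A.carrier⟩

namespace DefAbGroup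

variable (A : DefAbGroup L K)

theorem pts_add {a b : A} (ha : ∀ i, a.1 i ∈ acl L K) (hb : ∀ i, b.1 i ∈ acl L K)
    (i : Fin A.arity) : (a + b).1 i ∈ acl L K := by
  refine mem_acl_of_graph A.add_def ?_ ⟨(a, b), rfl⟩ (fun j => ?_) i
  · rintro x y y' ⟨p, hp⟩ ⟨q, hq⟩
    obtain ⟨rfl, rfl⟩ := Sum.elim_eq_iff.1 hp
    obtain ⟨h1, rfl⟩ := Sum.elim_eq_iff.1 hq
    obtain ⟨h2, h3⟩ := Sum.elim_eq_iff.1 h1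
    rw [Subtype.ext h2, Subtype.ext h3]
  · rcases j with j | j
    · exact ha j
    · exact hb j

theorem pts_neg {a : A} (ha : ∀ i, a.1 i ∈ acl L K) (i : Fin A.arity) :
    (-a).1 i ∈ acl L K := by
  refine mem_acl_of_graph A.neg_def ?_ ⟨a, rfl⟩ ha i
  rintro x y y' ⟨p, hp⟩ ⟨q, hq⟩
  obtain ⟨rfl, rfl⟩ := Sum.elim_eq_iff.1 hp
  obtain ⟨h1, rfl⟩ := Sum.elim_eq_iff.1 hq
  rw [Subtype.ext h1]

/-- The subgroup `A(acl(K))` of `A`: tuples of `A` with coordinates in `acl(K)`. -/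
def ptsSubgroup : AddSubgroup A where
  carrier := {x | ∀ i, x.1 i ∈ acl L K}
  zero_mem' := mem_acl_of_finite A.zero_def (Set.finite_singleton _) rfl
  neg_mem' := pts_neg A
  add_mem' := pts_add A

instance : AddCommGroup A.Pts := inferInstanceAs (AddCommGroup A.ptsSubgroup)

/-- `A(acl(K))` is a `G_K`-module for the coordinatewise action. -/
instance : DistribMulAction (galoisGroup L K) A.Pts where
  smul_add σ a b := by
    obtain ⟨p, hp⟩ := (galois_mem_iff σ A.add_def (Sum.elim (Sum.elim
      (fun i => ⟨a.1.1 i, a.2 i⟩) (fun i => ⟨b.1.1 i, b.2 i⟩))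
      (fun i => ⟨(a + b).1.1 i, (a + b).2 i⟩))).1 ⟨(a.1, b.1), by
        funext i; rcases i with (i | i) | i <;> rfl⟩
    have h1 : p.1 = (σ • a).1 := Subtype.ext <| funext fun i =>
      congrFun hp (Sum.inl (Sum.inl i))
    have h2 : p.2 = (σ • b).1 := Subtype.ext <| funext fun i =>
      congrFun hp (Sum.inl (Sum.inr i))
    have h3 : p.1 + p.2 = (σ • (a + b)).1 := Subtype.ext <| funext fun i =>
      congrFun hp (Sum.inr i)
    rw [h1, h2] at h3
    exact Subtype.ext h3.symm
  smul_zero σ := by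
    have h := (galois_mem_iff σ A.zero_def
      fun i => ⟨(0 : A.Pts).1.1 i, (0 : A.Pts).2 i⟩).1 rfl
    exact Subtype.ext (Subtype.ext h)

/-- Torsors under `A` split over `acl(K)`: every principal homogeneous space of `A` that is
definable over `acl(K)` has a point with coordinates in `acl(K)`. -/
def TorsorsSplit : Prop :=
  ∀ (T : DefSet L (acl L K)) [AddTorsor A T],
    IsDefMap₂ (L := L) (acl L K) (fun (a : A) (t : T) => a +ᵥ t) →
    ∃ t : T, ∀ i, t.1 i ∈ acl L K

end DefAbGroup

end Groups

section Cohomology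

variable (G : Type*) [Group G] [TopologicalSpace G] (M : Type*) [AddCommGroup M]
  [DistribMulAction G M]

/-- Continuous inhomogeneous 2-cocycles of `G` in the discrete module `M`. -/
def contTwoCocycles : AddSubgroup (G × G → M) where
  carrier := {h | IsLocallyConstant h ∧ groupCohomology.IsCocycle₂ h}
  zero_mem' := ⟨IsLocallyConstant.const 0, fun _ _ _ => by simp⟩
  add_mem' := by
    rintro h h' ⟨hc, hh⟩ ⟨hc', hh'⟩
    refine ⟨hc.add hc', fun a b c => ?_⟩
    have e := hh a b c
    have e' := hh' a b c
    simp only [Pi.add_apply, smul_add]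
    rw [add_add_add_comm, e, e', add_add_add_comm]
  neg_mem' := by
    rintro h ⟨hc, hh⟩
    refine ⟨hc.neg, fun a b c => ?_⟩
    have e := hh a b c
    simp only [Pi.neg_apply, smul_neg]
    rw [← neg_add, e, neg_add]

/-- The coboundaries of continuous 1-cochains. -/
def contTwoCoboundaries : AddSubgroup (contTwoCocycles G M) where
  carrier := {h | ∃ g : G → M, IsLocallyConstant g ∧
    ∀ σ τ, h.1 (σ, τ) = σ • g τ - g (σ * τ) + g σ}
  zero_mem' := ⟨0, IsLocallyConstant.const 0, fun _ _ => by simp⟩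
  add_mem' := by
    rintro h h' ⟨g, hg, e⟩ ⟨g', hg', e'⟩
    refine ⟨g + g', hg.add hg', fun σ τ => ?_⟩
    simp only [AddSubgroup.coe_add, Pi.add_apply, smul_add, e, e']
    abel
  neg_mem' := by
    rintro h ⟨g, hg, e⟩
    refine ⟨-g, hg.neg, fun σ τ => ?_⟩
    simp only [NegMemClass.coe_neg, Pi.neg_apply, smul_neg, e]
    abel

/-- The second continuous cohomology group `H²(G, M)` of a discrete `G`-module `M`. -/
abbrev contH2 : Type _ := contTwoCocycles G M ⧸ contTwoCoboundaries G M

end Cohomology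

/-- A groupoid in the category of `K`-definable sets and maps. `comp g f h` is the composition
"`f`, then `g`". -/
structure DefGroupoid (L : FirstOrder.Language.{u, v}) {U : Type w} [L.Structure U]
    (K : Set U) where
  Ob : DefSet L K
  Ar : DefSet L K
  src : Ar → Ob
  tgt : Ar → Ob
  id : Ob → Ar
  inv : Ar → Ar
  comp : ∀ g f : Ar, src g = tgt f → Ar
  src_id : ∀ x, src (id x) = x
  tgt_id : ∀ x, tgt (id x) = x
  src_inv : ∀ f, src (inv f) = tgt f
  tgt_inv : ∀ f, tgt (inv f) = src f
  src_comp : ∀ g f h, src (comp g f h) = src f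
  tgt_comp : ∀ g f h, tgt (comp g f h) = tgt g
  id_comp : ∀ f, comp (id (tgt f)) f (src_id _) = f
  comp_id : ∀ f, comp f (id (src f)) (tgt_id _).symm = f
  inv_comp : ∀ f, comp (inv f) f (src_inv f) = id (src f)
  comp_inv : ∀ f, comp f (inv f) (tgt_inv f).symm = id (tgt f)
  assoc : ∀ k g f (h : src k = tgt g) (h' : src g = tgt f),
    comp (comp k g h) f ((src_comp k g h).trans h') =
      comp k (comp g f h') (h.trans (tgt_comp g f h').symm)
  src_def : IsDefMap (L := L) K src
  tgt_def : IsDefMap (L := L) K tgt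
  id_def : IsDefMap (L := L) K id
  inv_def : IsDefMap (L := L) K inv
  comp_def : K.Definable L (Set.range fun p : {p : Ar × Ar // src p.1 = tgt p.2} =>
    Sum.elim (Sum.elim p.1.1.1 p.1.2.1) (comp p.1.1 p.1.2 p.2).1)

namespace DefGroupoid

variable {L : FirstOrder.Language.{u, v}} {U : Type w} [L.Structure U] {K : Set U}

/-- There is exactly one isomorphism class of objects. -/
def Connected (X : DefGroupoid L K) : Prop :=
  Nonempty X.Ob ∧ ∀ x y, ∃ f, X.src f = x ∧ X.tgt f = y

/-- A torsor of `X` over a one-point base, definable over the parameter set `C`. For connected `X`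
the quotient `[X]` is a point, so these are the torsors over `[X]`. -/
structure Torsor (X : DefGroupoid L K) (C : Set U) where
  P : DefSet L C
  nonempty : Nonempty P
  anchor : P → X.Ob
  act : ∀ (m : X.Ar) (p : P), X.src m = anchor p → P
  anchor_act : ∀ m p h, anchor (act m p h) = X.tgt m
  id_act : ∀ p, act (X.id (anchor p)) p (X.src_id _) = p
  comp_act : ∀ g f p (h : X.src g = X.tgt f) (h' : X.src f = anchor p),
    act (X.comp g f h) p ((X.src_comp g f h).trans h') =
      act g (act f p h') (h.trans (anchor_act f p h').symm)
  principal : ∀ p q, ∃! m, ∃ h, act m p h = q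
  anchor_def : IsDefMap (L := L) C anchor
  act_def : C.Definable L (Set.range fun z : {z : X.Ar × P // X.src z.1 = anchor z.2} =>
    Sum.elim (Sum.elim z.1.1.1 z.1.2.1) (act z.1.1 z.1.2 z.2).1)

/-- A connected groupoid is eliminable over `C` if it has a torsor over `[X]` definable over `C`. -/
def EliminableOver (X : DefGroupoid L K) (C : Set U) : Prop := Nonempty (X.Torsor C)

/-- `X` is eliminable over `acl(K)` by a torsor which is split over `acl(K)`, i.e. which has a point
with coordinates in `acl(K)`. -/
def HasSplitTorsor (X : DefGroupoid L K) : Prop :=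
  ∃ T : X.Torsor (acl L K), ∃ p : T.P, ∀ i, p.1 i ∈ acl L K

end DefGroupoid

section Bounded

variable {L : FirstOrder.Language.{u, v}} {U : Type w} [L.Structure U] {K : Set U}

/-- A `K`-definable groupoid bounded by the `K`-definable Abelian group `A`: there are group
isomorphisms `bound x : A ≃ Mor(x, x)`, definable over `K` uniformly in `x` and compatible with
conjugation by arrows. -/
structure BoundedGroupoid (A : DefAbGroup L K) extends DefGroupoid L K where
  bound : Ob → A → Ar
  src_bound : ∀ x a, src (bound x a) = x
  tgt_bound : ∀ x a, tgt (bound x a) = x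
  bound_bijective : ∀ x f, src f = x → tgt f = x → ∃! a, bound x a = f
  bound_add : ∀ x a b, bound x (a + b) =
    comp (bound x a) (bound x b) ((src_bound x a).trans (tgt_bound x b).symm)
  bound_natural : ∀ f a, comp f (bound (src f) a) (tgt_bound _ _).symm =
    comp (bound (tgt f) a) f (src_bound _ _)
  bound_def : IsDefMap₂ (L := L) K bound

variable {A : DefAbGroup L K}

/-- A `K`-definable Morita morphism of groupoids bounded by `A`: a functor, surjective on objects
and bijective on each set of morphisms, which respects the identifications with `A`. -/
structure MoritaMorphism (Z X : BoundedGroupoid A) where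
  ob : Z.Ob → X.Ob
  ar : Z.Ar → X.Ar
  src_ar : ∀ f, X.src (ar f) = ob (Z.src f)
  tgt_ar : ∀ f, X.tgt (ar f) = ob (Z.tgt f)
  map_comp : ∀ g f h, ar (Z.comp g f h) = X.comp (ar g) (ar f)
    (by rw [src_ar, tgt_ar, h])
  surjective : Function.Surjective ob
  full_faithful : ∀ x y f, X.src f = ob x → X.tgt f = ob y →
    ∃! g, Z.src g = x ∧ Z.tgt g = y ∧ ar g = f
  map_bound : ∀ z a, ar (Z.bound z a) = X.bound (ob z) a
  ob_def : IsDefMap (L := L) K ob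
  ar_def : IsDefMap (L := L) K ar

/-- Morita equivalence over `K` of groupoids bounded by `A`. -/
def MoritaEquivalent (X Y : BoundedGroupoid A) : Prop :=
  ∃ Z : BoundedGroupoid A, Nonempty (MoritaMorphism Z X) ∧ Nonempty (MoritaMorphism Z Y)

variable (A)

/-- The connected `K`-definable groupoids bounded by `A`, eliminable over `acl(K)` by a torsor split
over `acl(K)`. -/
def SplitGroupoid : Type w :=
  {X : BoundedGroupoid A // X.Connected ∧ X.HasSplitTorsor}

/-- Morita equivalence classes of such groupoids. -/
def MoritaClasses : Type w :=
  Quot fun X Y : SplitGroupoid A => MoritaEquivalent X.1 Y.1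

variable {A}

/-- The Morita class of a groupoid. -/
def SplitGroupoid.moritaClass (X : SplitGroupoid A) : MoritaClasses A := Quot.mk _ X

/-- `h` is a cocycle attached to `X`: for an `acl(K)`-point `x` of the objects and a continuous
choice of `acl(K)`-definable arrows `u σ : x → σ x`, the value `h (σ, τ)` is the automorphism of `x`
by which `σ (u τ) ∘ u σ` and `u (σ τ)`, both arrows `x → στ x`, differ. (A choice of `u σ` is the
same as a choice of an isomorphism of the split torsor `Mor(x, -)` with its conjugate by `σ`.) -/
def IsAttachedCocycle (X : BoundedGroupoid A)
    (h : contTwoCocycles (galoisGroup L K) A.Pts) : Prop :=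
  ∃ (x : X.Ob.Pts) (u : galoisGroup L K → X.Ar.Pts), IsLocallyConstant u ∧
    (∀ σ, X.src (u σ).1 = x.1) ∧ (∀ σ, X.tgt (u σ).1 = (σ • x).1) ∧
    ∀ σ τ, ∃ h₁ h₂, X.comp (σ • u τ).1 (u σ).1 h₁ =
      X.comp (u (σ * τ)).1 (X.bound x.1 (h.1 (σ, τ)).1) h₂

end Bounded

end ModelGalois

/-! The anchor of an algebraic point of the split torsor is an algebraic object `x`. For algebraic
objects `x`, `y` the set `Mor(x, y)` is an `A`-torsor definable over `acl(K)`, so it contains an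
algebraic arrow. Choosing one for each conjugate of `x` gives a locally constant family `u σ : x → σ
x`. The element `h (σ, τ)` of `A` measures by how much `u` fails to be a 1-cocycle. Associativity of
composition makes `h` a 2-cocycle, and another choice of `u` changes it by a coboundary
(`Frame.exists_cocycle`, `Frame.class_eq`).

Morita invariance (`class_eq_of_moritaMorphism`): given Morita morphisms `F : Z → X` and `G : Z →
Y`, the isomorphism classes of triples `(z, F z → x, G z → y)` form a definable bitorsor, by
elimination of imaginaries. Its fibre over a pair of algebraic objects is an `A`-torsor, so it has
an algebraic point `p`. Transport along `p` and its conjugates turns the arrows `u σ` of `X` into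
arrows of `Y` with the same cocycle. The case of two identity morphisms gives independence of `x`.

Conversely, Galois-equivariant data on finite sets of algebraic elements are `K`-definable, because
Galois orbits are the minimal finite `K`-definable sets (`exists_gal_eq`,
`DefFun.of_finite_of_gal`). By compactness of the Galois group a continuous cocycle only sees the
action on finitely many elements. It therefore becomes a definable homogeneous cocycle `c` on the
orbit `E` of one algebraic tuple (`exists_descent`). Twisting the composition of the pair groupoid
of `E` by `c` realises every class (`exists_splitGroupoid`). The arrows `u` descend in the same way
to a diagram in `X` indexed by `E`, with composition twisted by `c`. Two groupoids with cohomologous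
cocycles carry diagrams with the same `c`, and a twisted pair groupoid then maps to both
(`Diagram.moritaEquivalent`).

A torsor over `K` has an algebraic point `p` above `x`; the arrows carrying `p` to `σ p` compose
strictly, so `h = 0`. If the class of `h` vanishes, `u` can be corrected so that the diagram
commutes strictly, and gluing the torsors of arrows out of its objects gives a torsor over `K`
(`Diagram.eliminableOver`). -/

namespace ModelGalois

/-! ### Calculus of definable predicates and maps on coded types -/

section Calculus

/-- A type whose elements are coded by finite tuples of elements of `U`. -/
class Coded (U : Type w) (T : Type*) where
  Idx : Type
  finite : Finite Idx
  code : T → Idx → U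
  code_injective : Function.Injective code

attribute [instance] Coded.finite

/-- The tuple coding an element. -/
abbrev codeOf (U : Type w) {T : Type*} [Coded U T] : T → Coded.Idx U T → U := Coded.code

theorem code_inj {U : Type w} {T : Type*} [Coded U T] {s t : T} :
    codeOf U s = codeOf U t ↔ s = t := Coded.code_injective.eq_iff

instance Coded.tuple (U : Type w) (ι : Type) [Finite ι] : Coded U (ι → U) :=
  ⟨ι, inferInstance, fun x => x, fun _ _ h => h⟩

instance Coded.prod (U : Type w) (S T : Type*) [Coded U S] [Coded U T] : Coded U (S × T) where
  Idx := Coded.Idx U S ⊕ Coded.Idx U T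
  finite := inferInstance
  code p := Sum.elim (codeOf U p.1) (codeOf U p.2)
  code_injective p q h := by
    obtain ⟨h1, h2⟩ := Sum.elim_eq_iff.1 h
    exact Prod.ext (code_inj.1 h1) (code_inj.1 h2)

instance Coded.subtype (U : Type w) {T : Type*} [Coded U T] (P : T → Prop) :
    Coded U {t // P t} where
  Idx := Coded.Idx U T
  finite := inferInstance
  code t := codeOf U t.1
  code_injective _ _ h := Subtype.ext (code_inj.1 h)

instance Coded.set (U : Type w) {T : Type*} [Coded U T] (D : Set T) : Coded U D :=
  Coded.subtype U (· ∈ D)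

variable (L : FirstOrder.Language.{u, v}) {U : Type w} [L.Structure U] (C : Set U)

/-- A predicate on a coded type is definable over `C` when the set of codes of its elements is. -/
def DefPred {T : Type*} [Coded U T] (P : T → Prop) : Prop :=
  C.Definable L (codeOf U '' {t | P t})

/-- A coded type is a definable domain when the set of all codes is definable. -/
class DefDom (T : Type*) [Coded U T] : Prop where
  defPred_true : DefPred L C fun _ : T => True

/-- A map between coded types is definable when its graph is. -/
def DefFun {S T : Type*} [Coded U S] [Coded U T] (f : S → T) : Prop :=
  DefPred L C fun p : S × T => f p.1 = p.2

variable {L} {C}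

section

variable {R S T V : Type*} [Coded U R] [Coded U S] [Coded U T] [Coded U V]

theorem DefPred.congr {P Q : T → Prop} (hP : DefPred L C P) (h : ∀ t, P t ↔ Q t) :
    DefPred L C Q := by
  rwa [← show P = Q from funext fun t => propext (h t)]

theorem DefPred.mono {C' : Set U} {P : T → Prop} (hP : DefPred L C P) (h : C ⊆ C') :
    DefPred L C' P := Set.Definable.mono hP h

theorem DefDom.mono [h : DefDom L C T] {C' : Set U} (hC : C ⊆ C') : DefDom L C' T :=
  ⟨h.1.mono hC⟩

theorem DefPred.and {P Q : T → Prop} (hP : DefPred L C P) (hQ : DefPred L C Q) :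
    DefPred L C fun t => P t ∧ Q t := by
  have h := Set.Definable.inter hP hQ
  rwa [← Set.image_inter Coded.code_injective] at h

theorem DefPred.or {P Q : T → Prop} (hP : DefPred L C P) (hQ : DefPred L C Q) :
    DefPred L C fun t => P t ∨ Q t := by
  have h := Set.Definable.union hP hQ
  rwa [← Set.image_union] at h

theorem DefPred.not [DefDom L C T] {P : T → Prop} (hP : DefPred L C P) :
    DefPred L C fun t => ¬ P t := by
  have h := (DefDom.defPred_true (L := L) (C := C) (T := T)).sdiff hP
  rw [← Set.image_sdiff Coded.code_injective] at h
  refine DefPred.congr (P := fun t => True ∧ ¬ P t) h (by simp)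

theorem DefPred.imp [DefDom L C T] {P Q : T → Prop} (hP : DefPred L C P) (hQ : DefPred L C Q) :
    DefPred L C fun t => P t → Q t :=
  (hP.not.or hQ).congr fun _ => imp_iff_not_or.symm

/-- Change of variables, where the coordinates of `r s` are among those of `s`. -/
theorem DefPred.reindex [DefDom L C S] {P : T → Prop} (hP : DefPred L C P) (r : S → T)
    (ρ : Coded.Idx U T → Coded.Idx U S) (h : ∀ s, codeOf U (r s) = codeOf U s ∘ ρ) :
    DefPred L C fun s => P (r s) := by
  have h1 := (Set.Definable.preimage_comp ρ hP).inter
    (DefDom.defPred_true (L := L) (C := C) (T := S))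
  refine (congrArg (C.Definable L) ?_).mp h1
  ext z
  constructor
  · rintro ⟨⟨t, ht, htz⟩, ⟨s, -, rfl⟩⟩
    refine ⟨s, ?_, rfl⟩
    have : t = r s := code_inj.1 (htz.trans (h s).symm)
    show P (r s); rwa [← this]
  · rintro ⟨s, hs, rfl⟩
    exact ⟨⟨r s, hs, h s⟩, ⟨s, trivial, rfl⟩⟩

theorem DefPred.exists {P : S × T → Prop} (hP : DefPred L C P) :
    DefPred L C fun s => ∃ t, P (s, t) := by
  have h := Set.Definable.image_comp hP (Sum.inl : Coded.Idx U S → Coded.Idx U (S × T))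
  refine (congrArg (C.Definable L) ?_).mp h
  ext z
  constructor
  · rintro ⟨_, ⟨p, hp, rfl⟩, rfl⟩
    exact ⟨p.1, ⟨p.2, hp⟩, rfl⟩
  · rintro ⟨s, ⟨t, ht⟩, rfl⟩
    exact ⟨_, ⟨(s, t), ht, rfl⟩, rfl⟩

instance [DefDom L C S] [DefDom L C T] : DefDom L C (S × T) := by
  refine ⟨?_⟩
  have h1 := (Set.Definable.preimage_comp (Sum.inl : _ → Coded.Idx U S ⊕ Coded.Idx U T)
    (DefDom.defPred_true (L := L) (C := C) (T := S))).inter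
    (Set.Definable.preimage_comp (Sum.inr : _ → Coded.Idx U S ⊕ Coded.Idx U T)
    (DefDom.defPred_true (L := L) (C := C) (T := T)))
  refine (congrArg (C.Definable L) ?_).mp h1
  ext z
  constructor
  · rintro ⟨⟨s, -, hs⟩, ⟨t, -, ht⟩⟩
    refine ⟨(s, t), trivial, ?_⟩
    have e : z = Sum.elim (z ∘ Sum.inl) (z ∘ Sum.inr) := (Sum.elim_comp_inl_inr z).symm
    rw [e]
    exact congrArg₂ Sum.elim hs ht
  · rintro ⟨⟨s, t⟩, -, rfl⟩
    exact ⟨⟨s, trivial, rfl⟩, ⟨t, trivial, rfl⟩⟩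

instance (ι : Type) [Finite ι] : DefDom L C (ι → U) := by
  refine ⟨(congrArg (C.Definable L) ?_).mp Set.definable_univ⟩
  ext z
  exact ⟨fun _ => ⟨z, trivial, rfl⟩, fun _ => trivial⟩

theorem DefPred.defDom {P : T → Prop} (hP : DefPred L C P) : DefDom L C {t // P t} := by
  refine ⟨(congrArg (C.Definable L) ?_).mp hP⟩
  ext z
  constructor
  · rintro ⟨t, ht, rfl⟩
    exact ⟨⟨t, ht⟩, trivial, rfl⟩
  · rintro ⟨t, -, rfl⟩
    exact ⟨t.1, t.2, rfl⟩

theorem defDom_set {ι : Type} [Finite ι] {D : Set (ι → U)} (hD : C.Definable L D) :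
    DefDom L C D := by
  refine ⟨(congrArg (C.Definable L) ?_).mp hD⟩
  ext z
  constructor
  · intro h
    exact ⟨⟨z, h⟩, trivial, rfl⟩
  · rintro ⟨t, -, rfl⟩
    exact t.2

instance (D : DefSet L C) : DefDom L C D.carrier := defDom_set D.definable

theorem defPred_tuple {ι : Type} [Finite ι] {P : (ι → U) → Prop} :
    DefPred L C P ↔ C.Definable L {z | P z} := by
  unfold DefPred
  rw [show codeOf U '' {t : ι → U | P t} = {z | P z} from Set.image_id _]

theorem DefPred.snd [DefDom L C S] [DefDom L C T] {P : T → Prop} (hP : DefPred L C P) :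
    DefPred L C fun p : S × T => P p.2 :=
  hP.reindex Prod.snd Sum.inr fun _ => rfl

/-- Projections and similar maps, whose output coordinates are among the input coordinates. -/
theorem DefFun.of_reindex [DefDom L C S] [DefDom L C T] (r : S → T)
    (ρ : Coded.Idx U T → Coded.Idx U S) (h : ∀ s, codeOf U (r s) = codeOf U s ∘ ρ) :
    DefFun L C r := by
  have hi : ∀ i, C.Definable L
      {z : Coded.Idx U S ⊕ Coded.Idx U T → U | z (Sum.inl (ρ i)) = z (Sum.inr i)} := fun i => by
    have := (Set.Definable.diagonal (L := L) C).preimage_comp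
      ![(Sum.inl (ρ i) : Coded.Idx U S ⊕ Coded.Idx U T), Sum.inr i]
    exact this
  have h1 := (Set.definable_iInter_of_finite hi).inter
    (DefDom.defPred_true (L := L) (C := C) (T := S × T))
  refine (congrArg (C.Definable L) ?_).mp h1
  ext z
  constructor
  · rintro ⟨hz, ⟨⟨s, t⟩, -, rfl⟩⟩
    refine ⟨(s, t), ?_, rfl⟩
    refine (code_inj (U := U)).1 ?_
    rw [h]
    funext i
    exact Set.mem_iInter.1 hz i
  · rintro ⟨⟨s, t⟩, hst, rfl⟩
    refine ⟨Set.mem_iInter.2 fun i => ?_, ⟨_, trivial, rfl⟩⟩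
    have : r s = t := hst
    subst this
    exact (congrFun (h s) i).symm

theorem DefFun.id [DefDom L C T] : DefFun L C fun t : T => t :=
  DefFun.of_reindex _ (fun i => i) fun _ => rfl

theorem DefFun.fst [DefDom L C S] [DefDom L C T] : DefFun L C fun p : S × T => p.1 :=
  DefFun.of_reindex _ Sum.inl fun _ => rfl

theorem DefFun.snd [DefDom L C S] [DefDom L C T] : DefFun L C fun p : S × T => p.2 :=
  DefFun.of_reindex _ Sum.inr fun _ => rfl

theorem DefFun.mono {C' : Set U} {f : S → T} (hf : DefFun L C f) (h : C ⊆ C') :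
    DefFun L C' f := DefPred.mono hf h

theorem DefPred.comp [DefDom L C S] [DefDom L C T] {P : T → Prop} (hP : DefPred L C P)
    {f : S → T} (hf : DefFun L C f) : DefPred L C fun s => P (f s) :=
  (DefPred.exists (DefPred.and hf hP.snd)).congr fun s => by simp

theorem DefFun.pair [DefDom L C R] [DefDom L C S] [DefDom L C T] {f : R → S} {g : R → T}
    (hf : DefFun L C f) (hg : DefFun L C g) : DefFun L C fun r => (f r, g r) := by
  have h1 : DefPred L C fun p : R × (S × T) => f p.1 = p.2.1 :=
    DefPred.reindex hf (fun p : R × (S × T) => (p.1, p.2.1))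
      (Sum.elim Sum.inl (Sum.inr ∘ Sum.inl)) fun p => by
        funext i; rcases i with i | i <;> rfl
  have h2 : DefPred L C fun p : R × (S × T) => g p.1 = p.2.2 :=
    DefPred.reindex hg (fun p : R × (S × T) => (p.1, p.2.2))
      (Sum.elim Sum.inl (Sum.inr ∘ Sum.inr)) fun p => by
        funext i; rcases i with i | i <;> rfl
  exact (h1.and h2).congr fun p => by simp [Prod.ext_iff]

theorem DefFun.comp [DefDom L C R] [DefDom L C S] [DefDom L C T] {g : S → T} {f : R → S}
    (hg : DefFun L C g) (hf : DefFun L C f) : DefFun L C fun r => g (f r) :=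
  DefPred.comp (P := fun p : S × T => g p.1 = p.2) hg
    (f := fun p : R × T => (f p.1, p.2)) (DefFun.pair (DefPred.reindex hf
      (fun p : (R × T) × S => (p.1.1, p.2)) (Sum.elim (Sum.inl ∘ Sum.inl) Sum.inr)
      fun p => by funext i; rcases i with i | i <;> rfl) DefFun.snd)

theorem DefFun.comp₂ [DefDom L C R] [DefDom L C S] [DefDom L C T] [DefDom L C V]
    {h : S → T → V} {f : R → S} {g : R → T}
    (hh : DefFun L C fun p : S × T => h p.1 p.2) (hf : DefFun L C f) (hg : DefFun L C g) :
    DefFun L C fun r => h (f r) (g r) :=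
  DefFun.comp hh (hf.pair hg)

theorem DefPred.eq [DefDom L C S] [DefDom L C T] {f g : S → T} (hf : DefFun L C f)
    (hg : DefFun L C g) : DefPred L C fun s => f s = g s :=
  DefPred.comp (P := fun p : T × T => p.1 = p.2) DefFun.id (hf.pair hg)

theorem DefPred.const [DefDom L C T] (p : Prop) : DefPred L C fun _ : T => p := by
  by_cases hp : p
  · exact DefDom.defPred_true.congr (by simp [hp])
  · exact DefDom.defPred_true.not.congr (by simp [hp])

theorem DefFun.const [DefDom L C S] [DefDom L C T] {t : T} (ht : DefPred L C fun t' => t = t') :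
    DefFun L C fun _ : S => t :=
  DefPred.snd ht

theorem DefFun.val {P : T → Prop} [DefDom L C T] [DefDom L C {t // P t}] :
    DefFun L C fun t : {t // P t} => t.1 :=
  DefFun.of_reindex _ (fun i => i) fun _ => rfl

theorem DefFun.subtype_mk {P : T → Prop} [DefDom L C S] [DefDom L C T] [DefDom L C {t // P t}]
    {f : S → T} (hf : DefFun L C f) (h : ∀ s, P (f s)) :
    DefFun L C fun s => (⟨f s, h s⟩ : {t // P t}) :=
  (DefPred.reindex hf (fun p : S × {t // P t} => (p.1, p.2.1)) (fun i => i)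
    fun _ => rfl).congr fun p => by rw [Subtype.ext_iff]

theorem DefPred.forall [DefDom L C S] [DefDom L C T] {P : S × T → Prop} (hP : DefPred L C P) :
    DefPred L C fun s => ∀ t, P (s, t) :=
  (DefPred.not (DefPred.exists (DefPred.not hP))).congr fun s => by simp

theorem DefFun.congr {f g : S → T} (hf : DefFun L C f) (h : ∀ s, f s = g s) : DefFun L C g :=
  DefPred.congr hf fun p => by rw [h]

/-- The predicate of being equal to an element coded by parameters. -/
theorem DefPred.eq_of_mem [DefDom L C T] {t : T} (ht : ∀ i, codeOf U t i ∈ C) :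
    DefPred L C fun t' => t = t' := by
  have h1 := (Set.definable_iInter_of_finite fun i =>
    (Set.Definable.singleton_of_mem L (ht i)).preimage_comp (fun _ : Fin 1 => i)).inter
    (DefDom.defPred_true (L := L) (C := C) (T := T))
  refine (congrArg (C.Definable L) ?_).mp h1
  ext z
  constructor
  · rintro ⟨hz, ⟨s, -, rfl⟩⟩
    refine ⟨s, (code_inj (U := U)).1 (funext fun i => ?_), rfl⟩
    exact (Set.mem_iInter.1 hz i).symm
  · rintro ⟨s, h, rfl⟩
    obtain rfl : t = s := h
    exact ⟨Set.mem_iInter.2 fun i => rfl, ⟨t, trivial, rfl⟩⟩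

theorem defPred_tuple_prod {ι κ : Type} [Finite ι] [Finite κ] {P : (ι → U) × (κ → U) → Prop} :
    DefPred L C P ↔ C.Definable L {z : ι ⊕ κ → U | P (z ∘ Sum.inl, z ∘ Sum.inr)} := by
  refine iff_of_eq (congrArg (C.Definable L) ?_)
  ext z
  constructor
  · rintro ⟨p, hp, rfl⟩
    exact hp
  · intro h
    exact ⟨_, h, Sum.elim_comp_inl_inr z⟩

variable (C T) in
/-- A definable domain is in definable bijection with a definable set. -/
theorem exists_defSet_equiv [DefDom L C T] : ∃ (D : DefSet L C) (e : T ≃ D),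
    DefFun L C e ∧ DefFun L C e.symm := by
  obtain ⟨n, ⟨ε⟩⟩ := Finite.exists_equiv_fin (Coded.Idx U T)
  let D : DefSet L C := ⟨n, Set.range fun t : T => codeOf U t ∘ ε.symm, by
    refine (congrArg (C.Definable L) ?_).mp
      ((DefDom.defPred_true (L := L) (C := C) (T := T)).image_comp ε.symm)
    ext z
    constructor
    · rintro ⟨_, ⟨t, -, rfl⟩, rfl⟩
      exact ⟨t, rfl⟩
    · rintro ⟨t, rfl⟩
      exact ⟨_, ⟨t, trivial, rfl⟩, rfl⟩⟩
  have : DefDom L C D.carrier := defDom_set D.definable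
  let f : T → D := fun t => ⟨codeOf U t ∘ ε.symm, t, rfl⟩
  have hf : Function.Bijective f := by
    constructor
    · intro s t h
      refine (code_inj (U := U)).1 (funext fun i => ?_)
      have := congrFun (congrArg Subtype.val h) (ε i)
      simpa [f] using this
    · rintro ⟨_, t, rfl⟩
      exact ⟨t, rfl⟩
  refine ⟨D, Equiv.ofBijective f hf, DefFun.of_reindex _ ε.symm fun t => rfl, ?_⟩
  refine DefFun.of_reindex _ ε fun d => ?_
  obtain ⟨t, rfl⟩ := hf.2 d
  rw [show (Equiv.ofBijective f hf).symm (f t) = t from (Equiv.ofBijective f hf).symm_apply_apply t]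
  funext i
  show codeOf U t i = codeOf U t (ε.symm (ε i))
  rw [ε.symm_apply_apply]

end

section DefMaps

variable {l m n : ℕ} {D : Set (Fin l → U)} {E : Set (Fin m → U)} {F : Set (Fin n → U)}

theorem isDefMap_iff {f : D → E} : IsDefMap (L := L) C f ↔ DefFun L C f := by
  refine iff_of_eq (congrArg (C.Definable L) ?_)
  ext z
  constructor
  · rintro ⟨x, rfl⟩
    exact ⟨(x, f x), rfl, rfl⟩
  · rintro ⟨⟨x, y⟩, h, rfl⟩
    have : f x = y := h
    subst this
    exact ⟨x, rfl⟩

theorem isDefMap₂_iff {f : D → E → F} :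
    IsDefMap₂ (L := L) C f ↔ DefFun L C fun p : D × E => f p.1 p.2 := by
  refine iff_of_eq (congrArg (C.Definable L) ?_)
  ext z
  constructor
  · rintro ⟨x, rfl⟩
    exact ⟨(x, f x.1 x.2), rfl, rfl⟩
  · rintro ⟨⟨x, y⟩, h, rfl⟩
    have : f x.1 x.2 = y := h
    subst this
    exact ⟨x, rfl⟩

/-- Definability of the graph of a partially defined binary map. -/
theorem definable_partial_iff {Q : D × E → Prop} {f : ∀ p, Q p → F} :
    C.Definable L (Set.range fun p : {p : D × E // Q p} =>
      Sum.elim (Sum.elim p.1.1.1 p.1.2.1) (f p.1 p.2).1) ↔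
    DefPred L C fun p : (D × E) × F => ∃ h, f p.1 h = p.2 := by
  refine iff_of_eq (congrArg (C.Definable L) ?_)
  ext z
  constructor
  · rintro ⟨⟨x, hx⟩, rfl⟩
    exact ⟨(x, f x hx), ⟨hx, rfl⟩, rfl⟩
  · rintro ⟨⟨x, y⟩, h, rfl⟩
    obtain ⟨hx, h⟩ : ∃ hx, f x hx = y := h
    exact ⟨⟨x, hx⟩, by rw [← h]; rfl⟩

end DefMaps

end Calculus

end ModelGalois

namespace ModelGalois

/-! ### The Galois action on algebraic elements, and definability of equivariant finite data -/

section GaloisAction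

open Filter Topology

variable {L : FirstOrder.Language.{u, v}} {U : Type w} [L.Structure U] {K : Set U}

section

variable {S T V : Type*} [Coded U S] [Coded U T] [Coded U V]

variable (L K) in
/-- An element of a coded type is algebraic when its coordinates are. -/
def Alg (t : T) : Prop := ∀ i, codeOf U t i ∈ acl L K

theorem Alg.of_defFun {f : S → T} (hf : DefFun L K f) {s : S} (hs : Alg L K s) :
    Alg L K (f s) := by
  refine mem_acl_of_graph hf ?_ ⟨(s, f s), rfl, rfl⟩ hs
  rintro x y y' ⟨p, hp, hp'⟩ ⟨q, hq, hq'⟩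
  obtain ⟨rfl, rfl⟩ := Sum.elim_eq_iff.1 hp'
  obtain ⟨h1, rfl⟩ := Sum.elim_eq_iff.1 hq'
  have hp : f p.1 = p.2 := hp
  have hq : f q.1 = q.2 := hq
  rw [← hp, ← hq, (code_inj (U := U)).1 h1]

theorem Alg.pair {s : S} {t : T} (hs : Alg L K s) (ht : Alg L K t) : Alg L K (s, t) := by
  rintro (i | i)
  · exact hs i
  · exact ht i

theorem Alg.snd {p : S × T} (h : Alg L K p) : Alg L K p.2 := fun i => h (Sum.inr i)

theorem Alg.of_finite {P : T → Prop} (hP : DefPred L K P) (hfin : {t | P t}.Finite) {t : T}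
    (ht : P t) : Alg L K t :=
  mem_acl_of_finite hP (hfin.image _) ⟨t, ht, rfl⟩

/-- The smallest `K`-definable set containing a given algebraic element. -/
theorem Alg.exists_minimal [DefDom L K T] {t : T} (ht : Alg L K t) :
    ∃ P : T → Prop, DefPred L K P ∧ {t | P t}.Finite ∧ P t ∧
      ∀ Q : T → Prop, DefPred L K Q → Q t → ∀ s, P s → Q s := by
  classical
  -- A finite `K`-definable set containing `t` of least cardinality works: intersecting it with
  -- another such condition true of `t` cannot shrink it.
  have hex : ∃ n, ∃ P : T → Prop, DefPred L K P ∧ {t | P t}.Finite ∧ P t ∧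
      {t | P t}.ncard = n := by
    choose s hfin hdef hmem using ht
    refine ⟨_, fun t' => ∀ i, codeOf U t' i ∈ s i, ?_, ?_, hmem, rfl⟩
    · have h1 : K.Definable L (⋂ i, {z : Coded.Idx U T → U | z i ∈ s i}) :=
        Set.definable_iInter_of_finite fun i =>
          (hdef i).preimage_comp (fun _ : Fin 1 => i)
      have h2 := h1.inter (DefDom.defPred_true (L := L) (C := K) (T := T))
      refine (congrArg (K.Definable L) ?_).mp h2
      ext z
      constructor
      · rintro ⟨hz, ⟨t', -, rfl⟩⟩
        exact ⟨t', fun i => Set.mem_iInter.1 hz i, rfl⟩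
      · rintro ⟨t', h, rfl⟩
        exact ⟨Set.mem_iInter.2 h, ⟨t', trivial, rfl⟩⟩
    · refine Set.Finite.of_finite_image (f := codeOf U)
        ((Set.Finite.pi' hfin).subset ?_) (Coded.code_injective.injOn)
      rintro _ ⟨t', h, rfl⟩ i
      exact h i
  obtain ⟨P, hP, hfin, hPt, hcard⟩ := Nat.find_spec hex
  refine ⟨P, hP, hfin, hPt, fun Q hQ hQt s hs => ?_⟩
  have hsub : {t | P t ∧ Q t} ⊆ {t | P t} := fun t h => h.1
  have hle : {t | P t}.ncard ≤ {t | P t ∧ Q t}.ncard := by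
    rw [hcard]
    exact Nat.find_min' hex ⟨_, hP.and hQ, hfin.subset hsub, ⟨hPt, hQt⟩, rfl⟩
  have heq := Set.eq_of_subset_of_ncard_le hsub hle hfin
  have : s ∈ {t | P t ∧ Q t} := by rw [heq]; exact hs
  exact this.2

theorem exists_gal [DefDom L K T] (σ : galoisGroup L K) {t : T} (ht : Alg L K t) :
    ∃ t' : T, ∀ i, codeOf U t' i = σ.1 ⟨codeOf U t i, ht i⟩ := by
  obtain ⟨t', -, h⟩ := (galois_mem_iff σ (DefDom.defPred_true (L := L) (C := K) (T := T))
    fun i => ⟨codeOf U t i, ht i⟩).1 ⟨t, trivial, rfl⟩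
  exact ⟨t', fun i => congrFun h i⟩

open Classical in
/-- The action of the Galois group on algebraic elements of a coded type (extended by the identity
to other elements). -/
noncomputable def gal (σ : galoisGroup L K) (t : T) : T :=
  if h : ∃ t' : T, ∃ ht : Alg L K t, ∀ i, codeOf U t' i = σ.1 ⟨codeOf U t i, ht i⟩
  then h.choose else t

theorem gal_eq {σ : galoisGroup L K} {t t' : T} (ht : Alg L K t)
    (h : ∀ i, codeOf U t' i = σ.1 ⟨codeOf U t i, ht i⟩) : gal σ t = t' := by
  have hex : ∃ t' : T, ∃ ht : Alg L K t, ∀ i, codeOf U t' i = σ.1 ⟨codeOf U t i, ht i⟩ :=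
    ⟨t', ht, h⟩
  rw [gal, dif_pos hex]
  obtain ⟨_, h'⟩ := hex.choose_spec
  refine (code_inj (U := U)).1 (funext fun i => ?_)
  rw [h', h]

theorem gal_one {t : T} (ht : Alg L K t) : gal (1 : galoisGroup L K) t = t :=
  gal_eq ht fun _ => rfl

variable [DefDom L K S] [DefDom L K T] [DefDom L K V]

theorem codeOf_gal (σ : galoisGroup L K) {t : T} (ht : Alg L K t) (i : Coded.Idx U T) :
    codeOf U (gal σ t) i = σ.1 ⟨codeOf U t i, ht i⟩ := by
  obtain ⟨t', h⟩ := exists_gal σ ht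
  rw [gal_eq ht h, h]

theorem Alg.map_gal (σ : galoisGroup L K) {t : T} (ht : Alg L K t) : Alg L K (gal σ t) := fun i => by
  rw [codeOf_gal σ ht]
  exact Subtype.coe_prop _

theorem gal_mul (σ τ : galoisGroup L K) {t : T} (ht : Alg L K t) :
    gal (σ * τ) t = gal σ (gal τ t) := by
  refine gal_eq ht fun i => ?_
  rw [codeOf_gal σ (ht.map_gal τ)]
  have : (⟨codeOf U (gal τ t) i, ht.map_gal τ i⟩ : acl L K) = τ.1 ⟨codeOf U t i, ht i⟩ :=
    Subtype.ext (codeOf_gal τ ht i)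
  rw [this]
  rfl

theorem gal_pair (σ : galoisGroup L K) {s : S} {t : T} (hs : Alg L K s) (ht : Alg L K t) :
    gal σ (s, t) = (gal σ s, gal σ t) := by
  refine gal_eq (hs.pair ht) ?_
  rintro (i | i)
  · exact codeOf_gal σ hs i
  · exact codeOf_gal σ ht i

theorem gal_pred {P : T → Prop} (hP : DefPred L K P) (σ : galoisGroup L K) {t : T}
    (ht : Alg L K t) : P (gal σ t) ↔ P t := by
  have h := galois_mem_iff σ hP fun i => ⟨codeOf U t i, ht i⟩
  have h1 : ∀ t' : T, codeOf U t' ∈ codeOf U '' {t | P t} ↔ P t' := fun t' =>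
    Coded.code_injective.mem_set_image
  rw [← h1, ← h1 t]
  refine Iff.trans ?_ h.symm
  rw [show codeOf U (gal σ t) = _ from funext fun i => codeOf_gal σ ht i]

theorem gal_map {f : S → T} (hf : DefFun L K f) (σ : galoisGroup L K) {s : S}
    (hs : Alg L K s) : f (gal σ s) = gal σ (f s) := by
  have h := (gal_pred (P := fun p : S × T => f p.1 = p.2) hf σ
    (hs.pair (hs.of_defFun hf))).2 rfl
  rwa [gal_pair σ hs (hs.of_defFun hf)] at h

theorem gal_map₂ {f : S → T → V} (hf : DefFun L K fun p : S × T => f p.1 p.2)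
    (σ : galoisGroup L K) {s : S} {t : T} (hs : Alg L K s) (ht : Alg L K t) :
    f (gal σ s) (gal σ t) = gal σ (f s t) := by
  have h := gal_map hf σ (hs.pair ht)
  rwa [gal_pair σ hs ht] at h

end

theorem eventually_apply_eq (σ : galoisGroup L K) (a : acl L K) :
    ∀ᶠ τ in 𝓝 σ, τ.1 a = σ.1 a := by
  let : TopologicalSpace (acl L K) := ⊥
  have : DiscreteTopology (acl L K) := ⟨rfl⟩
  have hc : Continuous fun τ : galoisGroup L K => τ.1 a :=
    (continuous_apply a).comp (continuous_induced_dom (f := fun (σ : galoisGroup L K)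
      (a : acl L K) => σ.1 a))
  exact hc.continuousAt.eventually (IsOpen.mem_nhds (isOpen_discrete {σ.1 a}) rfl)

/-- Pointwise stabilisers of finite sets form a neighbourhood basis. -/
theorem exists_finset_of_mem_nhds {σ : galoisGroup L K} {s : Set (galoisGroup L K)}
    (hs : s ∈ 𝓝 σ) : ∃ F : Set (acl L K), F.Finite ∧ ∀ τ, (∀ a ∈ F, τ.1 a = σ.1 a) → τ ∈ s := by
  let : TopologicalSpace (acl L K) := ⊥
  have : DiscreteTopology (acl L K) := ⟨rfl⟩
  rw [nhds_induced, Filter.mem_comap] at hs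
  obtain ⟨t, ht, hts⟩ := hs
  rw [nhds_pi, Filter.mem_pi] at ht
  obtain ⟨F, hF, V, hV, hVt⟩ := ht
  refine ⟨F, hF, fun τ hτ => hts (hVt fun a ha => ?_)⟩
  show τ.1 a ∈ V a
  rw [hτ a ha]
  exact mem_of_mem_nhds (hV a)

section

variable {S T : Type*} [Coded U S] [Coded U T] [DefDom L K S] [DefDom L K T]

theorem eventually_gal_eq (σ : galoisGroup L K) {t : T} (ht : Alg L K t) :
    ∀ᶠ τ in 𝓝 σ, gal τ t = gal σ t := by
  have h : ∀ᶠ τ in 𝓝 σ, ∀ i, τ.1 ⟨codeOf U t i, ht i⟩ = σ.1 ⟨codeOf U t i, ht i⟩ :=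
    Filter.eventually_all.2 fun i => eventually_apply_eq σ _
  filter_upwards [h] with τ hτ
  refine gal_eq ht fun i => ?_
  rw [codeOf_gal σ ht, hτ]

end

/-- Preservation in one direction is enough. Complements of definable sets are definable, the
diagonal gives injectivity, and `g` maps each finite `K`-definable set of algebraic elements
injectively, hence surjectively, to itself. Points of `dcl(K)` are fixed because their singletons
are preserved. -/
theorem exists_galois_of_preserves (g : acl L K → acl L K)
    (hg : ∀ (n : ℕ) (D : Set (Fin n → U)), K.Definable L D → ∀ x : Fin n → acl L K,
      (fun i => (x i : U)) ∈ D → (fun i => (g (x i) : U)) ∈ D) :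
    ∃ σ : galoisGroup L K, ∀ a, σ.1 a = g a := by
  classical
  have hiff : ∀ (n : ℕ) (D : Set (Fin n → U)), K.Definable L D → ∀ x : Fin n → acl L K,
      (fun i => (x i : U)) ∈ D ↔ (fun i => (g (x i) : U)) ∈ D := fun n D hD x =>
    ⟨hg n D hD x, fun h => by_contra fun h' => hg n Dᶜ hD.compl x h' h⟩
  have hinj : Function.Injective g := fun a b h => by
    have := (hiff 2 _ (Set.Definable.diagonal (L := L) K) ![a, b]).2 (by
      show (g (![a, b] 0) : U) = (g (![a, b] 1) : U)
      exact congrArg Subtype.val h)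
    exact Subtype.ext this
  have hsurj : Function.Surjective g := fun b => by
    obtain ⟨s, hfin, hdef, hbs⟩ := b.2
    let s' : Set (acl L K) := {a | (a : U) ∈ s}
    have hmaps : Set.MapsTo g s' s' := fun a ha => hg 1 _ hdef (fun _ => a) ha
    have hfin' : s'.Finite := hfin.preimage Subtype.val_injective.injOn
    have : Finite s' := hfin'
    obtain ⟨a, ha⟩ := Finite.surjective_of_injective
      (hmaps.restrict_inj.2 hinj.injOn) (⟨b, hbs⟩ : s')
    exact ⟨a, congrArg Subtype.val ha⟩
  refine ⟨⟨Equiv.ofBijective g ⟨hinj, hsurj⟩, fun φ => ?_, fun a ha => ?_⟩, fun _ => rfl⟩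
  -- Only finitely many variables of `φ` occur, so it is a condition on a finite tuple.
  · let e := φ.freeVarFinset.equivFin
    let ψ : L.Formula (Fin φ.freeVarFinset.card) := φ.restrictFreeVar e
    have hψ : ∀ v : acl L K → U, ψ.Realize (fun i => v (e.symm i)) ↔ φ.Realize v := fun v =>
      Language.BoundedFormula.realize_restrictFreeVar v (by simp)
    have hdef : K.Definable L {z | ψ.Realize z} :=
      (Set.empty_definable_iff.2 ⟨ψ, rfl⟩).mono (Set.empty_subset K)
    have := hiff _ _ hdef fun i => e.symm i
    rw [← hψ, ← hψ]
    exact this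
  · exact Subtype.ext (hg 1 _ ha (fun _ => a) rfl)

/-- The values `f j a` eventually lie in a finite set, so the ultrafilter singles out one of them.
On a finite tuple the limit agrees with a single `f j` that preserves the given definable set. This
replaces any saturation assumption on `U`. -/
theorem exists_galois_of_ultrafilter {I : Type*} (𝒰 : Ultrafilter I)
    (f : I → acl L K → acl L K)
    (hf : ∀ (n : ℕ) (D : Set (Fin n → U)), K.Definable L D → ∀ x : Fin n → acl L K,
      (fun i => (x i : U)) ∈ D → ∀ᶠ j in 𝒰, (fun i => (f j (x i) : U)) ∈ D) :
    ∃ σ : galoisGroup L K, ∀ a, ∀ᶠ j in 𝒰, f j a = σ.1 a := by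
  have hlim : ∀ a, ∃ b, ∀ᶠ j in 𝒰, f j a = b := fun a => by
    obtain ⟨s, hfin, hdef, has⟩ := a.2
    have h := hf 1 _ hdef (fun _ => a) has
    have hfin' : {b : acl L K | (b : U) ∈ s}.Finite := hfin.preimage Subtype.val_injective.injOn
    have h' : ∀ᶠ j in 𝒰, ∃ b ∈ {b : acl L K | (b : U) ∈ s}, f j a = b := by
      filter_upwards [h] with j hj
      exact ⟨f j a, hj, rfl⟩
    obtain ⟨b, -, hb⟩ := (Ultrafilter.eventually_exists_mem_iff hfin').1 h'
    exact ⟨b, hb⟩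
  choose g hg using hlim
  obtain ⟨σ, hσ⟩ := exists_galois_of_preserves g fun n D hD x hx => by
    have h1 : ∀ᶠ j in 𝒰, ∀ i, f j (x i) = g (x i) := Filter.eventually_all.2 fun i => hg _
    obtain ⟨j, hj, hj'⟩ := (h1.and (hf n D hD x hx)).exists
    have e : (fun i => (g (x i) : U)) = fun i => (f j (x i) : U) := funext fun i => by rw [hj]
    rw [e]
    exact hj'
  exact ⟨σ, fun a => (hg a).mono fun j hj => hj.trans (hσ a).symm⟩

/-- The pointwise limit of an ultrafilter of automorphisms is again an automorphism. -/
instance : CompactSpace (galoisGroup L K) := by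
  refine ⟨isCompact_iff_ultrafilter_le_nhds.2 fun 𝒰 _ => ?_⟩
  obtain ⟨σ, hσ⟩ := exists_galois_of_ultrafilter 𝒰 (fun τ a => τ.1 a) fun n D hD x hx =>
    Filter.Eventually.of_forall fun τ => (galois_mem_iff τ hD x).1 hx
  refine ⟨σ, trivial, fun s hs => ?_⟩
  obtain ⟨F, hF, hFs⟩ := exists_finset_of_mem_nhds hs
  have h : ∀ᶠ τ in (𝒰 : Filter (galoisGroup L K)), ∀ a ∈ F, τ.1 a = σ.1 a :=
    (Filter.eventually_all_finite hF).2 fun a _ => hσ a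
  exact h.mono hFs

section

variable {S T : Type*} [Coded U S] [Coded U T] [DefDom L K S] [DefDom L K T]

/-- An algebraic element is Galois conjugate to any element with the same type over `K`. -/
theorem exists_gal_eq {s t : T} (hs : Alg L K s)
    (h : ∀ P : T → Prop, DefPred L K P → P s → P t) : ∃ σ : galoisGroup L K, gal σ s = t := by
  classical
  -- Extension of `s ↦ t` to a finite set `F`: the minimal `K`-definable set `P` of the tuple `(s,
  -- F)` projects to a condition true of `s`, hence of `t`. A witness `b` over `t` satisfies every
  -- `K`-definable condition true of `(s, F)`.
  have key : ∀ F : Finset (acl L K), ∃ b : Fin F.card → acl L K,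
      ∀ P : T × (Fin F.card → U) → Prop, DefPred L K P → P (s, fun i => (F.equivFin.symm i : acl L K)) →
        P (t, fun i => b i) := fun F => by
    have ha : Alg L K fun i => ((F.equivFin.symm i : acl L K) : U) := fun i => Subtype.coe_prop _
    obtain ⟨P, hP, hfin, hPs, hmin⟩ := (hs.pair ha).exists_minimal
    obtain ⟨b, hb⟩ := h _ hP.exists ⟨_, hPs⟩
    have hb' : Alg L K b := (Alg.of_finite hP hfin hb).snd
    exact ⟨fun i => ⟨b i, hb' i⟩, fun Q hQ hQs => hmin Q hQ hQs _ hb⟩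
  choose b hb using key
  -- The value outside `F` is immaterial: along the ultrafilter every given `a` eventually lies in
  -- `F`.
  let f : Finset (acl L K) → acl L K → acl L K := fun F a =>
    if ha : a ∈ F then b F (F.equivFin ⟨a, ha⟩) else a
  have hfF : ∀ (F : Finset (acl L K)) (a : acl L K) (ha : a ∈ F),
      f F a = b F (F.equivFin ⟨a, ha⟩) := fun F a ha => dif_pos ha
  have hev : ∀ a : acl L K, ∀ᶠ F : Finset (acl L K) in ((Ultrafilter.of atTop : Ultrafilter (Finset (acl L K))) :
      Filter (Finset (acl L K))),
      a ∈ F := fun a => by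
    refine Filter.Eventually.filter_mono (Ultrafilter.of_le atTop) ?_
    filter_upwards [eventually_ge_atTop {a}] with F hF
    exact hF (Finset.mem_singleton_self a)
  obtain ⟨σ, hσ⟩ := exists_galois_of_ultrafilter (Ultrafilter.of atTop) f fun n D hD x hx => by
    have hall : ∀ᶠ F : Finset (acl L K) in ((Ultrafilter.of atTop : Ultrafilter (Finset (acl L K))) :
      Filter (Finset (acl L K))),
      ∀ i, x i ∈ F :=
      Filter.eventually_all.2 fun i => hev (x i)
    filter_upwards [hall] with F hF
    have hP : DefPred L K fun z : Fin n → U => z ∈ D := defPred_tuple.2 hD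
    have := hb F (fun p => (fun i => p.2 (F.equivFin ⟨x i, hF i⟩)) ∈ D)
      (hP.reindex (fun p : T × (Fin F.card → U) => fun i => p.2 (F.equivFin ⟨x i, hF i⟩))
        (fun i => Sum.inr (F.equivFin ⟨x i, hF i⟩)) fun p => rfl)
      (by simpa using hx)
    simpa only [hfF F _ (hF _)] using this
  refine ⟨σ, gal_eq hs fun i => ?_⟩
  let a : acl L K := ⟨codeOf U s i, hs i⟩
  obtain ⟨F, hF, haF⟩ := ((hσ a).and (hev a)).exists
  rw [← hF, hfF F a haF]
  have h1 : DefPred L K fun p : (Fin 1 → U) × (Fin 1 → U) => p.1 = p.2 := DefFun.id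
  -- The condition that coordinate `i` of the first component is the entry indexed by `a` holds for
  -- `(s, F)`, so it passes to `t`.
  have h2 := hb F (fun p => (fun _ : Fin 1 => codeOf U p.1 i) =
      (fun _ : Fin 1 => p.2 (F.equivFin ⟨a, haF⟩)))
    (h1.reindex (fun p : T × (Fin F.card → U) =>
      ((fun _ : Fin 1 => codeOf U p.1 i), (fun _ : Fin 1 => p.2 (F.equivFin ⟨a, haF⟩))))
      (Sum.elim (fun _ => Sum.inl i) fun _ => Sum.inr (F.equivFin ⟨a, haF⟩)) fun p => by
        funext j; rcases j with j | j <;> rfl)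
    (by simp [a])
  exact congrFun h2 0

/-- Galois orbits of algebraic elements are finite and definable. -/
theorem Alg.finite_orbit {t : T} (ht : Alg L K t) :
    DefPred L K (fun s => ∃ σ : galoisGroup L K, gal σ t = s) ∧
      {s | ∃ σ : galoisGroup L K, gal σ t = s}.Finite := by
  obtain ⟨P, hP, hfin, hPt, hmin⟩ := ht.exists_minimal
  have h : ∀ s, P s ↔ ∃ σ : galoisGroup L K, gal σ t = s := fun s => by
    constructor
    · exact fun hs => exists_gal_eq ht fun Q hQ hQt => hmin Q hQ hQt s hs
    · rintro ⟨σ, rfl⟩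
      exact (gal_pred hP σ ht).2 hPt
  refine ⟨hP.congr h, ?_⟩
  simpa only [h] using hfin

/-- Such a set is a finite union of Galois orbits, each of which is `K`-definable. -/
theorem DefPred.of_finite_of_gal {P : T → Prop} (hfin : {t | P t}.Finite)
    (halg : ∀ t, P t → Alg L K t)
    (hgal : ∀ (σ : galoisGroup L K) t, P t → P (gal σ t)) : DefPred L K P := by
  have h : ∀ F : Set T, F.Finite → (∀ t ∈ F, P t) →
      DefPred L K fun s => ∃ t ∈ F, ∃ σ : galoisGroup L K, gal σ t = s := fun F hF => by
    induction F, hF using Set.Finite.induction_on with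
    | empty => exact fun _ => (DefPred.const False).congr (by simp)
    | @insert a F _ _ ih =>
      intro hP
      refine (DefPred.or (Alg.finite_orbit (halg a (hP a (Set.mem_insert _ _)))).1
        (ih fun t ht => hP t (Set.mem_insert_of_mem _ ht))).congr fun s => ?_
      simp only [Set.mem_insert_iff, exists_eq_or_imp]
  refine (h _ hfin fun _ ht => ht).congr fun s => ⟨?_, fun hs => ⟨s, hs, 1, gal_one (halg s hs)⟩⟩
  rintro ⟨t, ht, σ, rfl⟩
  exact hgal σ t ht

/-- An equivariant map on a finite domain is definable. -/
theorem DefFun.of_finite_of_gal [Finite S] (halg : ∀ s : S, Alg L K s) {f : S → T}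
    (hf : ∀ s, Alg L K (f s)) (hgal : ∀ (σ : galoisGroup L K) s, f (gal σ s) = gal σ (f s)) :
    DefFun L K f := by
  refine DefPred.of_finite_of_gal ?_ ?_ ?_
  · refine (Set.finite_range fun s => (s, f s)).subset ?_
    rintro ⟨s, t⟩ h
    exact ⟨s, Prod.ext rfl h⟩
  · rintro ⟨s, t⟩ h
    obtain rfl : f s = t := h
    exact (halg s).pair (hf s)
  · rintro σ ⟨s, t⟩ h
    obtain rfl : f s = t := h
    rw [gal_pair σ (halg s) (hf s)]
    exact hgal σ s

end

end GaloisAction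

end ModelGalois

namespace ModelGalois

/-! ### Idempotence of algebraic closure, and definable quotients -/

section Imaginaries

variable {L : FirstOrder.Language.{u, v}} {U : Type w} [L.Structure U] {C : Set U}

/-- A definable set is the fibre of a `∅`-definable set at a finite tuple of parameters. -/
theorem exists_definable_of_params {α : Type*} {S : Set (α → U)} (hS : C.Definable L S) :
    ∃ (n : ℕ) (k : Fin n → U) (S' : Set (α ⊕ Fin n → U)), (∀ i, k i ∈ C) ∧
      (∅ : Set U).Definable L S' ∧ ∀ z, z ∈ S ↔ Sum.elim z k ∈ S' := by
  classical
  obtain ⟨φ, rfl⟩ := Set.definable_iff_exists_formula_sum.1 hS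
  let F : Finset C := φ.freeVarFinset.toLeft
  let g : φ.freeVarFinset → α ⊕ Fin F.card := fun x =>
    match x with
    | ⟨Sum.inl c, hc⟩ => Sum.inr (F.equivFin ⟨c, Finset.mem_toLeft.2 hc⟩)
    | ⟨Sum.inr a, _⟩ => Sum.inl a
  let ψ : L.Formula (α ⊕ Fin F.card) := φ.restrictFreeVar g
  refine ⟨F.card, fun i => ((F.equivFin.symm i : C) : U), {z | ψ.Realize z},
    fun i => Subtype.coe_prop _, Set.empty_definable_iff.2 ⟨ψ, rfl⟩, fun z => ?_⟩
  refine (Language.BoundedFormula.realize_restrictFreeVar _ ?_).symm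
  rintro ⟨c | a, hc⟩
  · simp [g]
  · simp [g]

theorem DefPred.exists_finite {ι T : Type*} [Finite ι] [Coded U T] {P : ι → T → Prop}
    (hP : ∀ i, DefPred L C (P i)) : DefPred L C fun t => ∃ i, P i t := by
  refine (congrArg (C.Definable L) ?_).mp (Set.definable_iUnion_of_finite hP)
  rw [← Set.image_iUnion]
  congr 1
  ext t
  simp

/-- A finite set with algebraic parameters `k` is the fibre at `k` of a definable family. The union
of the fibres over those `k'` in a finite `C`-definable set around `k` whose fibre is as small as
the one at `k` is finite and `C`-definable. -/
theorem acl_acl_subset (C : Set U) : acl L (acl L C) ⊆ acl L C := by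
  rintro a ⟨s, hfin, hdef, has⟩
  obtain ⟨n, k, S', hk, hS', hS⟩ := exists_definable_of_params hdef
  have hkalg : Alg L C k := hk
  obtain ⟨P, hP, hPfin, hPk, -⟩ := hkalg.exists_minimal
  let V := Fin 1 → U
  let W := Fin n → U
  let φ : V → W → Prop := fun b k' => Sum.elim b k' ∈ S'
  have hφ : DefPred L C fun p : V × W => φ p.1 p.2 := by
    refine defPred_tuple_prod.2 ((congrArg (C.Definable L) ?_).mp (hS'.mono (Set.empty_subset C)))
    ext z
    show z ∈ S' ↔ Sum.elim (z ∘ Sum.inl) (z ∘ Sum.inr) ∈ S'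
    rw [Sum.elim_comp_inl_inr]
  have : Finite s := hfin
  obtain ⟨N, ⟨ε⟩⟩ := Finite.exists_equiv_fin s
  -- The fibre over `k'` has at most `N` elements, where `N` is the size of the fibre `s` over `k`.
  let B : W → Prop := fun k' => ∃ z : Fin N → U, ∀ b, φ b k' → ∃ i, b = fun _ => z i
  have hB : DefPred L C B := by
    refine DefPred.exists (P := fun p : W × (Fin N → U) => ∀ b, φ b p.1 → ∃ i, b = fun _ => p.2 i)
      (DefPred.forall (P := fun q : (W × (Fin N → U)) × V =>
        φ q.2 q.1.1 → ∃ i, q.2 = fun _ => q.1.2 i)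
      (DefPred.imp (hφ.comp (DefFun.snd.pair (DefFun.fst.comp DefFun.fst)))
        (DefPred.exists_finite fun i => DefPred.eq DefFun.snd ?_)))
    exact DefFun.of_reindex _ (fun _ => Sum.inl (Sum.inr i)) fun _ => rfl
  have hBk : B k := ⟨fun i => ε.symm i, fun b hb => by
    have hb' : b 0 ∈ s := (hS b).2 hb
    refine ⟨ε ⟨b 0, hb'⟩, funext fun j => ?_⟩
    beta_reduce
    rw [ε.symm_apply_apply, Subsingleton.elim j 0]⟩
  have hD : DefPred L C fun b : V => ∃ k', φ b k' ∧ P k' ∧ B k' :=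
    DefPred.exists (P := fun p : V × W => φ p.1 p.2 ∧ P p.2 ∧ B p.2) (hφ.and (hP.snd.and hB.snd))
  have hDfin : {b : V | ∃ k', φ b k' ∧ P k' ∧ B k'}.Finite := by
    refine (hPfin.biUnion (t := fun k' => {b | φ b k' ∧ B k'}) fun k' _ => ?_).subset ?_
    · by_cases h : B k'
      · obtain ⟨z, hz⟩ := h
        refine (Set.finite_range fun i => fun _ : Fin 1 => z i).subset ?_
        rintro b ⟨hb, -⟩
        obtain ⟨i, rfl⟩ := hz b hb
        exact ⟨i, rfl⟩
      · exact Set.finite_empty.subset fun b hb => (h hb.2).elim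
    · rintro b ⟨k', h1, h2, h3⟩
      exact Set.mem_biUnion (x := k') h2 ⟨h1, h3⟩
  exact Alg.of_finite (t := fun _ : Fin 1 => a) hD hDfin
    ⟨k, (hS _).1 has, hPk, hBk⟩ (0 : Fin 1)

/-- The value of a map definable over `acl K` at an algebraic element is algebraic. -/
theorem Alg.of_defFun_acl {S T : Type*} [Coded U S] [Coded U T] {f : S → T}
    (hf : DefFun L (acl L C) f) {s : S} (hs : Alg L C s) : Alg L C (f s) := fun i =>
  acl_acl_subset C (Alg.of_defFun hf (fun j => subset_acl _ (hs j)) i)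

/-- Elimination is assumed only for `∅`-definable equivalence relations on full powers of `U`. The
parameters of `r` are therefore turned into extra variables, the resulting family is modified into
an equivalence relation everywhere, and the map obtained is evaluated at the original parameters
`k`. -/
theorem EliminatesImaginaries.exists_map (hEI : EliminatesImaginaries L U) {T : Type*}
    [Coded U T] [DefDom L C T] {r : T → T → Prop} (hr : Equivalence r)
    (hdef : DefPred L C fun p : T × T => r p.1 p.2) :
    ∃ (m : ℕ) (f : T → Fin m → U), DefFun L C f ∧ ∀ s t, f s = f t ↔ r s t := by
  obtain ⟨n, k, S', hk, hS', hS⟩ := exists_definable_of_params hdef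
  let X := Coded.Idx U T → U
  let Y := Fin n → U
  let P : X → X → Y → Prop := fun x y z => Sum.elim (Sum.elim x y) z ∈ S'
  have hP : DefPred L (∅ : Set U) fun p : (X × X) × Y => P p.1.1 p.1.2 p.2 := by
    refine (congrArg ((∅ : Set U).Definable L) ?_).mp hS'
    ext z
    constructor
    · intro h
      have e : Sum.elim (Sum.elim (fun i => z (Sum.inl (Sum.inl i)))
          (fun i => z (Sum.inl (Sum.inr i)))) (fun i => z (Sum.inr i)) = z := by
        funext i; rcases i with (i | i) | i <;> rfl
      refine ⟨((fun i => z (Sum.inl (Sum.inl i)), fun i => z (Sum.inl (Sum.inr i))),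
        fun i => z (Sum.inr i)), ?_, e⟩
      show Sum.elim (Sum.elim _ _) _ ∈ S'
      rw [e]
      exact h
    · rintro ⟨p, hp, rfl⟩
      exact hp
  have hPk : ∀ x y, P x y k ↔ ∃ s t, r s t ∧ codeOf U s = x ∧ codeOf U t = y := by
    intro x y
    show Sum.elim (Sum.elim x y) k ∈ S' ↔ _
    refine (hS (Sum.elim x y)).symm.trans ?_
    constructor
    · rintro ⟨p, hp, h⟩
      obtain ⟨h1, h2⟩ := Sum.elim_eq_iff.1 h
      exact ⟨p.1, p.2, hp, h1, h2⟩
    · rintro ⟨s, t, h, rfl, rfl⟩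
      exact ⟨(s, t), h, rfl⟩
  let sy : Y → Prop := fun z => ∀ q : X × X, P q.1 q.2 z → P q.2 q.1 z
  let tr : Y → Prop := fun z => ∀ q : (X × X) × X, P q.1.1 q.1.2 z ∧ P q.1.2 q.2 z → P q.1.1 q.2 z
  have hsy : DefPred L (∅ : Set U) sy := by
    refine DefPred.forall (P := fun p : Y × (X × X) => P p.2.1 p.2.2 p.1 → P p.2.2 p.2.1 p.1)
      (DefPred.imp ?_ ?_)
    · exact hP.comp (f := fun p : Y × (X × X) => ((p.2.1, p.2.2), p.1))
        (((DefFun.fst.comp DefFun.snd).pair (DefFun.snd.comp DefFun.snd)).pair DefFun.fst)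
    · exact hP.comp (f := fun p : Y × (X × X) => ((p.2.2, p.2.1), p.1))
        (((DefFun.snd.comp DefFun.snd).pair (DefFun.fst.comp DefFun.snd)).pair DefFun.fst)
  have htr : DefPred L (∅ : Set U) tr := by
    have h1 : DefFun L (∅ : Set U) fun p : Y × ((X × X) × X) => p.2.1.1 :=
      DefFun.fst.comp (DefFun.fst.comp DefFun.snd)
    have h2 : DefFun L (∅ : Set U) fun p : Y × ((X × X) × X) => p.2.1.2 :=
      DefFun.snd.comp (DefFun.fst.comp DefFun.snd)
    have h3 : DefFun L (∅ : Set U) fun p : Y × ((X × X) × X) => p.2.2 :=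
      DefFun.snd.comp DefFun.snd
    exact DefPred.forall (P := fun p : Y × ((X × X) × X) =>
      P p.2.1.1 p.2.1.2 p.1 ∧ P p.2.1.2 p.2.2 p.1 → P p.2.1.1 p.2.2 p.1)
      (((hP.comp ((h1.pair h2).pair DefFun.fst)).and
        (hP.comp ((h2.pair h3).pair DefFun.fst))).imp (hP.comp ((h1.pair h3).pair DefFun.fst)))
  -- Pairs are identified only when they have the same parameter `z` and `P` is symmetric and
  -- transitive at `z`. The disjunct `p = q` supplies reflexivity at the remaining points, in
  -- particular at tuples which are not codes.
  let E : Setoid (X × Y) :=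
    { r := fun p q => p = q ∨ (p.2 = q.2 ∧ sy p.2 ∧ tr p.2 ∧ P p.1 q.1 p.2)
      iseqv := by
        refine ⟨fun _ => Or.inl rfl, ?_, ?_⟩
        · rintro ⟨x, z⟩ ⟨y, z'⟩ (h | ⟨h, h1, h2, h3⟩)
          · exact Or.inl h.symm
          · obtain rfl : z = z' := h
            exact Or.inr ⟨rfl, h1, h2, h1 (x, y) h3⟩
        · rintro ⟨x, z⟩ ⟨y, z'⟩ ⟨x', z''⟩ (h | ⟨h, h1, h2, h3⟩)
          · rw [h]; exact fun h => h
          · obtain rfl : z = z' := h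
            rintro (h' | ⟨h', -, -, h3'⟩)
            · rw [← h']; exact Or.inr ⟨rfl, h1, h2, h3⟩
            · obtain rfl : z = z'' := h'
              exact Or.inr ⟨rfl, h1, h2, h2 ((x, y), x') ⟨h3, h3'⟩⟩ }
  have hE : DefPred L (∅ : Set U) fun p : (X × Y) × (X × Y) => E p.1 p.2 := by
    have h1 : DefFun L (∅ : Set U) fun p : (X × Y) × (X × Y) => p.1.1 := DefFun.fst.comp DefFun.fst
    have h2 : DefFun L (∅ : Set U) fun p : (X × Y) × (X × Y) => p.1.2 := DefFun.snd.comp DefFun.fst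
    have h3 : DefFun L (∅ : Set U) fun p : (X × Y) × (X × Y) => p.2.1 := DefFun.fst.comp DefFun.snd
    have h4 : DefFun L (∅ : Set U) fun p : (X × Y) × (X × Y) => p.2.2 := DefFun.snd.comp DefFun.snd
    exact (DefPred.eq DefFun.fst DefFun.snd).or ((DefPred.eq h2 h4).and ((hsy.comp h2).and
      ((htr.comp h2).and (hP.comp ((h1.pair h3).pair h2)))))
  obtain ⟨N, ⟨ε⟩⟩ := Finite.exists_equiv_fin (Coded.Idx U T ⊕ Fin n)
  let g : (Fin N → U) → X × Y := fun v => (fun i => v (ε (Sum.inl i)), fun i => v (ε (Sum.inr i)))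
  let g' : X × Y → (Fin N → U) := fun p => Sum.elim p.1 p.2 ∘ ε.symm
  have hgg' : ∀ p, g (g' p) = p := fun p => by simp [g, g']
  have hg : DefFun L (∅ : Set U) g := DefFun.of_reindex g ε fun v => by
    funext i; rcases i with i | i <;> rfl
  have hg' : DefFun L (∅ : Set U) g' := DefFun.of_reindex g' ε.symm fun v => rfl
  obtain ⟨m, f, hf, hfE⟩ := hEI N (E.comap g) (by
    have := hE.comp ((hg.comp DefFun.fst).pair (hg.comp
      (DefFun.snd (S := Fin N → U) (T := Fin N → U))))
    exact defPred_tuple_prod.1 this)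
  have hf' : DefFun L (∅ : Set U) f := by
    refine defPred_tuple_prod.2 ((congrArg ((∅ : Set U).Definable L) ?_).mp hf)
    ext z
    constructor
    · rintro ⟨x, rfl⟩
      exact rfl
    · intro h
      have h : f (z ∘ Sum.inl) = z ∘ Sum.inr := h
      exact ⟨z ∘ Sum.inl, by beta_reduce; rw [h, Sum.elim_comp_inl_inr]⟩
  refine ⟨m, fun t => f (g' (codeOf U t, k)), ?_, fun s t => ?_⟩
  · have hcode : DefFun L C fun t : T => (codeOf U t : X) :=
      DefFun.of_reindex _ (fun i => i) fun _ => rfl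
    have hkc : DefFun L C fun _ : T => (k : Y) := DefFun.const (DefPred.eq_of_mem hk)
    exact (hf'.mono (Set.empty_subset C)).comp
      ((hg'.mono (Set.empty_subset C)).comp (hcode.pair hkc))
  · rw [hfE]
    show E (g (g' (codeOf U s, k))) (g (g' (codeOf U t, k))) ↔ r s t
    rw [hgg', hgg']
    constructor
    · rintro (h | ⟨-, -, -, h⟩)
      · have : s = t := (code_inj (U := U)).1 (congrArg Prod.fst h)
        rw [this]
        exact hr.refl t
      · obtain ⟨s', t', h, h1, h2⟩ := (hPk _ _).1 h
        rwa [(code_inj (U := U)).1 h1, (code_inj (U := U)).1 h2] at h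
    · intro h
      refine Or.inr ⟨rfl, ?_, ?_, (hPk _ _).2 ⟨s, t, h, rfl, rfl⟩⟩
      · rintro ⟨x, y⟩ h
        obtain ⟨s, t, h, h1, h2⟩ := (hPk _ _).1 h
        exact (hPk _ _).2 ⟨t, s, hr.symm h, h2, h1⟩
      · rintro ⟨⟨x, y⟩, z⟩ ⟨h, h'⟩
        obtain ⟨s, t, h, h1, h2⟩ := (hPk _ _).1 h
        obtain ⟨s', t', h', h1', h2'⟩ := (hPk _ _).1 h'
        obtain rfl : t = s' := (code_inj (U := U)).1 (h2.trans h1'.symm)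
        exact (hPk _ _).2 ⟨s, t', hr.trans h h', h1, h2'⟩

/-- Quotients of definable domains by definable equivalence relations. -/
theorem EliminatesImaginaries.exists_quotient (hEI : EliminatesImaginaries L U) {T : Type*}
    [Coded U T] [DefDom L C T] {r : T → T → Prop} (hr : Equivalence r)
    (hdef : DefPred L C fun p : T × T => r p.1 p.2) :
    ∃ (Q : DefSet L C) (f : T → Q), DefFun L C f ∧ Function.Surjective f ∧
      ∀ s t, f s = f t ↔ r s t := by
  obtain ⟨m, f, hf, hfr⟩ := hEI.exists_map hr hdef
  have hD : DefPred L C fun z : Fin m → U => ∃ t, f t = z :=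
    DefPred.exists (P := fun p : (Fin m → U) × T => f p.2 = p.1)
      (DefPred.eq (hf.comp DefFun.snd) DefFun.fst)
  let Q : DefSet L C := ⟨m, Set.range f, defPred_tuple.1 hD⟩
  have : DefDom L C Q.carrier := defDom_set Q.definable
  refine ⟨Q, fun t => ⟨f t, t, rfl⟩, ?_, ?_, fun s t => ?_⟩
  · exact DefPred.reindex hf (fun p : T × Q => (p.1, p.2.1)) (fun i => i) (fun _ => rfl) |>.congr
      fun p => ⟨fun h => Subtype.ext h, fun h => congrArg Subtype.val h⟩
  · rintro ⟨_, t, rfl⟩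
    exact ⟨t, rfl⟩
  · rw [← hfr, Subtype.ext_iff]

end Imaginaries

/-! ### Algebraic points in families of `A`-torsors -/

section Torsors

variable {L : FirstOrder.Language.{u, v}} {U : Type w} [L.Structure U] {K : Set U}
  {A : DefAbGroup L K}

/-- If torsors under `A` split, a fibre over an algebraic point of a definable family on which `A`
acts simply transitively has an algebraic point. -/
theorem DefAbGroup.TorsorsSplit.exists_alg (hA : A.TorsorsSplit) {Q B : Type*} [Coded U Q]
    [Coded U B] [DefDom L K Q] [DefDom L K B] {π : Q → B} (hπ : DefFun L K π)
    {act : A → Q → Q} (hact : DefFun L K fun p : A × Q => act p.1 p.2)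
    (π_act : ∀ a q, π (act a q) = π q) (act_zero : ∀ q, act 0 q = q)
    (act_add : ∀ a b q, act (a + b) q = act a (act b q))
    (hunique : ∀ q q', π q = π q' → ∃! a, act a q = q')
    {b : B} (hb : Alg L K b) (hne : ∃ q, π q = b) : ∃ q, Alg L K q ∧ π q = b := by
  have hK : K ⊆ acl L K := subset_acl K
  have : DefDom L (acl L K) Q := DefDom.mono hK
  have : DefDom L (acl L K) B := DefDom.mono hK
  have : DefDom L (acl L K) A.carrier := DefDom.mono hK
  have hfib : DefPred L (acl L K) fun q => π q = b :=
    DefPred.eq (hπ.mono hK) (DefFun.const (DefPred.eq_of_mem hb))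
  have : DefDom L (acl L K) {q // π q = b} := hfib.defDom
  obtain ⟨D, e, he, he'⟩ := exists_defSet_equiv (L := L) (acl L K) {q // π q = b}
  let vadd : A → D → D := fun a d =>
    e ⟨act a (e.symm d).1, (π_act a _).trans (e.symm d).2⟩
  have hex : ∀ d d' : D, ∃ a, vadd a d' = d ∧ ∀ a', vadd a' d' = d → a' = a := fun d d' => by
    obtain ⟨a, ha, ha'⟩ := hunique (e.symm d').1 (e.symm d).1
      ((e.symm d').2.trans (e.symm d).2.symm)
    refine ⟨a, ?_, fun a' h => ha' a' ?_⟩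
    · rw [← e.apply_symm_apply d]
      exact congrArg e (Subtype.ext ha)
    · rw [← h]
      simp [vadd]
  choose vsub hvsub hvsub' using hex
  let : AddTorsor A D :=
    { vadd := vadd
      zero_vadd := fun d => by
        show e _ = d
        exact e.eq_symm_apply.1 (Subtype.ext (act_zero _))
      add_vadd := fun a b d => by
        refine congrArg e (Subtype.ext ?_)
        show act (a + b) _ = act a (e.symm (e _)).1
        rw [act_add, e.symm_apply_apply]
      vsub := vsub
      nonempty := hne.elim fun q hq => ⟨e ⟨q, hq⟩⟩
      vsub_vadd' := fun d d' => hvsub d d'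
      vadd_vsub' := fun a d => (hvsub' _ d a rfl).symm }
  obtain ⟨d, hd⟩ := hA D (isDefMap₂_iff.2 (he.comp (DefFun.subtype_mk
    (DefFun.comp₂ (hact.mono hK) DefFun.fst (DefFun.val.comp (he'.comp DefFun.snd))) _)))
  -- The bijection with `D` is definable only over `acl(K)`, so returning to the fibre uses that
  -- `acl` is idempotent.
  exact ⟨(e.symm d).1, Alg.of_defFun_acl (DefFun.val.comp he') (s := d) hd, (e.symm d).2⟩

end Torsors

end ModelGalois

namespace ModelGalois

/-! ### Descent of continuous families to finite definable sets -/

section Descent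

open Filter Topology

variable {L : FirstOrder.Language.{u, v}} {U : Type w} [L.Structure U] {K : Set U}

/-- A locally constant map on a power of the Galois group depends on the action on a finite set. -/
theorem exists_finite_of_isLocallyConstant {β : Type*}
    {f : galoisGroup L K × galoisGroup L K × galoisGroup L K → β} (hf : IsLocallyConstant f) :
    ∃ F : Set (acl L K), F.Finite ∧ ∀ σ σ' τ τ' ρ ρ', (∀ a ∈ F, σ.1 a = σ'.1 a) →
      (∀ a ∈ F, τ.1 a = τ'.1 a) → (∀ a ∈ F, ρ.1 a = ρ'.1 a) → f (σ, τ, ρ) = f (σ', τ', ρ') := by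
  let G := galoisGroup L K
  have hloc : ∀ p : G × G × G, ∃ F : Set (acl L K), F.Finite ∧ ∀ q : G × G × G,
      (∀ a ∈ F, q.1.1 a = p.1.1 a) → (∀ a ∈ F, q.2.1.1 a = p.2.1.1 a) →
      (∀ a ∈ F, q.2.2.1 a = p.2.2.1 a) → f q = f p := fun p => by
    have h := (IsLocallyConstant.iff_eventually_eq f).1 hf p
    rw [Filter.Eventually, mem_nhds_prod_iff] at h
    obtain ⟨s, hs, t, ht, hst⟩ := h
    obtain ⟨t1, ht1, t2, ht2, htt⟩ := mem_nhds_prod_iff.1 ht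
    obtain ⟨F0, hF0, h0⟩ := exists_finset_of_mem_nhds hs
    obtain ⟨F1, hF1, h1⟩ := exists_finset_of_mem_nhds ht1
    obtain ⟨F2, hF2, h2⟩ := exists_finset_of_mem_nhds ht2
    refine ⟨F0 ∪ F1 ∪ F2, (hF0.union hF1).union hF2, fun q hq0 hq1 hq2 => ?_⟩
    exact hst (Set.mk_mem_prod (h0 _ fun a ha => hq0 a (Or.inl (Or.inl ha)))
      (htt (Set.mk_mem_prod (h1 _ fun a ha => hq1 a (Or.inl (Or.inr ha)))
        (h2 _ fun a ha => hq2 a (Or.inr ha)))))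
  choose F hF hFf using hloc
  have hev : ∀ σ : G, ∀ S : Set (acl L K), S.Finite → ∀ᶠ τ in 𝓝 σ, ∀ a ∈ S, τ.1 a = σ.1 a :=
    fun σ S hS => (Filter.eventually_all_finite hS).2 fun a _ => eventually_apply_eq σ a
  -- Finitely many basic neighbourhoods on which `f` is constant cover the compact space; the union
  -- of their finite sets controls `f` globally.
  obtain ⟨t, -, ht⟩ := (isCompact_univ (X := G × G × G)).elim_nhds_subcover
    (fun p => {q | (∀ a ∈ F p, q.1.1 a = p.1.1 a) ∧ (∀ a ∈ F p, q.2.1.1 a = p.2.1.1 a) ∧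
      (∀ a ∈ F p, q.2.2.1 a = p.2.2.1 a)}) fun p _ => by
    have h0 := continuous_fst.continuousAt.eventually (hev p.1 (F p) (hF p))
    have h1 := (continuous_fst.comp continuous_snd).continuousAt.eventually
      (hev p.2.1 (F p) (hF p))
    have h2 := (continuous_snd.comp continuous_snd).continuousAt.eventually
      (hev p.2.2 (F p) (hF p))
    exact h0.and (h1.and h2)
  refine ⟨⋃ p ∈ t, F p, t.finite_toSet.biUnion fun p _ => hF p, fun σ σ' τ τ' ρ ρ' h0 h1 h2 => ?_⟩
  obtain ⟨p, hp, hp0, hp1, hp2⟩ := Set.mem_iUnion₂.1 (ht (Set.mem_univ (σ, τ, ρ)))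
  have hsub : ∀ a ∈ F p, a ∈ ⋃ p ∈ t, F p := fun a ha => Set.mem_biUnion hp ha
  rw [hFf p (σ, τ, ρ) hp0 hp1 hp2]
  refine (hFf p (σ', τ', ρ') (fun a ha => ?_) (fun a ha => ?_) (fun a ha => ?_)).symm
  · exact (h0 a (hsub a ha)).symm.trans (hp0 a ha)
  · exact (h1 a (hsub a ha)).symm.trans (hp1 a ha)
  · exact (h2 a (hsub a ha)).symm.trans (hp2 a ha)

/-- An algebraic tuple with normal stabiliser whose conjugates determine the action on a given
finite set. -/
theorem exists_tuple_of_finite {F : Set (acl L K)} (hF : F.Finite) :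
    ∃ (n : ℕ) (e : Fin n → U), Alg L K e ∧
      (∀ σ τ : galoisGroup L K, gal σ e = gal τ e → ∀ a ∈ F, σ.1 a = τ.1 a) ∧
      ∀ σ τ ρ : galoisGroup L K, gal σ e = gal τ e → gal (σ * ρ) e = gal (τ * ρ) e := by
  -- Saturating `F` under the Galois group makes the pointwise stabiliser normal: if `σ` and `τ`
  -- agree on `F'`, so do `σ * ρ` and `τ * ρ`.
  let F' : Set (acl L K) := ⋃ a ∈ F, Set.range fun σ : galoisGroup L K => σ.1 a
  have hF' : F'.Finite := hF.biUnion fun a _ => by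
    obtain ⟨s, hfin, hdef, has⟩ := a.2
    refine (hfin.preimage (f := ((↑) : acl L K → U)) Subtype.val_injective.injOn).subset ?_
    rintro _ ⟨σ, rfl⟩
    exact (galois_mem_iff σ hdef fun _ => a).1 has
  have : Finite F' := hF'
  obtain ⟨n, ⟨ε⟩⟩ := Finite.exists_equiv_fin F'
  have he : Alg L K fun i : Fin n => ((ε.symm i : acl L K) : U) := fun i => Subtype.coe_prop _
  have hiff : ∀ σ τ : galoisGroup L K,
      (gal σ (fun i : Fin n => ((ε.symm i : acl L K) : U)) = gal τ fun i => ((ε.symm i : acl L K) : U)) ↔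
      ∀ a ∈ F', σ.1 a = τ.1 a := fun σ τ => by
    constructor
    · intro h a ha
      have := congrFun h (ε ⟨a, ha⟩)
      have h1 := codeOf_gal σ he (ε ⟨a, ha⟩)
      have h2 := codeOf_gal τ he (ε ⟨a, ha⟩)
      have h3 := h1.symm.trans (this.trans h2)
      have h4 : (⟨codeOf U (fun i : Fin n => ((ε.symm i : acl L K) : U)) (ε ⟨a, ha⟩), he _⟩ :
          acl L K) = a := Subtype.ext (by
        show ((ε.symm (ε ⟨a, ha⟩) : acl L K) : U) = a
        rw [ε.symm_apply_apply])
      rw [h4] at h3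
      exact Subtype.ext h3
    · intro h
      refine gal_eq he fun i => ?_
      rw [codeOf_gal τ he]
      exact congrArg Subtype.val (h _ (ε.symm i).2).symm
  refine ⟨n, _, he, fun σ τ h a ha => (hiff σ τ).1 h a ?_, fun σ τ ρ h => (hiff _ _).2 fun a ha => ?_⟩
  · exact Set.mem_biUnion ha ⟨1, rfl⟩
  · obtain ⟨b, hb, π, rfl⟩ := Set.mem_iUnion₂.1 ha
    exact (hiff σ τ).1 h _ (Set.mem_biUnion hb ⟨ρ * π, rfl⟩)

/-- A locally constant equivariant family of algebraic elements descends to a definable map on a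
finite definable set on which the Galois group acts transitively. -/
theorem exists_descent {T : Type*} [Coded U T] [DefDom L K T]
    {f : galoisGroup L K × galoisGroup L K × galoisGroup L K → T} (hf : IsLocallyConstant f)
    (halg : ∀ p, Alg L K (f p))
    (hgal : ∀ g σ τ ρ, f (g * σ, τ, ρ) = gal g (f (σ, τ, ρ))) :
    ∃ (E : DefSet L K) (e : E) (F : E → E → E → T), Alg L K e ∧
      (∀ a : E, ∃ σ : galoisGroup L K, gal σ e = a) ∧
      (DefFun L K fun p : E × E × E => F p.1 p.2.1 p.2.2) ∧
      ∀ σ τ ρ, F (gal σ e) (gal τ e) (gal ρ e) = f (σ, σ⁻¹ * τ, τ⁻¹ * ρ) := by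
  obtain ⟨F, hF, hFf⟩ := exists_finite_of_isLocallyConstant hf
  obtain ⟨n, e, he, heF, hnorm⟩ := exists_tuple_of_finite hF
  obtain ⟨E, hE⟩ : ∃ E : DefSet L K, E =
      ⟨n, {z | ∃ σ : galoisGroup L K, gal σ e = z}, defPred_tuple.1 he.finite_orbit.1⟩ := ⟨_, rfl⟩
  obtain ⟨ι, hι⟩ : ∃ ι : Fin E.arity ≃ Fin n, ∀ z : Fin n → U,
      z ∘ ι ∈ E.carrier ↔ ∃ σ : galoisGroup L K, gal σ e = z := by
    subst hE
    exact ⟨Equiv.refl _, fun z => Iff.rfl⟩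
  clear hE
  have hmul : ∀ σ τ ρ : galoisGroup L K, gal σ e = gal τ e → gal (ρ * σ) e = gal (ρ * τ) e :=
    fun σ τ ρ h => by rw [gal_mul _ _ he, gal_mul _ _ he, h]
  have hinv : ∀ σ τ : galoisGroup L K, gal σ e = gal τ e → gal σ⁻¹ e = gal τ⁻¹ e := fun σ τ h => by
    have h1 := hmul _ _ σ⁻¹ (hnorm σ τ τ⁻¹ h)
    rw [mul_inv_cancel, mul_one, ← mul_assoc, inv_mul_cancel, one_mul] at h1
    exact h1.symm
  -- By normality the conjugate of `e` under `σ⁻¹ * τ` depends only on the conjugates under `σ` and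
  -- `τ`, so `F` below does not depend on the chosen representatives `s`.
  have hdiv : ∀ σ σ' τ τ' : galoisGroup L K, gal σ e = gal σ' e → gal τ e = gal τ' e →
      gal (σ⁻¹ * τ) e = gal (σ'⁻¹ * τ') e := fun σ σ' τ τ' h h' =>
    (hmul _ _ _ h').trans (hnorm _ _ _ (hinv _ _ h))
  let e' : E := ⟨e ∘ ι, (hι e).2 ⟨1, gal_one he⟩⟩
  have he' : Alg L K e' := fun i => he (ι i)
  have hgal' : ∀ σ : galoisGroup L K, (gal σ e').1 = gal σ e ∘ ι := fun σ => by
    have : gal σ e' = ⟨gal σ e ∘ ι, (hι _).2 ⟨σ, rfl⟩⟩ := gal_eq he' fun i => codeOf_gal σ he (ι i)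
    rw [this]
  have hiff : ∀ σ τ : galoisGroup L K, gal σ e' = gal τ e' → gal σ e = gal τ e := fun σ τ h => by
    have h := congrArg Subtype.val h
    rw [hgal', hgal'] at h
    exact ι.surjective.injective_comp_right h
  have htrans : ∀ a : E, ∃ σ : galoisGroup L K, gal σ e' = a := fun a => by
    obtain ⟨σ, hσ⟩ := (hι (a.1 ∘ ι.symm)).1 (by
      rw [Function.comp_assoc, ι.symm_comp_self]; exact a.2)
    refine ⟨σ, Subtype.ext ?_⟩
    rw [hgal', hσ, Function.comp_assoc, ι.symm_comp_self]
    rfl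
  choose s hs using htrans
  have key : ∀ σ τ ρ, f (s (gal σ e'), (s (gal σ e'))⁻¹ * s (gal τ e'),
      (s (gal τ e'))⁻¹ * s (gal ρ e')) = f (σ, σ⁻¹ * τ, τ⁻¹ * ρ) := fun σ τ ρ => by
    have h0 : ∀ σ, gal (s (gal σ e')) e = gal σ e := fun σ => hiff _ _ (hs _)
    exact hFf _ _ _ _ _ _ (heF _ _ (h0 σ)) (heF _ _ (hdiv _ _ _ _ (h0 σ) (h0 τ)))
      (heF _ _ (hdiv _ _ _ _ (h0 τ) (h0 ρ)))
  have hEalg : ∀ a : E, Alg L K a := fun a => by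
    rw [← hs a]
    exact he'.map_gal _
  have : Finite E := by
    have h := he'.finite_orbit.2
    rw [show {b : E | ∃ σ : galoisGroup L K, gal σ e' = b} = Set.univ from
      Set.eq_univ_of_forall fun a => ⟨s a, hs a⟩] at h
    exact Set.finite_univ_iff.1 h
  refine ⟨E, e', fun a b d => f (s a, (s a)⁻¹ * s b, (s b)⁻¹ * s d), he', fun a => ⟨_, hs a⟩,
    ?_, key⟩
  refine DefFun.of_finite_of_gal (fun p => (hEalg _).pair ((hEalg _).pair (hEalg _)))
    (fun p => halg _) ?_
  rintro g ⟨a, b, d⟩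
  -- Left multiplication by `g` cancels in `σ⁻¹ * τ` and `τ⁻¹ * ρ`, so it affects only the first
  -- argument of `f`, where `f` is equivariant.
  rw [gal_pair g (hEalg _) ((hEalg _).pair (hEalg _)), gal_pair g (hEalg _) (hEalg _)]
  rw [← hs a, ← hs b, ← hs d, ← gal_mul _ _ he', ← gal_mul _ _ he', ← gal_mul _ _ he']
  simp only [key]
  rw [← hgal]
  simp only [mul_inv_rev, mul_assoc, inv_mul_cancel_left]

end Descent

end ModelGalois

/-! ### Arrow calculus in bounded groupoids -/

namespace ModelGalois

variable {L : FirstOrder.Language.{u, v}} {U : Type w} [L.Structure U] {K : Set U}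

namespace DefGroupoid

variable (X : DefGroupoid L K)

open Classical in
/-- Composition of arrows, with a junk value for arrows which are not composable. -/
noncomputable def mul (g f : X.Ar) : X.Ar := if h : X.src g = X.tgt f then X.comp g f h else g

variable {X}

theorem comp_eq_mul {g f : X.Ar} (h : X.src g = X.tgt f) : X.comp g f h = X.mul g f :=
  (dif_pos h).symm

theorem src_mul {g f : X.Ar} (h : X.src g = X.tgt f) : X.src (X.mul g f) = X.src f := by
  rw [← comp_eq_mul h, X.src_comp]

theorem tgt_mul {g f : X.Ar} (h : X.src g = X.tgt f) : X.tgt (X.mul g f) = X.tgt g := by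
  rw [← comp_eq_mul h, X.tgt_comp]

theorem mul_assoc {k g f : X.Ar} (h : X.src k = X.tgt g) (h' : X.src g = X.tgt f) :
    X.mul (X.mul k g) f = X.mul k (X.mul g f) := by
  have := X.assoc k g f h h'
  simpa only [comp_eq_mul] using this

theorem id_mul {f : X.Ar} {x : X.Ob} (h : X.tgt f = x) : X.mul (X.id x) f = f := by
  subst h
  rw [← comp_eq_mul (X.src_id _), X.id_comp]

theorem mul_id {f : X.Ar} {x : X.Ob} (h : X.src f = x) : X.mul f (X.id x) = f := by
  subst h
  rw [← comp_eq_mul (X.tgt_id _).symm, X.comp_id]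

theorem inv_mul (f : X.Ar) : X.mul (X.inv f) f = X.id (X.src f) := by
  rw [← comp_eq_mul (X.src_inv f), X.inv_comp]

theorem mul_inv (f : X.Ar) : X.mul f (X.inv f) = X.id (X.tgt f) := by
  rw [← comp_eq_mul (X.tgt_inv f).symm, X.comp_inv]

theorem inv_mul_cancel_left {g f : X.Ar} (h : X.src g = X.tgt f) :
    X.mul (X.inv g) (X.mul g f) = f := by
  rw [← mul_assoc (X.src_inv g) h, inv_mul, id_mul h.symm]

theorem mul_inv_cancel_left {g f : X.Ar} (h : X.tgt g = X.tgt f) :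
    X.mul g (X.mul (X.inv g) f) = f := by
  rw [← mul_assoc (X.tgt_inv g).symm ((X.src_inv g).trans h), mul_inv, id_mul h.symm]

theorem mul_inv_cancel_right {g f : X.Ar} (h : X.src g = X.src f) :
    X.mul (X.mul g (X.inv f)) f = g := by
  rw [mul_assoc (h.trans (X.tgt_inv f).symm) (X.src_inv f), inv_mul, mul_id h]

theorem mul_left_cancel {g f f' : X.Ar} (h : X.src g = X.tgt f) (h' : X.src g = X.tgt f')
    (e : X.mul g f = X.mul g f') : f = f' := by
  rw [← inv_mul_cancel_left h, e, inv_mul_cancel_left h']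

theorem mul_right_cancel {g g' f : X.Ar} (h : X.src g = X.tgt f) (h' : X.src g' = X.tgt f)
    (e : X.mul g f = X.mul g' f) : g = g' := by
  have key : ∀ k : X.Ar, X.src k = X.tgt f → X.mul (X.mul k f) (X.inv f) = k := fun k hk => by
    rw [mul_assoc hk (X.tgt_inv f).symm, mul_inv, mul_id hk]
  rw [← key g h, e, key g' h']

variable (X)

theorem src_defFun : DefFun L K X.src := isDefMap_iff.1 X.src_def
theorem tgt_defFun : DefFun L K X.tgt := isDefMap_iff.1 X.tgt_def
theorem id_defFun : DefFun L K X.id := isDefMap_iff.1 X.id_def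
theorem inv_defFun : DefFun L K X.inv := isDefMap_iff.1 X.inv_def

theorem mul_defFun : DefFun L K fun p : X.Ar × X.Ar => X.mul p.1 p.2 := by
  have h1 : DefPred L K fun p : (X.Ar × X.Ar) × X.Ar =>
      ∃ h : X.src p.1.1 = X.tgt p.1.2, X.comp p.1.1 p.1.2 h = p.2 :=
    (definable_partial_iff (Q := fun p : X.Ar × X.Ar => X.src p.1 = X.tgt p.2)
      (f := fun p h => X.comp p.1 p.2 h)).1 X.comp_def
  have hg : DefFun L K fun p : (X.Ar × X.Ar) × X.Ar => p.1.1 := DefFun.fst.comp DefFun.fst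
  have hf : DefFun L K fun p : (X.Ar × X.Ar) × X.Ar => p.1.2 := DefFun.snd.comp DefFun.fst
  have h2 := (DefPred.eq (X.src_defFun.comp hg) (X.tgt_defFun.comp hf)).not.and
    (DefPred.eq hg DefFun.snd)
  refine (h1.or h2).congr fun p => ?_
  by_cases h : X.src p.1.1 = X.tgt p.1.2
  · simp [h, comp_eq_mul]
  · simp [h, mul]

end DefGroupoid

theorem DefAbGroup.add_defFun (A : DefAbGroup L K) : DefFun L K fun p : A × A => p.1 + p.2 :=
  isDefMap₂_iff.1 A.add_def

theorem DefAbGroup.neg_defFun (A : DefAbGroup L K) : DefFun L K fun a : A => -a :=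
  isDefMap_iff.1 A.neg_def

theorem DefAbGroup.zero_defPred (A : DefAbGroup L K) : DefPred L K fun a : A => 0 = a :=
  (defPred_tuple (P := fun z => z = ((0 : A) : Fin A.arity → U))).2 A.zero_def |>.comp
      DefFun.val |>.congr fun a => by rw [← Subtype.ext_iff, eq_comm]

namespace BoundedGroupoid

variable {A : DefAbGroup L K} (X : BoundedGroupoid A)

open DefGroupoid

/-- The action of `A` on arrows: precomposition with an automorphism in `A`. -/
noncomputable def sh (a : A) (f : X.Ar) : X.Ar := X.mul f (X.bound (X.src f) a)

variable {X}

theorem src_sh (a : A) (f : X.Ar) : X.src (X.sh a f) = X.src f :=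
  (src_mul (X.tgt_bound _ _).symm).trans (X.src_bound _ _)

theorem tgt_sh (a : A) (f : X.Ar) : X.tgt (X.sh a f) = X.tgt f :=
  tgt_mul (X.tgt_bound _ _).symm

theorem bound_add' (x : X.Ob) (a b : A) :
    X.bound x (a + b) = X.mul (X.bound x a) (X.bound x b) :=
  (X.bound_add x a b).trans (comp_eq_mul _)

theorem bound_zero (x : X.Ob) : X.bound x 0 = X.id x := by
  have h := bound_add' x 0 0
  rw [add_zero] at h
  have e : X.src (X.bound x 0) = X.tgt (X.bound x 0) := by rw [X.src_bound, X.tgt_bound]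
  refine mul_left_cancel e (by rw [X.src_bound, X.tgt_id]) ?_
  rw [← h, mul_id (X.src_bound x 0)]

theorem bound_natural' {f : X.Ar} {x y : X.Ob} (hx : X.src f = x) (hy : X.tgt f = y) (a : A) :
    X.mul f (X.bound x a) = X.mul (X.bound y a) f := by
  subst hx hy
  rw [← comp_eq_mul (X.tgt_bound _ _).symm, X.bound_natural, comp_eq_mul]

theorem sh_zero (f : X.Ar) : X.sh 0 f = f := by
  rw [sh, bound_zero, mul_id rfl]

theorem sh_sh (a b : A) (f : X.Ar) : X.sh a (X.sh b f) = X.sh (a + b) f := by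
  rw [sh, src_sh, sh, sh, mul_assoc (X.tgt_bound _ _).symm
    ((X.src_bound _ _).trans (X.tgt_bound _ _).symm), ← bound_add', add_comm]

theorem mul_sh {g f : X.Ar} (h : X.src g = X.tgt f) (a : A) :
    X.mul g (X.sh a f) = X.sh a (X.mul g f) := by
  rw [sh, sh, src_mul h, mul_assoc h (X.tgt_bound _ _).symm]

/-- Naturality of `bound` moves the automorphism across `f`. With `mul_sh` it lets elements of `A`
be pulled out of either factor of a composite. -/
theorem sh_mul {g f : X.Ar} (h : X.src g = X.tgt f) (a : A) :
    X.mul (X.sh a g) f = X.sh a (X.mul g f) := by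
  rw [← mul_sh h, sh, sh, mul_assoc (X.tgt_bound _ _).symm ((X.src_bound _ _).trans h), h,
    bound_natural' rfl rfl]

/-- The composite of `g` with the inverse of `f` is an automorphism of the common source, hence
comes from a unique element of `A`. So nonempty sets `Mor(x, y)` are principal homogeneous spaces of
`A`. -/
theorem existsUnique_sh {f g : X.Ar} (hs : X.src f = X.src g) (ht : X.tgt f = X.tgt g) :
    ∃! a, X.sh a f = g := by
  have e : X.src (X.inv f) = X.tgt g := (X.src_inv f).trans ht
  obtain ⟨a, ha, hu⟩ := X.bound_bijective (X.src f) (X.mul (X.inv f) g)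
    ((src_mul e).trans hs.symm) ((tgt_mul e).trans (X.tgt_inv f))
  refine ⟨a, ?_, fun b hb => hu b ?_⟩
  · show X.mul f _ = g
    rw [ha, mul_inv_cancel_left ht]
  · rw [← hb]
    exact (inv_mul_cancel_left (X.tgt_bound _ _).symm).symm

theorem sh_injective {f : X.Ar} {a b : A} (h : X.sh a f = X.sh b f) : a = b :=
  (existsUnique_sh (src_sh b f).symm (tgt_sh b f).symm).unique h rfl

theorem sh_id (x : X.Ob) (a : A) : X.sh a (X.id x) = X.bound x a := by
  rw [sh, X.src_id, id_mul (X.tgt_bound _ _)]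

theorem mul_bound {f : X.Ar} {x : X.Ob} (h : X.src f = x) (a : A) :
    X.mul f (X.bound x a) = X.sh a f := by
  subst h; rfl

open Classical in
variable (X) in
/-- The element of `A` by which two parallel arrows differ. -/
noncomputable def diff (f g : X.Ar) : A := if h : ∃ a, X.sh a f = g then h.choose else 0

theorem sh_diff {f g : X.Ar} (hs : X.src f = X.src g) (ht : X.tgt f = X.tgt g) :
    X.sh (X.diff f g) f = g := by
  have h := (existsUnique_sh hs ht).exists
  rw [diff, dif_pos h]
  exact h.choose_spec

theorem diff_eq {f g : X.Ar} {a : A} (h : X.sh a f = g) : X.diff f g = a := by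
  subst h
  exact sh_injective (sh_diff (src_sh a f).symm (tgt_sh a f).symm)

variable (X)

theorem bound_defFun : DefFun L K fun p : X.Ob × A => X.bound p.1 p.2 := isDefMap₂_iff.1 X.bound_def

theorem sh_defFun : DefFun L K fun p : A × X.Ar => X.sh p.1 p.2 :=
  DefFun.comp₂ (h := X.mul) X.mul_defFun DefFun.snd
    (DefFun.comp₂ (h := X.bound) X.bound_defFun (X.src_defFun.comp DefFun.snd) DefFun.fst)

theorem diff_defFun : DefFun L K fun p : X.Ar × X.Ar => X.diff p.1 p.2 := by
  have hsh : DefPred L K fun p : (X.Ar × X.Ar) × A => X.sh p.2 p.1.1 = p.1.2 :=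
    DefPred.eq (DefFun.comp₂ (h := X.sh) X.sh_defFun DefFun.snd (DefFun.fst.comp DefFun.fst))
      (DefFun.snd.comp DefFun.fst)
  have hno := (DefPred.exists hsh).not
  refine (hsh.or ((hno.comp DefFun.fst).and (A.zero_defPred.comp DefFun.snd))).congr ?_
  rintro ⟨⟨f, g⟩, a⟩
  show X.sh a f = g ∨ (¬(∃ b, X.sh b f = g) ∧ 0 = a) ↔ X.diff f g = a
  constructor
  · rintro (h | ⟨h, rfl⟩)
    · exact diff_eq h
    · exact dif_neg h
  · rintro rfl
    by_cases h : ∃ b, X.sh b f = g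
    · obtain ⟨b, hb⟩ := h
      exact Or.inl (by rw [diff_eq hb, hb])
    · exact Or.inr ⟨h, (show X.diff f g = 0 from dif_neg h).symm⟩

end BoundedGroupoid

end ModelGalois

/-! ### Frames and their cocycles -/

namespace ModelGalois

variable {L : FirstOrder.Language.{u, v}} {U : Type w} [L.Structure U] {K : Set U}

section Continuity

open Filter Topology

instance : ContinuousMul (galoisGroup L K) := by
  refine ⟨continuous_induced_rng.2 ?_⟩
  let : TopologicalSpace (acl L K) := ⊥
  have : DiscreteTopology (acl L K) := ⟨rfl⟩
  refine continuous_pi fun a => continuous_iff_continuousAt.2 fun p => ?_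
  have h1 := continuous_snd.continuousAt.eventually (eventually_apply_eq p.2 a)
  have h2 := continuous_fst.continuousAt.eventually (eventually_apply_eq p.1 (p.2.1 a))
  refine tendsto_nhds_of_eventually_eq ?_
  filter_upwards [h1, h2] with q hq1 hq2
  show q.1.1 (q.2.1 a) = p.1.1 (p.2.1 a)
  rw [hq1, hq2]

/-- Near a point `u` is a fixed algebraic element, and nearby automorphisms act on it in the same
way. -/
theorem IsLocallyConstant.gal {S T : Type*} [TopologicalSpace S] [Coded U T] [DefDom L K T]
    {s : S → galoisGroup L K} (hs : Continuous s) {u : S → T} (hu : IsLocallyConstant u)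
    (halg : ∀ x, Alg L K (u x)) : IsLocallyConstant fun x => gal (s x) (u x) := by
  refine (IsLocallyConstant.iff_eventually_eq _).2 fun x => ?_
  filter_upwards [(IsLocallyConstant.iff_eventually_eq _).1 hu x,
    hs.continuousAt.eventually (eventually_gal_eq (s x) (halg x))] with y hy hy'
  rw [hy, hy']

end Continuity

/-- An algebraic element of a definable set, as a point. -/
def DefSet.pt (D : DefSet L K) (x : D) (hx : Alg L K x) : D.Pts := ⟨x, hx⟩

theorem DefSet.alg_pt {D : DefSet L K} (x : D.Pts) : Alg L K x.1 := x.2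

theorem DefSet.pt_injective {D : DefSet L K} : Function.Injective fun x : D.Pts => x.1 :=
  Subtype.val_injective

theorem DefSet.smul_val (D : DefSet L K) (σ : galoisGroup L K) (x : D.Pts) :
    (σ • x).1 = gal σ x.1 := (gal_eq (alg_pt x) fun _ => rfl).symm

theorem DefAbGroup.smul_val (A : DefAbGroup L K) (σ : galoisGroup L K) (a : A.Pts) :
    (σ • a).1 = gal σ a.1 := DefSet.smul_val _ σ a

namespace DefGroupoid

variable {X : DefGroupoid L K}

theorem mul_gal (σ : galoisGroup L K) {g f : X.Ar} (hg : Alg L K g) (hf : Alg L K f) :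
    X.mul (gal σ g) (gal σ f) = gal σ (X.mul g f) :=
  gal_map₂ X.mul_defFun σ hg hf

theorem src_gal (σ : galoisGroup L K) {f : X.Ar} (hf : Alg L K f) :
    X.src (gal σ f) = gal σ (X.src f) := gal_map X.src_defFun σ hf

theorem tgt_gal (σ : galoisGroup L K) {f : X.Ar} (hf : Alg L K f) :
    X.tgt (gal σ f) = gal σ (X.tgt f) := gal_map X.tgt_defFun σ hf

/-- In a connected groupoid with an algebraic object `x`, the arrows out of `x` form a split
torsor. -/
theorem hasSplitTorsor_of_alg {x : X.Ob} (hx : Alg L K x) :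
    X.HasSplitTorsor := by
  have hK : K ⊆ acl L K := subset_acl K
  have : DefDom L (acl L K) X.Ar.carrier := DefDom.mono hK
  have : DefDom L (acl L K) X.Ob.carrier := DefDom.mono hK
  have hfib : DefPred L (acl L K) fun f => X.src f = x :=
    DefPred.eq (X.src_defFun.mono hK) (DefFun.const (DefPred.eq_of_mem hx))
  have : DefDom L (acl L K) {f // X.src f = x} := hfib.defDom
  obtain ⟨D, e, he, he'⟩ := exists_defSet_equiv (L := L) (acl L K) {f // X.src f = x}
  have hv : DefFun L (acl L K) fun d : D => (e.symm d).1 := DefFun.val.comp he'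
  let act : ∀ (m : X.Ar) (p : D), X.src m = X.tgt (e.symm p).1 → D := fun m p h =>
    e ⟨X.mul m (e.symm p).1, (src_mul h).trans (e.symm p).2⟩
  have hact : ∀ m p h, (e.symm (act m p h)).1 = X.mul m (e.symm p).1 := fun m p h => by
    simp only [act, Equiv.symm_apply_apply]
  have hext : ∀ {p q : D}, (e.symm p).1 = (e.symm q).1 → p = q := fun h =>
    e.symm.injective (Subtype.ext h)
  have hact' : ∀ {m p q}, (∃ h, act m p h = q) ↔
      X.src m = X.tgt (e.symm p).1 ∧ X.mul m (e.symm p).1 = (e.symm q).1 := fun {m p q} => by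
    constructor
    · rintro ⟨h, rfl⟩
      exact ⟨h, (hact m p h).symm⟩
    · rintro ⟨h, h'⟩
      exact ⟨h, hext ((hact m p h).trans h')⟩
  have hmem : X.src (X.id x) = x := X.src_id x
  refine ⟨{
    P := D
    nonempty := ⟨e ⟨X.id x, hmem⟩⟩
    anchor := fun p => X.tgt (e.symm p).1
    act := act
    anchor_act := fun m p h => (congrArg X.tgt (hact m p h)).trans (tgt_mul h)
    id_act := fun p => hext ((hact _ _ (X.src_id _)).trans (id_mul rfl))
    comp_act := fun g f p h h' => hext (by
      refine (hact _ _ ((X.src_comp g f h).trans h')).trans (Eq.symm ?_)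
      refine (hact g _ (h.trans ((congrArg X.tgt (hact f p h')).trans (tgt_mul h')).symm)).trans ?_
      rw [hact f p h', comp_eq_mul, mul_assoc h h'])
    principal := fun p q => by
      have e1 : X.src (e.symm q).1 = X.src (e.symm p).1 :=
        (e.symm q).2.trans (e.symm p).2.symm
      have e2 : X.src (e.symm q).1 = X.tgt (X.inv (e.symm p).1) :=
        e1.trans (X.tgt_inv _).symm
      refine ⟨X.mul (e.symm q).1 (X.inv (e.symm p).1), ?_, fun m hm => ?_⟩
      · exact hact'.2 ⟨(src_mul e2).trans (X.src_inv _), mul_inv_cancel_right e1⟩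
      · obtain ⟨h, h'⟩ := hact'.1 hm
        refine mul_right_cancel h ((src_mul e2).trans (X.src_inv _)) ?_
        rw [h', mul_inv_cancel_right e1]
    anchor_def := isDefMap_iff.2 ((X.tgt_defFun.mono hK).comp hv)
    act_def := (definable_partial_iff (Q := fun z : X.Ar × D => X.src z.1 = X.tgt (e.symm z.2).1)
      (f := fun z h => act z.1 z.2 h)).2 (by
        have hm : DefFun L (acl L K) fun p : (X.Ar × D) × D => p.1.1 := DefFun.fst.comp DefFun.fst
        have hp : DefFun L (acl L K) fun p : (X.Ar × D) × D => (e.symm p.1.2).1 :=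
          hv.comp (DefFun.snd.comp DefFun.fst)
        exact ((DefPred.eq ((X.src_defFun.mono hK).comp hm) ((X.tgt_defFun.mono hK).comp hp)).and
          (DefPred.eq (DefFun.comp₂ (h := X.mul) (X.mul_defFun.mono hK) hm hp)
            (hv.comp DefFun.snd))).congr fun p => hact'.symm) },
    e ⟨X.id x, hmem⟩, Alg.of_defFun_acl he (s := ⟨X.id x, hmem⟩)
      (Alg.of_defFun X.id_defFun hx)⟩

end DefGroupoid

namespace BoundedGroupoid

variable {A : DefAbGroup L K} {X : BoundedGroupoid A}

open DefGroupoid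

theorem sh_gal (σ : galoisGroup L K) {a : A} (ha : Alg L K a) {f : X.Ar} (hf : Alg L K f) :
    X.sh (gal σ a) (gal σ f) = gal σ (X.sh a f) :=
  gal_map₂ X.sh_defFun σ ha hf

theorem alg_diff {f g : X.Ar} (hf : Alg L K f) (hg : Alg L K g) : Alg L K (X.diff f g) :=
  Alg.of_defFun X.diff_defFun (hf.pair hg)

variable (X) in
/-- A continuous family of algebraic arrows from an algebraic object `x` to its conjugates. -/
structure Frame (x : X.Ob) (u : galoisGroup L K → X.Ar) : Prop where
  alg_ob : Alg L K x
  alg : ∀ σ, Alg L K (u σ)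
  isLocallyConstant : IsLocallyConstant u
  src : ∀ σ, X.src (u σ) = x
  tgt : ∀ σ, X.tgt (u σ) = gal σ x

namespace Frame

variable {x : X.Ob} {u : galoisGroup L K → X.Ar}

theorem src_gal (F : X.Frame x u) (σ τ : galoisGroup L K) :
    X.src (gal σ (u τ)) = X.tgt (u σ) := by
  rw [DefGroupoid.src_gal σ (F.alg τ), F.src, F.tgt]

theorem tgt_gal (F : X.Frame x u) (σ τ : galoisGroup L K) :
    X.tgt (gal σ (u τ)) = gal (σ * τ) x := by
  rw [DefGroupoid.tgt_gal σ (F.alg τ), F.tgt, gal_mul _ _ F.alg_ob]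

theorem isLocallyConstant_gal (F : X.Frame x u) :
    IsLocallyConstant fun p : galoisGroup L K × galoisGroup L K => gal p.1 (u p.2) :=
  IsLocallyConstant.gal continuous_fst (F.isLocallyConstant.comp_continuous continuous_snd)
    fun _ => F.alg _

end Frame

theorem isAttachedCocycle_iff {h : contTwoCocycles (galoisGroup L K) A.Pts} :
    IsAttachedCocycle X h ↔ ∃ x u, X.Frame x u ∧ ∀ σ τ,
      X.mul (gal σ (u τ)) (u σ) = X.sh (h.1 (σ, τ)).1 (u (σ * τ)) := by
  constructor
  · rintro ⟨x, u, hu, hsrc, htgt, hcomp⟩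
    refine ⟨x.1, fun σ => (u σ).1, ⟨x.2, fun σ => (u σ).2, hu.comp _, hsrc, fun σ => ?_⟩,
      fun σ τ => ?_⟩
    · rw [htgt, DefSet.smul_val]
    · obtain ⟨h1, h2, h3⟩ := hcomp σ τ
      rw [comp_eq_mul, comp_eq_mul, mul_bound (hsrc _), DefSet.smul_val] at h3
      exact h3
  · rintro ⟨x, u, F, hcomp⟩
    refine ⟨X.Ob.pt x F.alg_ob, fun σ => X.Ar.pt (u σ) (F.alg σ),
      IsLocallyConstant.desc _ Subtype.val F.isLocallyConstant DefSet.pt_injective, F.src,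
      fun σ => ?_, fun σ τ => ?_⟩
    · rw [DefSet.smul_val]
      exact F.tgt σ
    · refine ⟨?_, ?_, ?_⟩
      · rw [DefSet.smul_val]
        exact F.src_gal σ τ
      · rw [X.tgt_bound]
        exact F.src _
      · rw [comp_eq_mul, comp_eq_mul]
        exact (congrArg₂ X.mul (DefSet.smul_val _ _ _) rfl).trans
          ((hcomp σ τ).trans (mul_bound (F.src _) _).symm)

/-- Both arrows run from `x` to `στ x`, so they differ by a unique element of `A`, which is
algebraic because `diff` is `K`-definable. -/
theorem Frame.exists_cocycle {x : X.Ob} {u : galoisGroup L K → X.Ar} (F : X.Frame x u) :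
    ∃ h : contTwoCocycles (galoisGroup L K) A.Pts, ∀ σ τ,
      X.mul (gal σ (u τ)) (u σ) = X.sh (h.1 (σ, τ)).1 (u (σ * τ)) := by
  let h : galoisGroup L K × galoisGroup L K → A := fun p =>
    X.diff (u (p.1 * p.2)) (X.mul (gal p.1 (u p.2)) (u p.1))
  have hsh : ∀ σ τ, X.sh (h (σ, τ)) (u (σ * τ)) = X.mul (gal σ (u τ)) (u σ) := fun σ τ => by
    refine sh_diff ?_ ?_
    · rw [src_mul (F.src_gal σ τ), F.src, F.src]
    · rw [tgt_mul (F.src_gal σ τ), F.tgt_gal, F.tgt]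
  have halg : ∀ p, Alg L K (h p) := fun p => alg_diff (F.alg _)
    (Alg.of_defFun X.mul_defFun (((F.alg _).map_gal _).pair (F.alg _)))
  have hloc : IsLocallyConstant h := by
    have h1 := F.isLocallyConstant.comp_continuous
      (continuous_mul (M := galoisGroup L K))
    have h2 := F.isLocallyConstant_gal
    have h3 : IsLocallyConstant fun p : galoisGroup L K × galoisGroup L K => u p.1 :=
      F.isLocallyConstant.comp_continuous continuous_fst
    exact ((h1.prodMk (h2.prodMk h3)).comp fun q => X.diff q.1 (X.mul q.2.1 q.2.2))
  -- Both sides are the shift from `u (σ * τ * ρ)` to the triple composite of `gal (σ * τ) (u ρ)`,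
  -- `gal σ (u τ)` and `u σ`, bracketed in two ways.
  have hcoc : ∀ σ τ ρ, h (σ * τ, ρ) + h (σ, τ) = gal σ (h (τ, ρ)) + h (σ, τ * ρ) := fun σ τ ρ => by
    refine sh_injective (f := u (σ * τ * ρ)) ?_
    rw [add_comm, ← sh_sh, hsh, ← mul_sh (F.src_gal _ _), hsh, gal_mul _ _ (F.alg _),
      ← mul_assoc ?_ (F.src_gal _ _), mul_gal _ ((F.alg _).map_gal _) (F.alg _), ← hsh,
      ← sh_gal _ (halg _) (F.alg _), sh_mul (F.src_gal _ _), ← sh_sh, _root_.mul_assoc, hsh]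
    rw [← gal_mul _ _ (F.alg _), F.src_gal, F.tgt, F.tgt_gal]
  refine ⟨⟨fun p => A.pt (h p) (halg p), IsLocallyConstant.desc _ Subtype.val hloc
    DefSet.pt_injective, fun σ τ ρ => Subtype.ext ?_⟩, fun σ τ => (hsh σ τ).symm⟩
  refine (hcoc σ τ ρ).trans ?_
  show _ = (σ • (A.pt (h (τ, ρ)) (halg _) : A.Pts)).1 + _
  rw [A.smul_val]
  rfl

/-- The fibres of `(src, tgt)` are `A`-torsors under `sh`, nonempty by connectedness, so splitting
of torsors applies. -/
theorem exists_alg_arrow (hA : A.TorsorsSplit) (hX : X.Connected) {x y : X.Ob}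
    (hx : Alg L K x) (hy : Alg L K y) : ∃ f, Alg L K f ∧ X.src f = x ∧ X.tgt f = y := by
  obtain ⟨f, hf, h⟩ := hA.exists_alg (π := fun f => (X.src f, X.tgt f)) (act := X.sh)
    (X.src_defFun.pair X.tgt_defFun) X.sh_defFun (fun a f => by rw [src_sh, tgt_sh]) sh_zero
    (fun a b f => (sh_sh a b f).symm)
    (fun f g h => existsUnique_sh (congrArg Prod.fst h) (congrArg Prod.snd h))
    (hx.pair hy) (by
      obtain ⟨f, h1, h2⟩ := hX.2 x y
      exact ⟨f, Prod.ext h1 h2⟩)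
  exact ⟨f, hf, congrArg Prod.fst h, congrArg Prod.snd h⟩

/-- The arrow is chosen as a function of the conjugate `gal σ x` alone; this makes the family
locally constant. -/
theorem exists_frame (hA : A.TorsorsSplit) (hX : X.Connected) {x : X.Ob} (hx : Alg L K x) :
    ∃ u, X.Frame x u := by
  have h : ∀ y : {y : X.Ob // Alg L K y}, ∃ f, Alg L K f ∧ X.src f = x ∧ X.tgt f = y.1 :=
    fun y => exists_alg_arrow hA hX hx y.2
  choose f hf hsrc htgt using h
  refine ⟨fun σ => f ⟨gal σ x, hx.map_gal σ⟩, hx, fun _ => hf _, ?_, fun _ => hsrc _, fun _ => htgt _⟩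
  have h1 : IsLocallyConstant fun σ : galoisGroup L K => gal σ x :=
    IsLocallyConstant.gal continuous_id (IsLocallyConstant.const x) fun _ => hx
  have h2 : IsLocallyConstant fun σ : galoisGroup L K =>
      (⟨gal σ x, hx.map_gal σ⟩ : {y : X.Ob // Alg L K y}) :=
    IsLocallyConstant.desc _ Subtype.val h1 Subtype.val_injective
  exact h2.comp f

end BoundedGroupoid

theorem SplitGroupoid.exists_alg_ob {A : DefAbGroup L K} (X : SplitGroupoid A) :
    ∃ x : X.1.Ob, Alg L K x := by
  obtain ⟨T, p, hp⟩ := X.2.2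
  exact ⟨T.anchor p, Alg.of_defFun_acl (isDefMap_iff.1 T.anchor_def) (s := p) hp⟩

theorem SplitGroupoid.exists_attached {A : DefAbGroup L K} (hA : A.TorsorsSplit)
    (X : SplitGroupoid A) : ∃ h, IsAttachedCocycle X.1 h := by
  obtain ⟨x, hx⟩ := X.exists_alg_ob
  obtain ⟨u, F⟩ := BoundedGroupoid.exists_frame hA X.2.1 hx
  obtain ⟨h, hh⟩ := F.exists_cocycle
  exact ⟨h, BoundedGroupoid.isAttachedCocycle_iff.2 ⟨x, u, F, hh⟩⟩

end ModelGalois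

/-! ### Change of frame, and the zero cocycle of a groupoid with a torsor over `K` -/

namespace ModelGalois

variable {L : FirstOrder.Language.{u, v}} {U : Type w} [L.Structure U] {K : Set U}

/-- The unique solution of a definable functional relation with algebraic arguments is
algebraic. -/
theorem Alg.of_rel {S T : Type*} [Coded U S] [Coded U T] {R : S → T → Prop}
    (hR : DefPred L K fun p : S × T => R p.1 p.2)
    (hfun : ∀ s t t', R s t → R s t' → t = t') {s : S} {t : T} (hs : Alg L K s) (h : R s t) :
    Alg L K t := by
  refine mem_acl_of_graph hR ?_ ⟨(s, t), h, rfl⟩ hs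
  rintro x y y' ⟨p, hp, hp'⟩ ⟨q, hq, hq'⟩
  obtain ⟨rfl, rfl⟩ := Sum.elim_eq_iff.1 hp'
  obtain ⟨h1, rfl⟩ := Sum.elim_eq_iff.1 hq'
  have h1 : q.1 = p.1 := (code_inj (U := U)).1 h1
  have hq : R q.1 q.2 := hq
  exact congrArg (codeOf U) (hfun _ _ _ hp (h1 ▸ hq))

namespace BoundedGroupoid

open DefGroupoid

variable {A : DefAbGroup L K} {X : BoundedGroupoid A}

section Change

variable {x : X.Ob} {u : galoisGroup L K → X.Ar} {g : galoisGroup L K → A}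

theorem Frame.sh (F : X.Frame x u) (hg : IsLocallyConstant g) (halg : ∀ σ, Alg L K (g σ)) :
    X.Frame x fun σ => X.sh (g σ) (u σ) where
  alg_ob := F.alg_ob
  alg σ := Alg.of_defFun X.sh_defFun ((halg σ).pair (F.alg σ))
  isLocallyConstant := (hg.prodMk F.isLocallyConstant).comp fun q => X.sh q.1 q.2
  src σ := (src_sh _ _).trans (F.src σ)
  tgt σ := (tgt_sh _ _).trans (F.tgt σ)

theorem Frame.mul_sh (F : X.Frame x u) (halg : ∀ σ, Alg L K (g σ)) (σ τ : galoisGroup L K) :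
    X.mul (gal σ (X.sh (g τ) (u τ))) (X.sh (g σ) (u σ)) =
      X.sh (gal σ (g τ) + g σ) (X.mul (gal σ (u τ)) (u σ)) := by
  rw [← sh_gal σ (halg τ) (F.alg τ), sh_mul ((F.src_gal σ τ).trans (tgt_sh _ _).symm),
    BoundedGroupoid.mul_sh (F.src_gal σ τ), sh_sh]

/-- Two frames at the same object differ by a continuous cochain `g` with values in `A`, and `h' -
h` is the coboundary of `g`. -/
theorem Frame.class_eq {u' : galoisGroup L K → X.Ar} (F : X.Frame x u) (F' : X.Frame x u')
    {h h' : contTwoCocycles (galoisGroup L K) A.Pts}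
    (e : ∀ σ τ, X.mul (gal σ (u τ)) (u σ) = X.sh (h.1 (σ, τ)).1 (u (σ * τ)))
    (e' : ∀ σ τ, X.mul (gal σ (u' τ)) (u' σ) = X.sh (h'.1 (σ, τ)).1 (u' (σ * τ))) :
    (QuotientAddGroup.mk h : contH2 (galoisGroup L K) A.Pts) = QuotientAddGroup.mk h' := by
  let g : galoisGroup L K → A := fun σ => X.diff (u σ) (u' σ)
  have halg : ∀ σ, Alg L K (g σ) := fun σ => alg_diff (F.alg σ) (F'.alg σ)
  have hloc : IsLocallyConstant g :=
    (F.isLocallyConstant.prodMk F'.isLocallyConstant).comp fun q => X.diff q.1 q.2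
  have hsh : ∀ σ, X.sh (g σ) (u σ) = u' σ := fun σ =>
    sh_diff ((F.src σ).trans (F'.src σ).symm) ((F.tgt σ).trans (F'.tgt σ).symm)
  refine QuotientAddGroup.eq.2 ⟨fun σ => A.pt (g σ) (halg σ),
    IsLocallyConstant.desc _ Subtype.val hloc DefSet.pt_injective, fun σ τ => Subtype.ext ?_⟩
  have key : gal σ (g τ) + g σ + (h.1 (σ, τ)).1 = (h'.1 (σ, τ)).1 + g (σ * τ) := by
    refine sh_injective (f := u (σ * τ)) ?_
    rw [← sh_sh, ← e, ← F.mul_sh halg, hsh, hsh, e', ← sh_sh, hsh]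
  have hs : (σ • A.pt (g τ) (halg τ) : A.Pts).1 = gal σ (g τ) := A.smul_val _ _
  show -(h.1 (σ, τ)).1 + (h'.1 (σ, τ)).1 = (σ • A.pt (g τ) (halg τ) : A.Pts).1 - g (σ * τ) + g σ
  rw [hs, eq_sub_of_add_eq key.symm]
  abel

end Change

end BoundedGroupoid

namespace DefGroupoid.Torsor

variable {X : DefGroupoid L K} (T : X.Torsor K)

/-- The relation `m · p = q`. -/
def Act (m : X.Ar) (p q : T.P) : Prop := ∃ h, T.act m p h = q

variable {T}

theorem Act.src {m : X.Ar} {p q : T.P} (h : T.Act m p q) : X.src m = T.anchor p := h.1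

theorem Act.tgt {m : X.Ar} {p q : T.P} (h : T.Act m p q) : X.tgt m = T.anchor q := by
  obtain ⟨h, rfl⟩ := h
  exact (T.anchor_act _ _ _).symm

theorem Act.mul {g f : X.Ar} {p q r : T.P} (hg : T.Act g q r) (hf : T.Act f p q) :
    T.Act (X.mul g f) p r := by
  have h : X.src g = X.tgt f := hg.src.trans hf.tgt.symm
  obtain ⟨h1, rfl⟩ := hf
  obtain ⟨h2, rfl⟩ := hg
  rw [← comp_eq_mul h]
  exact ⟨_, T.comp_act g f p h h1⟩

theorem Act.unique {m m' : X.Ar} {p q : T.P} (h : T.Act m p q) (h' : T.Act m' p q) : m = m' :=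
  (T.principal p q).unique h h'

theorem act_defPred : DefPred L K fun z : (X.Ar × T.P) × T.P => T.Act z.1.1 z.1.2 z.2 :=
  (definable_partial_iff (Q := fun z : X.Ar × T.P => X.src z.1 = T.anchor z.2)
      (f := fun z h => T.act z.1 z.2 h)).1 T.act_def

end DefGroupoid.Torsor

namespace BoundedGroupoid

open DefGroupoid

variable {A : DefAbGroup L K} {X : BoundedGroupoid A}

/-- Through `bound`, `A` acts simply transitively on the fibres of the anchor, so there is an
algebraic point `p` above `x`. As frame serve the unique arrows carrying `p` to `gal σ p`. -/
theorem isAttachedCocycle_zero_of_torsor (hA : A.TorsorsSplit) (hX : X.Connected)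
    (T : X.Torsor K) {x : X.Ob} (hx : Alg L K x) : IsAttachedCocycle X 0 := by
  have hanchor : DefFun L K T.anchor := isDefMap_iff.1 T.anchor_def
  have hact (a : A) (p : T.P) :
      T.Act (X.bound (T.anchor p) a) p (T.act (X.bound (T.anchor p) a) p (X.src_bound _ _)) :=
    ⟨_, rfl⟩
  have hactu {a : A} {p q : T.P} (h : T.Act (X.bound (T.anchor p) a) p q) :
      T.act (X.bound (T.anchor p) a) p (X.src_bound _ _) = q := h.2
  have hadd {a b : A} {p q r : T.P} (h : T.Act (X.bound (T.anchor p) b) p q)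
      (h' : T.Act (X.bound (T.anchor q) a) q r) : T.Act (X.bound (T.anchor p) (a + b)) p r := by
    rw [bound_add']
    rw [← h.tgt, X.tgt_bound] at h'
    exact h'.mul h
  obtain ⟨p, hp, hpx⟩ := hA.exists_alg (π := T.anchor)
    (act := fun a p => T.act (X.bound (T.anchor p) a) p (X.src_bound _ _)) hanchor (by
      have ha : DefFun L K fun z : (A × T.P) × T.P => z.1.1 := DefFun.fst.comp DefFun.fst
      have hp : DefFun L K fun z : (A × T.P) × T.P => z.1.2 := DefFun.snd.comp DefFun.fst
      refine (T.act_defPred.comp (((DefFun.comp₂ (h := X.bound) X.bound_defFun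
        (hanchor.comp hp) ha).pair hp).pair DefFun.snd)).congr fun z => ?_
      exact ⟨fun h => hactu h, fun h => by rw [← h]; exact hact _ _⟩)
    (fun a q => by rw [T.anchor_act, X.tgt_bound])
    (fun q => hactu (by rw [bound_zero]; exact ⟨_, T.id_act q⟩))
    (fun a b q => hactu (hadd (hact b q) (hact a _)))
    (fun q q' h => by
      obtain ⟨m, hm, hm'⟩ := T.principal q q'
      have hm : T.Act m q q' := hm
      obtain ⟨a, ha, ha'⟩ := X.bound_bijective (T.anchor q) m hm.src (hm.tgt.trans h.symm)
      refine ⟨a, hactu (by rw [ha]; exact hm), fun b hb => ha' b (hm' _ ?_)⟩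
      rw [← hb]
      exact hact b q)
    hx (by
      obtain ⟨p⟩ := T.nonempty
      obtain ⟨f, h1, h2⟩ := hX.2 (T.anchor p) x
      exact ⟨T.act f p h1, (T.anchor_act _ _ _).trans h2⟩)
  choose d hd using fun p q => (T.principal p q).exists
  have hd : ∀ p q, T.Act (d p q) p q := hd
  have hd_def : DefPred L K fun z : (T.P × T.P) × X.Ar => T.Act z.2 z.1.1 z.1.2 :=
    T.act_defPred.comp ((DefFun.snd.pair (DefFun.fst.comp DefFun.fst)).pair
      (DefFun.snd.comp DefFun.fst))
  have hloc : IsLocallyConstant fun σ : galoisGroup L K => gal σ p :=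
    IsLocallyConstant.gal continuous_id (IsLocallyConstant.const p) fun _ => hp
  have halg : ∀ σ : galoisGroup L K, Alg L K (d p (gal σ p)) := fun σ =>
    Alg.of_rel (R := fun (z : T.P × T.P) m => T.Act m z.1 z.2) hd_def
      (fun _ _ _ h h' => h.unique h') (hp.pair (hp.map_gal σ)) (hd _ _)
  have F : X.Frame x fun σ => d p (gal σ p) :=
    { alg_ob := hx
      alg := halg
      isLocallyConstant := hloc.comp (d p)
      src := fun σ => (hd _ _).src.trans hpx
      tgt := fun σ => by rw [(hd _ _).tgt, gal_map hanchor σ hp, hpx] }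
  refine isAttachedCocycle_iff.2 ⟨x, _, F, fun σ τ => ?_⟩
  show _ = X.sh 0 _
  rw [sh_zero]
  -- The torsor is defined over `K`, so `σ` preserves its action. The composite with the arrow from
  -- `p` to `σ p` carries `p` to `στ p`, and uniqueness identifies it with the frame at `στ`.
  have h1 : T.Act (gal σ (d p (gal τ p))) (gal σ p) (gal σ (gal τ p)) := by
    have := (gal_pred T.act_defPred σ (((halg τ).pair hp).pair (hp.map_gal τ))).2 (hd _ _)
    rwa [gal_pair σ ((halg τ).pair hp) (hp.map_gal τ), gal_pair σ (halg τ) hp] at this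
  have h2 := h1.mul (hd p (gal σ p))
  rw [← gal_mul σ τ hp] at h2
  exact h2.unique (hd _ _)

end BoundedGroupoid

end ModelGalois

/-! ### Morita morphisms and the bitorsor of a pair of them -/

namespace ModelGalois

variable {L : FirstOrder.Language.{u, v}} {U : Type w} [L.Structure U] {K : Set U}
  {A : DefAbGroup L K}

open DefGroupoid BoundedGroupoid

namespace MoritaMorphism

variable {Z X : BoundedGroupoid A} (F : MoritaMorphism Z X)

theorem ar_mul {g f : Z.Ar} (h : Z.src g = Z.tgt f) : F.ar (Z.mul g f) = X.mul (F.ar g) (F.ar f) := by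
  rw [← comp_eq_mul h, F.map_comp, comp_eq_mul]

theorem ar_bound (z : Z.Ob) (a : A) : F.ar (Z.bound z a) = X.bound (F.ob z) a := F.map_bound z a

/-- Preservation of identities is not part of the structure; it is compatibility with `bound` at
`0`. -/
theorem ar_id (z : Z.Ob) : F.ar (Z.id z) = X.id (F.ob z) := by
  rw [← bound_zero, ← bound_zero, ar_bound]

theorem ar_sh (a : A) (f : Z.Ar) : F.ar (Z.sh a f) = X.sh a (F.ar f) := by
  rw [BoundedGroupoid.sh, F.ar_mul (Z.tgt_bound _ _).symm, ar_bound, BoundedGroupoid.sh, F.src_ar]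

theorem ar_inv (f : Z.Ar) : F.ar (Z.inv f) = X.inv (F.ar f) := by
  have h1 : X.src (F.ar (Z.inv f)) = X.tgt (F.ar f) := by rw [F.src_ar, F.tgt_ar, Z.src_inv]
  refine mul_right_cancel h1 (X.src_inv _) ?_
  rw [← F.ar_mul (Z.src_inv f), DefGroupoid.inv_mul, DefGroupoid.inv_mul, ar_id, F.src_ar]

theorem ar_faithful {f g : Z.Ar} (hs : Z.src f = Z.src g) (ht : Z.tgt f = Z.tgt g)
    (h : F.ar f = F.ar g) : f = g :=
  (F.full_faithful (Z.src g) (Z.tgt g) (F.ar g) (F.src_ar g) (F.tgt_ar g)).unique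
    ⟨hs, ht, h⟩ ⟨rfl, rfl, rfl⟩

theorem exists_ar {f : X.Ar} {x y : Z.Ob} (hs : X.src f = F.ob x) (ht : X.tgt f = F.ob y) :
    ∃ g, Z.src g = x ∧ Z.tgt g = y ∧ F.ar g = f := (F.full_faithful x y f hs ht).exists

theorem ob_defFun : DefFun L K F.ob := isDefMap_iff.1 F.ob_def
theorem ar_defFun : DefFun L K F.ar := isDefMap_iff.1 F.ar_def

/-- The identity Morita morphism. -/
def refl (X : BoundedGroupoid A) : MoritaMorphism X X where
  ob := _root_.id
  ar := _root_.id
  src_ar _ := rfl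
  tgt_ar _ := rfl
  map_comp _ _ _ := rfl
  surjective := Function.surjective_id
  full_faithful _ _ f hx hy := ⟨f, ⟨hx, hy, rfl⟩, fun _ h => h.2.2⟩
  map_bound _ _ := rfl
  ob_def := isDefMap_iff.2 DefFun.id
  ar_def := isDefMap_iff.2 DefFun.id

end MoritaMorphism

section Bitorsor

variable {X Y Z : BoundedGroupoid A} (F : MoritaMorphism Z X) (G : MoritaMorphism Z Y)

/-- An object of `Z` together with arrows out of its images in `X` and `Y`. -/
abbrev Cospan : Type w :=
  {t : Z.Ob × X.Ar × Y.Ar // X.src t.2.1 = F.ob t.1 ∧ Y.src t.2.2 = G.ob t.1}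

variable {F G}

theorem cospan_defPred : DefPred L K fun t : Z.Ob × X.Ar × Y.Ar =>
    X.src t.2.1 = F.ob t.1 ∧ Y.src t.2.2 = G.ob t.1 :=
  (DefPred.eq (X.src_defFun.comp (DefFun.fst.comp DefFun.snd)) (F.ob_defFun.comp DefFun.fst)).and
    (DefPred.eq (Y.src_defFun.comp (DefFun.snd.comp DefFun.snd)) (G.ob_defFun.comp DefFun.fst))

instance : DefDom L K (Cospan F G) := cospan_defPred.defDom

/-- The arrow `k` of `Z` carries one cospan to another up to the arrows `r` of `X` and `s` of `Y`
between their feet. -/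
structure Cospan.Via (r : X.Ar) (s : Y.Ar) (k : Z.Ar) (t t' : Cospan F G) : Prop where
  src : Z.src k = t.1.1
  tgt : Z.tgt k = t'.1.1
  src_left : X.src r = X.tgt t.1.2.1
  src_right : Y.src s = Y.tgt t.1.2.2
  left : X.mul t'.1.2.1 (F.ar k) = X.mul r t.1.2.1
  right : Y.mul t'.1.2.2 (G.ar k) = Y.mul s t.1.2.2

/-- The relation `Cospan.Via` for some arrow of `Z`. -/
def Cospan.Rel (r : X.Ar) (s : Y.Ar) (t t' : Cospan F G) : Prop := ∃ k, Cospan.Via r s k t t'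

namespace Cospan

variable {r r' : X.Ar} {s s' : Y.Ar} {k k' : Z.Ar} {t t' t'' : Cospan F G}

theorem Via.src_ar_left (h : Via r s k t t') : X.src t'.1.2.1 = X.tgt (F.ar k) := by
  rw [t'.2.1, F.tgt_ar, h.tgt]

theorem Via.src_ar_right (h : Via r s k t t') : Y.src t'.1.2.2 = Y.tgt (G.ar k) := by
  rw [t'.2.2, G.tgt_ar, h.tgt]

theorem Via.tgt_left (h : Via r s k t t') : X.tgt r = X.tgt t'.1.2.1 := by
  rw [← tgt_mul h.src_left, ← h.left, tgt_mul h.src_ar_left]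

theorem Via.tgt_right (h : Via r s k t t') : Y.tgt s = Y.tgt t'.1.2.2 := by
  rw [← tgt_mul h.src_right, ← h.right, tgt_mul h.src_ar_right]

theorem Rel.tgt_left : Rel r s t t' → X.tgt r = X.tgt t'.1.2.1 := fun ⟨_, h⟩ => h.tgt_left

theorem Rel.tgt_right : Rel r s t t' → Y.tgt s = Y.tgt t'.1.2.2 := fun ⟨_, h⟩ => h.tgt_right

theorem Rel.src_left : Rel r s t t' → X.src r = X.tgt t.1.2.1 := fun ⟨_, h⟩ => h.src_left

theorem Rel.src_right : Rel r s t t' → Y.src s = Y.tgt t.1.2.2 := fun ⟨_, h⟩ => h.src_right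

theorem Via.trans (h : Via r s k t t') (h' : Via r' s' k' t' t'') :
    Via (X.mul r' r) (Y.mul s' s) (Z.mul k' k) t t'' := by
  have hk : Z.src k' = Z.tgt k := h'.src.trans h.tgt.symm
  have hr : X.src r' = X.tgt r := h'.src_left.trans h.tgt_left.symm
  have hs : Y.src s' = Y.tgt s := h'.src_right.trans h.tgt_right.symm
  have hF : X.src (F.ar k') = X.tgt (F.ar k) := by rw [F.src_ar, F.tgt_ar, hk]
  have hG : Y.src (G.ar k') = Y.tgt (G.ar k) := by rw [G.src_ar, G.tgt_ar, hk]
  refine ⟨(src_mul hk).trans h.src, (tgt_mul hk).trans h'.tgt, (src_mul hr).trans h.src_left,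
    (src_mul hs).trans h.src_right, ?_, ?_⟩
  · rw [F.ar_mul hk, ← DefGroupoid.mul_assoc h'.src_ar_left hF, h'.left,
      DefGroupoid.mul_assoc h'.src_left h.src_ar_left, h.left,
      DefGroupoid.mul_assoc hr h.src_left]
  · rw [G.ar_mul hk, ← DefGroupoid.mul_assoc h'.src_ar_right hG, h'.right,
      DefGroupoid.mul_assoc h'.src_right h.src_ar_right, h.right,
      DefGroupoid.mul_assoc hs h.src_right]

theorem Rel.trans : Rel r s t t' → Rel r' s' t' t'' → Rel (X.mul r' r) (Y.mul s' s) t t'' :=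
  fun ⟨_, h⟩ ⟨_, h'⟩ => ⟨_, h.trans h'⟩

variable (t) in
theorem Rel.refl : Rel (X.id (X.tgt t.1.2.1)) (Y.id (Y.tgt t.1.2.2)) t t :=
  ⟨Z.id t.1.1, Z.src_id _, Z.tgt_id _, X.src_id _, Y.src_id _,
    by rw [F.ar_id, mul_id t.2.1, id_mul rfl], by rw [G.ar_id, mul_id t.2.2, id_mul rfl]⟩

theorem Rel.symm : Rel r s t t' → Rel (X.inv r) (Y.inv s) t' t := by
  rintro ⟨k, h⟩
  have hF : X.tgt (F.ar k) = X.src t'.1.2.1 := h.src_ar_left.symm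
  refine ⟨Z.inv k, (Z.src_inv k).trans h.tgt, (Z.tgt_inv k).trans h.src,
    (X.src_inv r).trans h.tgt_left, (Y.src_inv s).trans h.tgt_right, ?_, ?_⟩
  · have h1 : X.src t.1.2.1 = X.src (F.ar k) := by rw [t.2.1, F.src_ar, h.src]
    have h2 : X.src t.1.2.1 = X.tgt (X.inv (F.ar k)) := h1.trans (X.tgt_inv _).symm
    have h3 : X.src (X.inv r) = X.tgt t'.1.2.1 := (X.src_inv r).trans h.tgt_left
    rw [F.ar_inv]
    refine mul_right_cancel (f := F.ar k) ((src_mul h2).trans (X.src_inv _))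
      ((src_mul h3).trans h.src_ar_left) ?_
    rw [mul_inv_cancel_right h1, DefGroupoid.mul_assoc h3 h.src_ar_left, h.left,
      inv_mul_cancel_left h.src_left]
  · have h1 : Y.src t.1.2.2 = Y.src (G.ar k) := by rw [t.2.2, G.src_ar, h.src]
    have h2 : Y.src t.1.2.2 = Y.tgt (Y.inv (G.ar k)) := h1.trans (Y.tgt_inv _).symm
    have h3 : Y.src (Y.inv s) = Y.tgt t'.1.2.2 := (Y.src_inv s).trans h.tgt_right
    rw [G.ar_inv]
    refine mul_right_cancel (f := G.ar k) ((src_mul h2).trans (Y.src_inv _))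
      ((src_mul h3).trans h.src_ar_right) ?_
    rw [mul_inv_cancel_right h1, DefGroupoid.mul_assoc h3 h.src_ar_right, h.right,
      inv_mul_cancel_left h.src_right]

/-- The square in `X` prescribes the image of `k` under `F`; fullness of `F` produces `k`, and the
square in `Y` then determines `s`. Faithfulness gives the uniqueness of `s` in `Rel.unique`. -/
theorem Rel.exists (hs : X.src r = X.tgt t.1.2.1) (ht : X.tgt r = X.tgt t'.1.2.1) :
    ∃ s, Rel r s t t' := by
  have h1 : X.src (X.inv t'.1.2.1) = X.tgt (X.mul r t.1.2.1) :=
    (X.src_inv _).trans (ht.symm.trans (tgt_mul hs).symm)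
  obtain ⟨k, hk, hk', hkF⟩ := F.exists_ar (f := X.mul (X.inv t'.1.2.1) (X.mul r t.1.2.1))
    (x := t.1.1) (y := t'.1.1) ((src_mul h1).trans ((src_mul hs).trans t.2.1))
    ((tgt_mul h1).trans ((X.tgt_inv _).trans t'.2.1))
  have h2 : Y.src t'.1.2.2 = Y.tgt (G.ar k) := by rw [t'.2.2, G.tgt_ar, hk']
  have h3 : Y.src (Y.mul t'.1.2.2 (G.ar k)) = Y.src t.1.2.2 := by
    rw [src_mul h2, G.src_ar, hk, t.2.2]
  refine ⟨Y.mul (Y.mul t'.1.2.2 (G.ar k)) (Y.inv t.1.2.2), k, hk, hk', hs, ?_, ?_, ?_⟩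
  · rw [src_mul (h3.trans (Y.tgt_inv _).symm), Y.src_inv]
  · rw [hkF, mul_inv_cancel_left (ht.symm.trans (tgt_mul hs).symm)]
  · rw [mul_inv_cancel_right h3]

theorem Rel.unique : Rel r s t t' → Rel r s' t t' → s = s' := by
  rintro ⟨k, h⟩ ⟨k', h'⟩
  have hk : k = k' := F.ar_faithful (h.src.trans h'.src.symm) (h.tgt.trans h'.tgt.symm)
    (mul_left_cancel h.src_ar_left h'.src_ar_left (h.left.trans h'.left.symm))
  subst hk
  exact mul_right_cancel h.src_right h'.src_right (h.right.symm.trans h'.right)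

/-- Shifting `k` by `a` shifts both sides by the same `a`, since both morphisms respect the
identifications with `A`. This is why transport from `X` to `Y` preserves cocycles. -/
theorem Rel.sh (a : A) : Rel r s t t' → Rel (X.sh a r) (Y.sh a s) t t' := by
  rintro ⟨k, h⟩
  refine ⟨Z.sh a k, (src_sh _ _).trans h.src, (tgt_sh _ _).trans h.tgt,
    (src_sh _ _).trans h.src_left, (src_sh _ _).trans h.src_right, ?_, ?_⟩
  · rw [F.ar_sh, mul_sh h.src_ar_left, h.left, sh_mul h.src_left]
  · rw [G.ar_sh, mul_sh h.src_ar_right, h.right, sh_mul h.src_right]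

/-- Equivalence of cospans: isomorphism over the same feet. -/
def Equiv (t t' : Cospan F G) : Prop := Rel (X.id (X.tgt t.1.2.1)) (Y.id (Y.tgt t.1.2.2)) t t'

theorem Equiv.left (h : Equiv t t') : X.tgt t.1.2.1 = X.tgt t'.1.2.1 := by
  rw [← Rel.tgt_left h, X.tgt_id]

theorem Equiv.right (h : Equiv t t') : Y.tgt t.1.2.2 = Y.tgt t'.1.2.2 := by
  rw [← Rel.tgt_right h, Y.tgt_id]

theorem Rel.congr_right (h : Rel r s t t') (h' : Equiv t' t'') : Rel r s t t'' := by
  have := Rel.trans h h'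
  rwa [id_mul h.tgt_left, id_mul h.tgt_right] at this

theorem Rel.congr_left (h : Equiv t t') (h' : Rel r s t' t'') : Rel r s t t'' := by
  have := Rel.trans h h'
  rwa [mul_id (h'.src_left.trans h.left.symm), mul_id (h'.src_right.trans h.right.symm)] at this

theorem Equiv.symm (h : Equiv t t') : Equiv t' t := by
  have h' := Rel.symm h
  have e1 : X.inv (X.id (X.tgt t.1.2.1)) = X.id (X.tgt t'.1.2.1) := by
    rw [← h.left, ← mul_id (f := X.inv (X.id (X.tgt t.1.2.1))) (x := X.tgt t.1.2.1)
      ((X.src_inv _).trans (X.tgt_id _)), DefGroupoid.inv_mul, X.src_id]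
  have e2 : Y.inv (Y.id (Y.tgt t.1.2.2)) = Y.id (Y.tgt t'.1.2.2) := by
    rw [← h.right, ← mul_id (f := Y.inv (Y.id (Y.tgt t.1.2.2))) (x := Y.tgt t.1.2.2)
      ((Y.src_inv _).trans (Y.tgt_id _)), DefGroupoid.inv_mul, Y.src_id]
  rwa [e1, e2] at h'

theorem equiv_equivalence : Equivalence (Equiv (F := F) (G := G)) :=
  ⟨Rel.refl, Equiv.symm, fun h h' => Rel.congr_right h h'⟩

variable (F G) in
theorem rel_defPred : DefPred L K fun p : (X.Ar × Y.Ar) × (Cospan F G × Cospan F G) =>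
    Rel p.1.1 p.1.2 p.2.1 p.2.2 := by
  have hr : DefFun L K fun p : ((X.Ar × Y.Ar) × (Cospan F G × Cospan F G)) × Z.Ar => p.1.1.1 :=
    DefFun.fst.comp (DefFun.fst.comp DefFun.fst)
  have hs : DefFun L K fun p : ((X.Ar × Y.Ar) × (Cospan F G × Cospan F G)) × Z.Ar => p.1.1.2 :=
    DefFun.snd.comp (DefFun.fst.comp DefFun.fst)
  have ht : DefFun L K fun p : ((X.Ar × Y.Ar) × (Cospan F G × Cospan F G)) × Z.Ar => p.1.2.1.1 :=
    DefFun.val.comp (DefFun.fst.comp (DefFun.snd.comp DefFun.fst))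
  have ht' : DefFun L K fun p : ((X.Ar × Y.Ar) × (Cospan F G × Cospan F G)) × Z.Ar => p.1.2.2.1 :=
    DefFun.val.comp (DefFun.snd.comp (DefFun.snd.comp DefFun.fst))
  have hk : DefFun L K fun p : ((X.Ar × Y.Ar) × (Cospan F G × Cospan F G)) × Z.Ar => p.2 :=
    DefFun.snd
  have hf := DefFun.fst.comp (DefFun.snd.comp ht)
  have hg := DefFun.snd.comp (DefFun.snd.comp ht)
  have hf' := DefFun.fst.comp (DefFun.snd.comp ht')
  have hg' := DefFun.snd.comp (DefFun.snd.comp ht')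
  refine DefPred.congr (DefPred.exists (P := fun p : ((X.Ar × Y.Ar) × (Cospan F G × Cospan F G)) ×
      Z.Ar => Z.src p.2 = p.1.2.1.1.1 ∧ Z.tgt p.2 = p.1.2.2.1.1 ∧ X.src p.1.1.1 = X.tgt p.1.2.1.1.2.1 ∧
      Y.src p.1.1.2 = Y.tgt p.1.2.1.1.2.2 ∧
      X.mul p.1.2.2.1.2.1 (F.ar p.2) = X.mul p.1.1.1 p.1.2.1.1.2.1 ∧
      Y.mul p.1.2.2.1.2.2 (G.ar p.2) = Y.mul p.1.1.2 p.1.2.1.1.2.2) ?_)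
      fun p => exists_congr fun k => ⟨fun ⟨h1, h2, h3, h4, h5, h6⟩ => ⟨h1, h2, h3, h4, h5, h6⟩,
        fun ⟨h1, h2, h3, h4, h5, h6⟩ => ⟨h1, h2, h3, h4, h5, h6⟩⟩
  exact (DefPred.eq (Z.src_defFun.comp hk) (DefFun.fst.comp ht)).and
    ((DefPred.eq (Z.tgt_defFun.comp hk) (DefFun.fst.comp ht')).and
    ((DefPred.eq (X.src_defFun.comp hr) (X.tgt_defFun.comp hf)).and
    ((DefPred.eq (Y.src_defFun.comp hs) (Y.tgt_defFun.comp hg)).and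
    ((DefPred.eq (DefFun.comp₂ (h := X.mul) X.mul_defFun hf' (F.ar_defFun.comp hk))
      (DefFun.comp₂ (h := X.mul) X.mul_defFun hr hf)).and
    (DefPred.eq (DefFun.comp₂ (h := Y.mul) Y.mul_defFun hg' (G.ar_defFun.comp hk))
      (DefFun.comp₂ (h := Y.mul) Y.mul_defFun hs hg))))))

variable (F G) in
theorem equiv_defPred : DefPred L K fun p : Cospan F G × Cospan F G => Equiv p.1 p.2 := by
  have ht : DefFun L K fun p : Cospan F G × Cospan F G => p.1.1.2 :=
    DefFun.snd.comp (DefFun.val.comp DefFun.fst)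
  have h1 : DefFun L K fun p : Cospan F G × Cospan F G => X.id (X.tgt p.1.1.2.1) :=
    X.id_defFun.comp (X.tgt_defFun.comp (DefFun.fst.comp ht))
  have h2 : DefFun L K fun p : Cospan F G × Cospan F G => Y.id (Y.tgt p.1.1.2.2) :=
    Y.id_defFun.comp (Y.tgt_defFun.comp (DefFun.snd.comp ht))
  exact (rel_defPred F G).comp ((h1.pair h2).pair DefFun.id)

/-- The action of `A` on cospans through the right leg. -/
noncomputable def shift (a : A) (t : Cospan F G) : Cospan F G :=
  ⟨(t.1.1, t.1.2.1, Y.sh a t.1.2.2), t.2.1, (src_sh _ _).trans t.2.2⟩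

theorem Rel.shift {a : A} : Rel r (Y.sh a s) t t' ↔ Rel r s (shift a t) t' := by
  refine exists_congr fun k => ⟨fun h => ?_, fun h => ?_⟩
  · have hs : Y.src s = Y.tgt t.1.2.2 := (src_sh _ _).symm.trans h.src_right
    refine ⟨h.src, h.tgt, h.src_left, hs.trans (tgt_sh _ _).symm, h.left, ?_⟩
    exact h.right.trans ((sh_mul hs a).trans (mul_sh hs a).symm)
  · have hs : Y.src s = Y.tgt t.1.2.2 := h.src_right.trans (tgt_sh _ _)
    refine ⟨h.src, h.tgt, h.src_left, (src_sh _ _).trans hs, h.left, ?_⟩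
    exact h.right.trans ((mul_sh hs a).trans (sh_mul hs a).symm)

variable (F G) in
theorem shift_defFun : DefFun L K fun p : A × Cospan F G => shift p.1 p.2 := by
  have ht : DefFun L K fun p : A × Cospan F G => p.2.1 := DefFun.val.comp DefFun.snd
  exact DefFun.subtype_mk ((DefFun.fst.comp ht).pair ((DefFun.fst.comp (DefFun.snd.comp ht)).pair
    (DefFun.comp₂ (h := Y.sh) Y.sh_defFun DefFun.fst (DefFun.snd.comp (DefFun.snd.comp ht))))) _

end Cospan

end Bitorsor

end ModelGalois

/-! ### Morita invariance of the cohomology class -/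

namespace ModelGalois

variable {L : FirstOrder.Language.{u, v}} {U : Type w} [L.Structure U] {K : Set U}

section Surjective

variable {S T V : Type*} [Coded U S] [Coded U T] [Coded U V] [DefDom L K S] [DefDom L K T]
  [DefDom L K V] {f : S → T}

theorem DefPred.of_surjective (hf : DefFun L K f) (hsurj : Function.Surjective f) {P : T → Prop}
    (hP : DefPred L K fun s => P (f s)) : DefPred L K P := by
  refine (DefPred.exists (P := fun p : T × S => f p.2 = p.1 ∧ P (f p.2))
    ((DefPred.eq (hf.comp DefFun.snd) DefFun.fst).and hP.snd)).congr fun t => ⟨?_, fun h => ?_⟩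
  · rintro ⟨s, hs, h⟩
    obtain rfl : f s = t := hs
    exact h
  · obtain ⟨s, rfl⟩ := hsurj t
    exact ⟨s, rfl, h⟩

theorem DefFun.of_surjective (hf : DefFun L K f) (hsurj : Function.Surjective f) {g : T → V}
    (hg : DefFun L K fun s => g (f s)) : DefFun L K g :=
  DefPred.of_surjective (f := fun p : S × V => (f p.1, p.2))
    ((hf.comp DefFun.fst).pair DefFun.snd)
    (fun p => by
      obtain ⟨s, hs⟩ := hsurj p.1
      exact ⟨(s, p.2), Prod.ext hs rfl⟩) hg

end Surjective

variable {A : DefAbGroup L K}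

open DefGroupoid BoundedGroupoid

/-- Cocycles attached to Morita equivalent groupoids are cohomologous. -/
theorem class_eq_of_moritaMorphism (hEI : EliminatesImaginaries L U) (hA : A.TorsorsSplit)
    {X Y Z : BoundedGroupoid A} (F : MoritaMorphism Z X) (G : MoritaMorphism Z Y)
    (hY : Y.Connected) {h h' : contTwoCocycles (galoisGroup L K) A.Pts}
    (hh : IsAttachedCocycle X h) (hh' : IsAttachedCocycle Y h') :
    (QuotientAddGroup.mk h : contH2 (galoisGroup L K) A.Pts) = QuotientAddGroup.mk h' := by
  classical
  obtain ⟨x, u, Fx, hu⟩ := isAttachedCocycle_iff.1 hh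
  obtain ⟨y, v, Fy, hv⟩ := isAttachedCocycle_iff.1 hh'
  obtain ⟨Q, mk, hmk, hsurj, hiff⟩ :=
    hEI.exists_quotient Cospan.equiv_equivalence (Cospan.equiv_defPred F G)
  let rep := Function.surjInv hsurj
  have hrep : ∀ q, mk (rep q) = q := Function.surjInv_eq hsurj
  have hrep' : ∀ t, Cospan.Equiv (rep (mk t)) t := fun t => (hiff _ _).1 (hrep _)
  let π : Q → X.Ob × Y.Ob := fun q => (X.tgt (rep q).1.2.1, Y.tgt (rep q).1.2.2)
  have hπmk : ∀ t, π (mk t) = (X.tgt t.1.2.1, Y.tgt t.1.2.2) := fun t =>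
    Prod.ext (hrep' t).left (hrep' t).right
  have hleg : DefFun L K fun t : Cospan F G => t.1.2 := DefFun.snd.comp DefFun.val
  have hπ : DefFun L K π := DefFun.of_surjective hmk hsurj (DefFun.congr
    ((X.tgt_defFun.comp (DefFun.fst.comp hleg)).pair (Y.tgt_defFun.comp (DefFun.snd.comp hleg)))
    fun t => (hπmk t).symm)
  -- The representatives `rep` need not be definable. `M` and `act` nevertheless are, since they are
  -- induced by definable data on cospans compatible with the equivalence.
  let M : X.Ar → Y.Ar → Q → Q → Prop := fun r s p q => Cospan.Rel r s (rep p) (rep q)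
  have hMmk : ∀ r s t t', M r s (mk t) (mk t') ↔ Cospan.Rel r s t t' := fun r s t t' =>
    ⟨fun e => Cospan.Rel.congr_left (hrep' t).symm (e.congr_right (hrep' t')),
      fun e => Cospan.Rel.congr_left (hrep' t) (e.congr_right (hrep' t').symm)⟩
  have hM : DefPred L K fun p : (X.Ar × Y.Ar) × (Q × Q) => M p.1.1 p.1.2 p.2.1 p.2.2 := by
    refine DefPred.of_surjective
      (f := fun p : (X.Ar × Y.Ar) × (Cospan F G × Cospan F G) => (p.1, (mk p.2.1, mk p.2.2)))
      (DefFun.fst.pair ((hmk.comp (DefFun.fst.comp DefFun.snd)).pair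
        (hmk.comp (DefFun.snd.comp DefFun.snd)))) ?_
      ((Cospan.rel_defPred F G).congr fun p => (hMmk _ _ _ _).symm)
    rintro ⟨r, p, q⟩
    exact ⟨(r, rep p, rep q), by simp [hrep]⟩
  let act : A → Q → Q := fun a q => mk (Cospan.shift a (rep q))
  have hshift : ∀ {a : A} {r s t t'}, M r (Y.sh a s) (mk t) (mk t') ↔
      M r s (mk (Cospan.shift a t)) (mk t') := fun {a r s t t'} => by
    rw [hMmk, hMmk, Cospan.Rel.shift]
  have hmk_eq : ∀ t t', mk t = mk t' ↔
      M (X.id (X.tgt t.1.2.1)) (Y.id (Y.tgt t.1.2.2)) (mk t) (mk t') := fun t t' => by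
    rw [hiff, hMmk, Cospan.Equiv]
  have hactmk : ∀ a t, act a (mk t) = mk (Cospan.shift a t) := fun a t => by
    refine (hmk_eq _ _).2 ?_
    show M (X.id (X.tgt (rep (mk t)).1.2.1)) (Y.id (Y.tgt (Y.sh a (rep (mk t)).1.2.2))) _ _
    rw [← hshift, tgt_sh, hrep, (hrep' t).left, (hrep' t).right]
    refine (hMmk _ _ _ _).2 ?_
    obtain ⟨k, hk⟩ := Cospan.Rel.refl t
    have hs : Y.src (Y.id (Y.tgt t.1.2.2)) = Y.tgt t.1.2.2 := Y.src_id _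
    refine ⟨k, hk.src, hk.tgt, hk.src_left, (src_sh _ _).trans hs, hk.left, ?_⟩
    have h1 := hk.src_ar_right
    rw [sh_mul hs, ← hk.right, ← sh_mul h1]
    rfl
  obtain ⟨p, hp, hpπ⟩ := hA.exists_alg (π := π) (act := act) hπ
    (DefFun.of_surjective (f := fun z : A × Cospan F G => (z.1, mk z.2))
      (DefFun.fst.pair (hmk.comp DefFun.snd))
      (by rintro ⟨a, q⟩; exact ⟨(a, rep q), Prod.ext rfl (hrep q)⟩)
      (DefFun.congr (hmk.comp (Cospan.shift_defFun F G)) fun z => (hactmk _ _).symm))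
    (fun a q => by
      obtain ⟨t, rfl⟩ := hsurj q
      rw [hactmk, hπmk, hπmk]
      exact Prod.ext rfl (tgt_sh _ _))
    (fun q => by
      obtain ⟨t, rfl⟩ := hsurj q
      rw [hactmk]
      exact congrArg mk (Subtype.ext (Prod.ext rfl (Prod.ext rfl (sh_zero _)))))
    (fun a b q => by
      obtain ⟨t, rfl⟩ := hsurj q
      rw [hactmk (a + b), hactmk b, hactmk a]
      exact congrArg mk (Subtype.ext (Prod.ext rfl (Prod.ext rfl (sh_sh _ _ _).symm))))
    (fun q q' e => by
      obtain ⟨t, rfl⟩ := hsurj q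
      obtain ⟨t', rfl⟩ := hsurj q'
      rw [hπmk, hπmk] at e
      obtain ⟨s, hs⟩ := Cospan.Rel.exists (t := t) (t' := t') (r := X.id (X.tgt t.1.2.1))
        (X.src_id _) ((X.tgt_id _).trans (congrArg Prod.fst e))
      -- Cospans with the same feet are related by the identity of `X` and a unique automorphism `s`
      -- in `Y`; acting by `a` joins their classes exactly when `s` is the automorphism given by
      -- `a`.
      have hall : ∀ a, act a (mk t) = mk t' ↔ Y.sh a (Y.id (Y.tgt t.1.2.2)) = s := fun a => by
        rw [hactmk, hmk_eq, ← hshift, hMmk]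
        show Cospan.Rel (X.id (X.tgt t.1.2.1)) (Y.sh a (Y.id (Y.tgt (Y.sh a t.1.2.2)))) t t' ↔ _
        rw [tgt_sh]
        exact ⟨fun e' => e'.unique hs, fun e' => e' ▸ hs⟩
      simp only [hall]
      refine existsUnique_sh ?_ ?_
      · rw [Y.src_id, hs.src_right]
      · rw [Y.tgt_id, hs.tgt_right]
        exact congrArg Prod.snd e)
    (Fx.alg_ob.pair Fy.alg_ob) (by
      obtain ⟨z, rfl⟩ := F.surjective x
      obtain ⟨g, hg, hg'⟩ := hY.2 (G.ob z) y
      refine ⟨mk ⟨(z, X.id (F.ob z), g), X.src_id _, hg⟩, (hπmk _).trans ?_⟩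
      exact Prod.ext (X.tgt_id _) hg')
  have hπσ : ∀ σ : galoisGroup L K, π (gal σ p) = (gal σ x, gal σ y) := fun σ => by
    rw [gal_map hπ σ hp, hpπ, gal_pair σ Fx.alg_ob Fy.alg_ob]
  have hex : ∀ σ, ∃ s, M (u σ) s p (gal σ p) := fun σ => Cospan.Rel.exists
    ((Fx.src σ).trans (congrArg Prod.fst hpπ).symm)
    ((Fx.tgt σ).trans (congrArg Prod.fst (hπσ σ)).symm)
  -- The arrow of `Y` is chosen as a function of the pair `(u σ, gal σ p)`, which is locally
  -- constant in `σ`. At these pairs a solution exists, so the default is not used.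
  let S : X.Ar × Q → Y.Ar := fun z =>
    if hz : ∃ s, M z.1 s p z.2 then hz.choose else v 1
  have hS : ∀ σ, M (u σ) (S (u σ, gal σ p)) p (gal σ p) := fun σ => by
    have hz := hex σ
    show M (u σ) (dite _ _ _) p (gal σ p)
    rw [dif_pos hz]
    exact hz.choose_spec
  let v' : galoisGroup L K → Y.Ar := fun σ => S (u σ, gal σ p)
  have hlocp : IsLocallyConstant fun σ : galoisGroup L K => gal σ p :=
    IsLocallyConstant.gal continuous_id (IsLocallyConstant.const p) fun _ => hp
  have halg : ∀ σ, Alg L K (v' σ) := fun σ => by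
    refine Alg.of_rel (R := fun (z : X.Ar × (Q × Q)) s => M z.1 s z.2.1 z.2.2) ?_
      (fun _ _ _ e e' => e.unique e') ((Fx.alg σ).pair (hp.pair (hp.map_gal σ))) (hS σ)
    exact hM.comp (((DefFun.fst.comp DefFun.fst).pair DefFun.snd).pair (DefFun.snd.comp DefFun.fst))
  have Fv' : Y.Frame y v' :=
    { alg_ob := Fy.alg_ob
      alg := halg
      isLocallyConstant := (Fx.isLocallyConstant.prodMk hlocp).comp S
      src := fun σ => (hS σ).src_right.trans (congrArg Prod.snd hpπ)
      tgt := fun σ => (hS σ).tgt_right.trans (congrArg Prod.snd (hπσ σ)) }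
  refine Frame.class_eq Fv' Fy (fun σ τ => ?_) hv
  -- Composing the conjugated relation with the one for `σ` relates `p` to its conjugate under `στ`.
  -- Its `X`-side is `u (σ * τ)` shifted by `h (σ, τ)`, so by `Rel.sh` and uniqueness its `Y`-side
  -- is `v' (σ * τ)` shifted by the same element.
  have h1 : M (gal σ (u τ)) (gal σ (v' τ)) (gal σ p) (gal σ (gal τ p)) := by
    have := (gal_pred hM σ (((Fx.alg τ).pair (halg τ)).pair (hp.pair (hp.map_gal τ)))).2 (hS τ)
    rwa [gal_pair σ ((Fx.alg τ).pair (halg τ)) (hp.pair (hp.map_gal τ)),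
      gal_pair σ (Fx.alg τ) (halg τ), gal_pair σ hp (hp.map_gal τ)] at this
  have h2 := (hS σ).trans h1
  rw [← gal_mul σ τ hp, hu] at h2
  exact h2.unique ((hS (σ * τ)).sh _)

end ModelGalois

/-! ### Pair groupoids twisted by a cocycle -/

namespace ModelGalois

variable {L : FirstOrder.Language.{u, v}} {U : Type w} [L.Structure U] {K : Set U}
  {A : DefAbGroup L K}

open DefGroupoid BoundedGroupoid

section Twist

variable (O : DefSet L K) (A)

/-- The arrows of a twisted pair groupoid: triples of two objects and an element of `A`. -/
noncomputable def twistAr : DefSet L K := (exists_defSet_equiv (L := L) K (O × O × A)).choose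

/-- The arrow with given source, target and value. -/
noncomputable def twistEquiv : O × O × A ≃ twistAr A O :=
  (exists_defSet_equiv (L := L) K (O × O × A)).choose_spec.choose

variable {O A}

theorem twistEquiv_defFun : DefFun L K (twistEquiv A O) :=
  (exists_defSet_equiv (L := L) K (O × O × A)).choose_spec.choose_spec.1

theorem twistEquiv_symm_defFun : DefFun L K (twistEquiv A O).symm :=
  (exists_defSet_equiv (L := L) K (O × O × A)).choose_spec.choose_spec.2

variable {c : O → O → O → A}

/-- The homogeneous 2-cocycle identity. -/
def IsPairCocycle (c : O → O → O → A) : Prop :=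
  ∀ x y z t, c y z t + c x y t = c x y z + c x z t

namespace IsPairCocycle

/-- The cocycle is not assumed normalised. Its degenerate values depend on the repeated point only,
so the single correction `-c x x x` in the identity at `x` works for composition on both sides. -/
theorem right (hc : IsPairCocycle c) (x y : O) : c x y y = c y y y :=
  (add_right_cancel (hc x y y y)).symm

theorem left (hc : IsPairCocycle c) (x y : O) : c x x y = c x x x :=
  add_right_cancel (hc x x x y)

theorem swap (hc : IsPairCocycle c) (x y : O) : c y x y + c y y y = c x y x + c x x x := by
  have h := hc x y x y
  rwa [hc.right x y, hc.left x y] at h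

end IsPairCocycle

/-- The pair groupoid of a definable set with composition twisted by a cocycle. -/
noncomputable def twist (hdef : DefFun L K fun p : O × O × O => c p.1 p.2.1 p.2.2)
    (hc : IsPairCocycle c) : BoundedGroupoid A :=
  have hs : DefFun L K fun f : twistAr A O => ((twistEquiv A O).symm f).1 :=
    DefFun.fst.comp twistEquiv_symm_defFun
  have ht : DefFun L K fun f : twistAr A O => ((twistEquiv A O).symm f).2.1 :=
    DefFun.fst.comp (DefFun.snd.comp twistEquiv_symm_defFun)
  have hv : DefFun L K fun f : twistAr A O => ((twistEquiv A O).symm f).2.2 :=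
    DefFun.snd.comp (DefFun.snd.comp twistEquiv_symm_defFun)
  have hadd {S : Type w} [Coded U S] [DefDom L K S] {a b : S → A} (ha : DefFun L K a)
      (hb : DefFun L K b) : DefFun L K fun s => a s + b s :=
    DefFun.comp₂ (h := fun a b : A => a + b) A.add_defFun ha hb
  have hneg {S : Type w} [Coded U S] [DefDom L K S] {a : S → A} (ha : DefFun L K a) :
      DefFun L K fun s => -a s := A.neg_defFun.comp ha
  have hcc {S : Type w} [Coded U S] [DefDom L K S] {x y z : S → O} (hx : DefFun L K x)
      (hy : DefFun L K y) (hz : DefFun L K z) : DefFun L K fun s => c (x s) (y s) (z s) :=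
    hdef.comp (hx.pair (hy.pair hz))
  { Ob := O
    Ar := twistAr A O
    src := fun f => ((twistEquiv A O).symm f).1
    tgt := fun f => ((twistEquiv A O).symm f).2.1
    id := fun x => twistEquiv A O (x, x, -c x x x)
    -- The value is forced by the left inverse law; the right inverse law then needs
    -- `IsPairCocycle.swap`.
    inv := fun f => twistEquiv A O (((twistEquiv A O).symm f).2.1, ((twistEquiv A O).symm f).1,
      -((twistEquiv A O).symm f).2.2 + (-c ((twistEquiv A O).symm f).1
        ((twistEquiv A O).symm f).2.1 ((twistEquiv A O).symm f).1 +
      -c ((twistEquiv A O).symm f).1 ((twistEquiv A O).symm f).1 ((twistEquiv A O).symm f).1))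
    comp := fun g f _ => twistEquiv A O (((twistEquiv A O).symm f).1,
      ((twistEquiv A O).symm g).2.1, ((twistEquiv A O).symm f).2.2 + ((twistEquiv A O).symm g).2.2 +
      c ((twistEquiv A O).symm f).1 ((twistEquiv A O).symm f).2.1 ((twistEquiv A O).symm g).2.1)
    src_id := fun x => by simp
    tgt_id := fun x => by simp
    src_inv := fun f => by simp
    tgt_inv := fun f => by simp
    src_comp := fun g f _ => by simp
    tgt_comp := fun g f _ => by simp
    id_comp := fun f => by
      obtain ⟨⟨x, y, a⟩, rfl⟩ := (twistEquiv A O).surjective f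
      simp [hc.right x y]
    comp_id := fun f => by
      obtain ⟨⟨x, y, a⟩, rfl⟩ := (twistEquiv A O).surjective f
      simp [hc.left x y]
    inv_comp := fun f => by
      obtain ⟨⟨x, y, a⟩, rfl⟩ := (twistEquiv A O).surjective f
      simp
    comp_inv := fun f => by
      obtain ⟨⟨x, y, a⟩, rfl⟩ := (twistEquiv A O).surjective f
      have h := hc.swap x y
      simp only [Equiv.symm_apply_apply, EmbeddingLike.apply_eq_iff_eq, Prod.mk.injEq, true_and]
      rw [eq_neg_iff_add_eq_zero, _root_.add_assoc, h]
      abel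
    assoc := fun k g f h h' => by
      obtain ⟨⟨x, y, a⟩, rfl⟩ := (twistEquiv A O).surjective f
      obtain ⟨⟨y', z, b⟩, rfl⟩ := (twistEquiv A O).surjective g
      obtain ⟨⟨z', t, d⟩, rfl⟩ := (twistEquiv A O).surjective k
      simp only [Equiv.symm_apply_apply] at h h'
      subst h h'
      have e := hc x y' z' t
      simp only [Equiv.symm_apply_apply, EmbeddingLike.apply_eq_iff_eq, Prod.mk.injEq, true_and]
      rw [show a + (b + d + c y' z' t) + c x y' t = a + b + d + (c y' z' t + c x y' t) by abel, e]
      abel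
    src_def := isDefMap_iff.2 hs
    tgt_def := isDefMap_iff.2 ht
    id_def := isDefMap_iff.2 (twistEquiv_defFun.comp (DefFun.id.pair (DefFun.id.pair
      (hneg (hcc DefFun.id DefFun.id DefFun.id)))))
    inv_def := isDefMap_iff.2 (twistEquiv_defFun.comp (ht.pair (hs.pair
      (hadd (hneg hv) (hadd (hneg (hcc hs ht hs)) (hneg (hcc hs hs hs)))))))
    comp_def := (definable_partial_iff (Q := fun p : twistAr A O × twistAr A O =>
        ((twistEquiv A O).symm p.1).1 = ((twistEquiv A O).symm p.2).2.1)
      (f := fun p _ => twistEquiv A O (((twistEquiv A O).symm p.2).1,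
        ((twistEquiv A O).symm p.1).2.1, ((twistEquiv A O).symm p.2).2.2 +
        ((twistEquiv A O).symm p.1).2.2 + c ((twistEquiv A O).symm p.2).1
        ((twistEquiv A O).symm p.2).2.1 ((twistEquiv A O).symm p.1).2.1))).2 (by
      have hg : DefFun L K fun p : (twistAr A O × twistAr A O) × twistAr A O => p.1.1 :=
        DefFun.fst.comp DefFun.fst
      have hf : DefFun L K fun p : (twistAr A O × twistAr A O) × twistAr A O => p.1.2 :=
        DefFun.snd.comp DefFun.fst
      refine ((DefPred.eq (hs.comp hg) (ht.comp hf)).and (DefPred.eq (twistEquiv_defFun.comp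
        ((hs.comp hf).pair ((ht.comp hg).pair (hadd (hadd (hv.comp hf) (hv.comp hg))
          (hcc (hs.comp hf) (ht.comp hf) (ht.comp hg)))))) DefFun.snd)).congr fun p => ?_
      exact exists_prop.symm)
    bound := fun x a => twistEquiv A O (x, x, a + -c x x x)
    src_bound := fun x a => by simp
    tgt_bound := fun x a => by simp
    bound_bijective := fun x f h h' => by
      obtain ⟨⟨y, z, a⟩, rfl⟩ := (twistEquiv A O).surjective f
      simp only [Equiv.symm_apply_apply] at h h'
      subst h h'
      refine ⟨a + c z z z, by simp, fun b hb => ?_⟩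
      simp only [EmbeddingLike.apply_eq_iff_eq, Prod.mk.injEq, true_and] at hb
      rw [← hb]
      abel
    bound_add := fun x a b => by
      simp only [Equiv.symm_apply_apply, EmbeddingLike.apply_eq_iff_eq, Prod.mk.injEq, true_and]
      abel
    bound_natural := fun f a => by
      obtain ⟨⟨x, y, b⟩, rfl⟩ := (twistEquiv A O).surjective f
      simp only [Equiv.symm_apply_apply, EmbeddingLike.apply_eq_iff_eq, Prod.mk.injEq, true_and,
        hc.left x y, hc.right x y]
      abel
    bound_def := isDefMap₂_iff.2 (twistEquiv_defFun.comp (DefFun.fst.pair (DefFun.fst.pair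
      (hadd DefFun.snd (hneg (hcc DefFun.fst DefFun.fst DefFun.fst)))))) }

variable {hdef : DefFun L K fun p : O × O × O => c p.1 p.2.1 p.2.2} {hc : IsPairCocycle c}

variable (hdef hc) in
/-- The arrow of the twisted pair groupoid with given source, target and value. -/
noncomputable def twistArrow (p : O × O × A) : (twist hdef hc).Ar := twistEquiv A O p

variable (hdef hc) in
/-- The source, target and value of an arrow of the twisted pair groupoid. -/
noncomputable def twistVal (f : (twist hdef hc).Ar) : O × O × A := (twistEquiv A O).symm f

theorem twistVal_arrow (p : O × O × A) : twistVal hdef hc (twistArrow hdef hc p) = p :=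
  (twistEquiv A O).symm_apply_apply p

theorem twistArrow_surjective : Function.Surjective (twistArrow hdef hc) :=
  (twistEquiv A O).surjective

theorem twistArrow_defFun : DefFun L K (twistArrow hdef hc) := twistEquiv_defFun

theorem twistVal_defFun : DefFun L K (twistVal hdef hc) := twistEquiv_symm_defFun

theorem src_twist (p : O × O × A) : (twist hdef hc).src (twistArrow hdef hc p) = p.1 :=
  congrArg Prod.fst (twistVal_arrow p)

theorem tgt_twist (p : O × O × A) : (twist hdef hc).tgt (twistArrow hdef hc p) = p.2.1 :=
  congrArg (fun p => p.2.1) (twistVal_arrow p)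

theorem mul_twist (x y z : O) (a b : A) : (twist hdef hc).mul (twistArrow hdef hc (y, z, b))
    (twistArrow hdef hc (x, y, a)) = twistArrow hdef hc (x, z, a + b + c x y z) := by
  rw [← comp_eq_mul ((src_twist (y, z, b)).trans (tgt_twist (x, y, a)).symm)]
  refine congrArg (twistArrow hdef hc) (?_ : (_, _, _) = _)
  simp only [twistArrow, Equiv.symm_apply_apply]

theorem bound_twist (x : O) (a : A) :
    (twist hdef hc).bound x a = twistArrow hdef hc (x, x, a + -c x x x) := rfl

theorem sh_twist (x y : O) (a b : A) :
    (twist hdef hc).sh b (twistArrow hdef hc (x, y, a)) = twistArrow hdef hc (x, y, a + b) := by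
  rw [BoundedGroupoid.sh, src_twist, bound_twist, mul_twist, hc.left x y]
  congr 3
  abel

theorem connected_twist [Nonempty O] : (twist hdef hc).Connected :=
  ⟨‹Nonempty O›, fun x y => ⟨twistArrow hdef hc (x, y, 0), src_twist _, tgt_twist _⟩⟩

/-- A Morita morphism out of a twisted pair groupoid is given by a family of arrows between the
images of its objects whose composition is twisted by the cocycle. -/
noncomputable def twistMorita {X : BoundedGroupoid A} {ob : O → X.Ob} {W : O → O → X.Ar}
    (hob : DefFun L K ob) (hsurj : Function.Surjective ob)
    (hW : DefFun L K fun p : O × O => W p.1 p.2) (hsrc : ∀ x y, X.src (W x y) = ob x)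
    (htgt : ∀ x y, X.tgt (W x y) = ob y)
    (hmul : ∀ x y z, X.mul (W y z) (W x y) = X.sh (c x y z) (W x z)) :
    MoritaMorphism (twist hdef hc) X :=
  have hval : DefFun L K fun f => (twistVal hdef hc f).2 := DefFun.snd.comp twistVal_defFun
  -- Cancelling `W x x` in `hmul x x x` shows that it is the identity up to the same degenerate
  -- value as in the twisted groupoid.
  have hid (x : O) : W x x = X.sh (c x x x) (X.id (ob x)) := by
    refine mul_left_cancel (g := W x x) ((hsrc x x).trans (htgt x x).symm) ?_ ?_
    · rw [hsrc, tgt_sh, X.tgt_id]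
    · rw [hmul, mul_sh ((hsrc x x).trans (X.tgt_id _).symm), mul_id (hsrc x x)]
  have hbound (x : O) (a : A) : X.sh (a + -c x x x) (W x x) = X.bound (ob x) a := by
    rw [hid, sh_sh, neg_add_cancel_right, sh_id]
  { ob := ob
    ar := fun f => X.sh (twistVal hdef hc f).2.2 (W (twistVal hdef hc f).1 (twistVal hdef hc f).2.1)
    src_ar := fun _ => (src_sh _ _).trans (hsrc _ _)
    tgt_ar := fun _ => (tgt_sh _ _).trans (htgt _ _)
    map_comp := fun g f h => by
      obtain ⟨⟨x, y, a⟩, rfl⟩ := twistArrow_surjective f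
      obtain ⟨⟨y', z, b⟩, rfl⟩ := twistArrow_surjective g
      obtain rfl : y' = y := (src_twist _).symm.trans (h.trans (tgt_twist _))
      have hs : X.src (W y' z) = X.tgt (W x y') := (hsrc _ _).trans (htgt _ _).symm
      rw [comp_eq_mul, comp_eq_mul, mul_twist]
      simp only [twistVal_arrow]
      rw [sh_mul (hs.trans (tgt_sh _ _).symm), mul_sh hs, sh_sh, hmul, sh_sh, add_comm b a]
    surjective := hsurj
    full_faithful := fun x y f hs ht => by
      obtain ⟨a, ha, ha'⟩ := existsUnique_sh ((hsrc x y).trans hs.symm) ((htgt x y).trans ht.symm)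
      refine ⟨twistArrow hdef hc (x, y, a), ⟨src_twist _, tgt_twist _, ?_⟩, ?_⟩
      · simpa only [twistVal_arrow] using ha
      · rintro g ⟨h1, h2, h3⟩
        obtain ⟨⟨x', y', b⟩, rfl⟩ := twistArrow_surjective g
        obtain rfl : x' = x := (src_twist _).symm.trans h1
        obtain rfl : y' = y := (tgt_twist _).symm.trans h2
        rw [ha' b (by simpa only [twistVal_arrow] using h3)]
    map_bound := fun x a => by
      refine (congrArg (fun p : O × O × A => X.sh p.2.2 (W p.1 p.2.1)) (twistVal_arrow _)).trans ?_
      exact hbound x a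
    ob_def := isDefMap_iff.2 hob
    ar_def := isDefMap_iff.2 (DefFun.comp₂ (h := X.sh) X.sh_defFun (DefFun.snd.comp hval)
      (DefFun.comp₂ (h := W) hW (DefFun.fst.comp twistVal_defFun) (DefFun.fst.comp hval))) }

end Twist

end ModelGalois

/-! ### Every class is realised, and the class determines the groupoid up to Morita equivalence -/

namespace ModelGalois

variable {L : FirstOrder.Language.{u, v}} {U : Type w} [L.Structure U] {K : Set U}
  {A : DefAbGroup L K}

open DefGroupoid BoundedGroupoid

theorem DefAbGroup.gal_zero (A : DefAbGroup L K) (σ : galoisGroup L K) :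
    gal σ (0 : A) = 0 :=
  ((gal_pred A.zero_defPred σ (0 : A.Pts).2).2 rfl).symm

theorem DefAbGroup.gal_add (A : DefAbGroup L K) (σ : galoisGroup L K) {a b : A}
    (ha : Alg L K a) (hb : Alg L K b) : gal σ a + gal σ b = gal σ (a + b) :=
  gal_map₂ (f := fun a b : A => a + b) A.add_defFun σ ha hb

theorem isLocallyConstant_gal_cocycle (h : contTwoCocycles (galoisGroup L K) A.Pts) :
    IsLocallyConstant fun p : galoisGroup L K × galoisGroup L K × galoisGroup L K =>
      gal p.1 (h.1 p.2).1 :=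
  IsLocallyConstant.gal continuous_fst
    ((h.2.1.comp_continuous continuous_snd).comp Subtype.val) fun p => (h.1 p.2).2

/-- A continuous cocycle, and a continuous equivariant family of algebraic elements, are given by
`K`-definable maps on the conjugates of some algebraic element. -/
theorem exists_descent_cocycle (h : contTwoCocycles (galoisGroup L K) A.Pts) {T : Type*}
    [Coded U T] [DefDom L K T] {f : galoisGroup L K × galoisGroup L K × galoisGroup L K → T}
    (hf : IsLocallyConstant f) (halg : ∀ p, Alg L K (f p))
    (hgal : ∀ g σ τ ρ, f (g * σ, τ, ρ) = gal g (f (σ, τ, ρ))) :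
    ∃ (E : DefSet L K) (e : E) (c : E → E → E → A) (F : E → E → E → T), Alg L K e ∧
      (∀ a : E, ∃ σ : galoisGroup L K, gal σ e = a) ∧
      (DefFun L K fun p : E × E × E => c p.1 p.2.1 p.2.2) ∧ IsPairCocycle c ∧
      (DefFun L K fun p : E × E × E => F p.1 p.2.1 p.2.2) ∧
      (∀ σ τ ρ, c (gal σ e) (gal τ e) (gal ρ e) = gal σ (h.1 (σ⁻¹ * τ, τ⁻¹ * ρ)).1) ∧
      ∀ σ τ ρ, F (gal σ e) (gal τ e) (gal ρ e) = f (σ, σ⁻¹ * τ, τ⁻¹ * ρ) := by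
  have hh (p) : Alg L K (h.1 p).1 := (h.1 p).2
  obtain ⟨E, e, F, he, htr, hF, hFe⟩ := exists_descent (T := A × T)
    (f := fun p => (gal p.1 (h.1 p.2).1, f p)) ((isLocallyConstant_gal_cocycle h).prodMk hf)
    (fun p => ((hh _).map_gal _).pair (halg p)) fun g σ τ ρ => by
      rw [gal_pair _ ((hh _).map_gal _) (halg _), hgal, gal_mul _ _ (hh _)]
  refine ⟨E, e, fun a b d => (F a b d).1, fun a b d => (F a b d).2, he, htr, DefFun.fst.comp hF,
    fun x y z t => ?_, DefFun.snd.comp hF, fun σ τ ρ => congrArg Prod.fst (hFe σ τ ρ),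
    fun σ τ ρ => congrArg Prod.snd (hFe σ τ ρ)⟩
  obtain ⟨σ, rfl⟩ := htr x
  obtain ⟨τ, rfl⟩ := htr y
  obtain ⟨ρ, rfl⟩ := htr z
  obtain ⟨κ, rfl⟩ := htr t
  simp only [hFe]
  -- The homogeneous identity at four conjugates of `e` is `σ` applied to the inhomogeneous one at
  -- the successive quotients.
  have key := congrArg (fun a : A.Pts => gal σ a.1) (h.2.2 (σ⁻¹ * τ) (τ⁻¹ * ρ) (ρ⁻¹ * κ))
  have e1 : gal σ (((σ⁻¹ * τ) • h.1 (τ⁻¹ * ρ, ρ⁻¹ * κ) : A.Pts).1) =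
      gal τ (h.1 (τ⁻¹ * ρ, ρ⁻¹ * κ)).1 := by
    rw [A.smul_val, ← gal_mul _ _ (hh _), _root_.mul_inv_cancel_left]
  have e2 (a b : A.Pts) : gal σ ((a + b : A.Pts).1) = gal σ a.1 + gal σ b.1 :=
    (A.gal_add σ a.2 b.2).symm
  simp only [e2, e1, _root_.mul_assoc, _root_.mul_inv_cancel_left] at key
  rw [← key, add_comm]

/-- In the pair groupoid of the orbit of `e` twisted by `c`, the arrows from `e` to `gal σ e` of
value `0` form a frame. Its defect is `c` at `e`, `gal σ e` and `gal (σ * τ) e`, which is `h (σ,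
τ)`. -/
theorem exists_splitGroupoid (h : contTwoCocycles (galoisGroup L K) A.Pts) :
    ∃ X : SplitGroupoid A, IsAttachedCocycle X.1 h := by
  have hh (p) : Alg L K (h.1 p).1 := (h.1 p).2
  -- No second family has to descend here, so the cocycle itself fills that place.
  obtain ⟨E, e, c, -, he, -, hdef, hc, -, hce, -⟩ := exists_descent_cocycle h
    (isLocallyConstant_gal_cocycle h) (fun p => (hh _).map_gal _)
    fun g σ τ ρ => gal_mul _ _ (hh _)
  have : Nonempty E := ⟨e⟩
  have h0 : Alg L K (0 : A) := (0 : A.Pts).2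
  have htriple (σ : galoisGroup L K) : Alg L K (e, gal σ e, (0 : A)) :=
    he.pair ((he.map_gal σ).pair h0)
  have hloc : IsLocallyConstant fun σ : galoisGroup L K => gal σ e :=
    IsLocallyConstant.gal continuous_id (IsLocallyConstant.const e) fun _ => he
  have hF : (twist hdef hc).Frame e fun σ => twistArrow hdef hc (e, gal σ e, 0) :=
    { alg_ob := he
      alg := fun σ => Alg.of_defFun twistArrow_defFun (htriple σ)
      isLocallyConstant := hloc.comp fun b => twistArrow hdef hc (e, b, 0)
      src := fun σ => src_twist _
      tgt := fun σ => tgt_twist _ }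
  refine ⟨⟨twist hdef hc, connected_twist, hasSplitTorsor_of_alg (X := (twist hdef hc).toDefGroupoid)
    (x := e) he⟩, isAttachedCocycle_iff.2 ⟨e, _, hF, fun σ τ => ?_⟩⟩
  have hc1 : c e (gal σ e) (gal σ (gal τ e)) = (h.1 (σ, τ)).1 := by
    have := hce 1 σ (σ * τ)
    rwa [gal_one he, gal_one (hh _), inv_one, one_mul, _root_.inv_mul_cancel_left, gal_mul _ _ he] at this
  rw [← gal_map twistArrow_defFun σ (htriple τ), gal_pair σ he ((he.map_gal τ).pair h0),
    gal_pair σ (he.map_gal τ) h0, A.gal_zero, mul_twist, hc1, gal_mul _ _ he, sh_twist, add_zero]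

/-- Arrows of `X` between given objects whose composition is twisted by the cocycle `c`. -/
structure Diagram {E : DefSet L K} (c : E → E → E → A) (X : BoundedGroupoid A) (ob : E → X.Ob)
    (ar : E → E → X.Ar) : Prop where
  ob_defFun : DefFun L K ob
  ar_defFun : DefFun L K fun p : E × E => ar p.1 p.2
  src : ∀ x y, X.src (ar x y) = ob x
  tgt : ∀ x y, X.tgt (ar x y) = ob y
  mul : ∀ x y z, X.mul (ar y z) (ar x y) = X.sh (c x y z) (ar x z)

namespace Diagram

variable {E O : DefSet L K} {c : E → E → E → A} {X : BoundedGroupoid A} {ob : E → X.Ob}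
  {ar : E → E → X.Ar}

theorem src_eq_tgt (D : Diagram c X ob ar) (x y z : E) : X.src (ar y z) = X.tgt (ar x y) :=
  (D.src y z).trans (D.tgt x y).symm

/-- The twisted composition law at the conjugates of `e` under `σ`, `τ`, `ρ` is `σ` applied to the
law of the frame at `(σ⁻¹ * τ, τ⁻¹ * ρ)`. -/
theorem of_frame {x : X.Ob} {u : galoisGroup L K → X.Ar} (F : X.Frame x u)
    {h : contTwoCocycles (galoisGroup L K) A.Pts}
    (hu : ∀ σ τ, X.mul (gal σ (u τ)) (u σ) = X.sh (h.1 (σ, τ)).1 (u (σ * τ))) {e : E}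
    (htr : ∀ a : E, ∃ σ : galoisGroup L K, gal σ e = a)
    (hob : DefFun L K ob) (har : DefFun L K fun p : E × E => ar p.1 p.2)
    (hc : ∀ σ τ ρ : galoisGroup L K, c (gal σ e) (gal τ e) (gal ρ e) = gal σ (h.1 (σ⁻¹ * τ, τ⁻¹ * ρ)).1)
    (hob' : ∀ σ : galoisGroup L K, ob (gal σ e) = gal σ x)
    (har' : ∀ σ τ : galoisGroup L K, ar (gal σ e) (gal τ e) = gal σ (u (σ⁻¹ * τ))) : Diagram c X ob ar where
  ob_defFun := hob
  ar_defFun := har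
  src a b := by
    obtain ⟨σ, rfl⟩ := htr a
    obtain ⟨τ, rfl⟩ := htr b
    rw [har', hob', F.src_gal, F.tgt]
  tgt a b := by
    obtain ⟨σ, rfl⟩ := htr a
    obtain ⟨τ, rfl⟩ := htr b
    rw [har', hob', F.tgt_gal, _root_.mul_inv_cancel_left]
  mul a b d := by
    obtain ⟨σ, rfl⟩ := htr a
    obtain ⟨τ, rfl⟩ := htr b
    obtain ⟨ρ, rfl⟩ := htr d
    have h1 : gal τ (u (τ⁻¹ * ρ)) = gal σ (gal (σ⁻¹ * τ) (u (τ⁻¹ * ρ))) := by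
      rw [← gal_mul _ _ (F.alg _), _root_.mul_inv_cancel_left]
    rw [har', har', har', hc, h1, mul_gal _ ((F.alg _).map_gal _) (F.alg _), hu,
      sh_gal _ (h.1 _).2 (F.alg _), _root_.mul_assoc, _root_.mul_inv_cancel_left]

/-- Changing the objects of a diagram along arrows `m`. -/
theorem conj (D : Diagram c X ob ar) {π : O → E} (hπ : DefFun L K π) {m : O → X.Ar}
    (hm : DefFun L K m) (hsrc : ∀ o, X.src (m o) = ob (π o)) :
    Diagram (fun x y z => c (π x) (π y) (π z)) X (fun o => X.tgt (m o))
      fun x y => X.mul (m y) (X.mul (ar (π x) (π y)) (X.inv (m x))) := by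
  have h1 (x y : O) : X.src (ar (π x) (π y)) = X.tgt (X.inv (m x)) := by
    rw [D.src, X.tgt_inv, hsrc]
  have h2 (x y : O) : X.src (m y) = X.tgt (ar (π x) (π y)) := by rw [hsrc, D.tgt]
  have h3 (x y : O) : X.src (m y) = X.tgt (X.mul (ar (π x) (π y)) (X.inv (m x))) :=
    (h2 x y).trans (tgt_mul (h1 x y)).symm
  refine ⟨X.tgt_defFun.comp hm, ?_, fun x y => ?_, fun x y => tgt_mul (h3 x y), fun x y z => ?_⟩
  · exact DefFun.comp₂ (h := X.mul) X.mul_defFun (hm.comp DefFun.snd)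
      (DefFun.comp₂ (h := X.mul) X.mul_defFun (DefFun.comp₂ (h := ar) D.ar_defFun
        (hπ.comp DefFun.fst) (hπ.comp DefFun.snd)) (X.inv_defFun.comp (hm.comp DefFun.fst)))
  · rw [src_mul (h3 x y), src_mul (h1 x y), X.src_inv]
  · have h4 : X.src (X.inv (m y)) = X.tgt (X.mul (m y) (X.mul (ar (π x) (π y)) (X.inv (m x)))) := by
      rw [X.src_inv, tgt_mul (h3 x y)]
    have h5 : X.src (X.mul (ar (π y) (π z)) (X.inv (m y))) =
        X.tgt (X.mul (m y) (X.mul (ar (π x) (π y)) (X.inv (m x)))) := (src_mul (h1 y z)).trans h4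
    have h6 : X.src (ar (π y) (π z)) = X.tgt (X.mul (ar (π x) (π y)) (X.inv (m x))) :=
      (D.src_eq_tgt _ _ _).trans (tgt_mul (h1 x y)).symm
    rw [DefGroupoid.mul_assoc (h3 y z) h5, DefGroupoid.mul_assoc (h1 y z) h4,
      inv_mul_cancel_left (h3 x y), ← DefGroupoid.mul_assoc (D.src_eq_tgt _ _ _) (h1 x y), D.mul,
      sh_mul (h1 x z), mul_sh (h3 x z)]

/-- Diagrams with the same cocycle in two connected groupoids give a Morita equivalence. -/
theorem moritaEquivalent {Y : BoundedGroupoid A} {ob' : E → Y.Ob} {ar' : E → E → Y.Ar}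
    (D : Diagram c X ob ar) (D' : Diagram c Y ob' ar') [Nonempty E] (hX : X.Connected)
    (hY : Y.Connected) (hdef : DefFun L K fun p : E × E × E => c p.1 p.2.1 p.2.2)
    (hc : IsPairCocycle c) : MoritaEquivalent X Y := by
  obtain ⟨e⟩ := ‹Nonempty E›
  -- The objects of the diagrams need not exhaust those of `X` and `Y`. Adjoining arbitrary arrows
  -- out of them makes both object maps surjective, by connectedness, and the cocycle is pulled back
  -- from `E`.
  let S := {t : E × X.Ar × Y.Ar // X.src t.2.1 = ob t.1 ∧ Y.src t.2.2 = ob' t.1}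
  have hS : DefPred L K fun t : E × X.Ar × Y.Ar => X.src t.2.1 = ob t.1 ∧ Y.src t.2.2 = ob' t.1 :=
    (DefPred.eq (X.src_defFun.comp (DefFun.fst.comp DefFun.snd))
      (D.ob_defFun.comp DefFun.fst)).and
    (DefPred.eq (Y.src_defFun.comp (DefFun.snd.comp DefFun.snd)) (D'.ob_defFun.comp DefFun.fst))
  have : DefDom L K S := hS.defDom
  obtain ⟨O, ε, -, hε⟩ := exists_defSet_equiv (L := L) K S
  have hval : DefFun L K fun o : O => (ε.symm o).1 := DefFun.val.comp hε
  have hπ : DefFun L K fun o : O => (ε.symm o).1.1 := DefFun.fst.comp hval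
  have hm : DefFun L K fun o : O => (ε.symm o).1.2.1 := DefFun.fst.comp (DefFun.snd.comp hval)
  have hn : DefFun L K fun o : O => (ε.symm o).1.2.2 := DefFun.snd.comp (DefFun.snd.comp hval)
  have D₁ := D.conj hπ hm fun o => (ε.symm o).2.1
  have D₂ := D'.conj hπ hn fun o => (ε.symm o).2.2
  refine ⟨twist (c := fun x y z => c (ε.symm x).1.1 (ε.symm y).1.1 (ε.symm z).1.1)
    (hdef.comp ((hπ.comp DefFun.fst).pair ((hπ.comp (DefFun.fst.comp DefFun.snd)).pair
      (hπ.comp (DefFun.snd.comp DefFun.snd))))) (fun _ _ _ _ => hc _ _ _ _),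
    ⟨twistMorita D₁.ob_defFun (fun x => ?_) D₁.ar_defFun D₁.src D₁.tgt D₁.mul⟩,
    ⟨twistMorita D₂.ob_defFun (fun y => ?_) D₂.ar_defFun D₂.src D₂.tgt D₂.mul⟩⟩
  · obtain ⟨f, hf, hf'⟩ := hX.2 (ob e) x
    refine ⟨ε ⟨(e, f, Y.id (ob' e)), hf, Y.src_id _⟩, ?_⟩
    rwa [Equiv.symm_apply_apply]
  · obtain ⟨f, hf, hf'⟩ := hY.2 (ob' e) y
    refine ⟨ε ⟨(e, X.id (ob e), f), X.src_id _, hf⟩, ?_⟩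
    rwa [Equiv.symm_apply_apply]

end Diagram

/-- Frames of two groupoids with the same cocycle descend to diagrams with the same cocycle. -/
theorem exists_diagrams {X Y : BoundedGroupoid A} {x : X.Ob} {y : Y.Ob}
    {u : galoisGroup L K → X.Ar} {v : galoisGroup L K → Y.Ar} (Fx : X.Frame x u)
    (Fy : Y.Frame y v) {h : contTwoCocycles (galoisGroup L K) A.Pts}
    (hu : ∀ σ τ, X.mul (gal σ (u τ)) (u σ) = X.sh (h.1 (σ, τ)).1 (u (σ * τ)))
    (hv : ∀ σ τ, Y.mul (gal σ (v τ)) (v σ) = Y.sh (h.1 (σ, τ)).1 (v (σ * τ))) :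
    ∃ (E : DefSet L K) (e : E) (c : E → E → E → A) (ob : E → X.Ob) (ar : E → E → X.Ar)
      (ob' : E → Y.Ob) (ar' : E → E → Y.Ar),
      (∀ a : E, ∃ σ : galoisGroup L K, gal σ e = a) ∧
      (DefFun L K fun p : E × E × E => c p.1 p.2.1 p.2.2) ∧ IsPairCocycle c ∧
      (∀ σ τ ρ, c (gal σ e) (gal τ e) (gal ρ e) = gal σ (h.1 (σ⁻¹ * τ, τ⁻¹ * ρ)).1) ∧
      Diagram c X ob ar ∧ Diagram c Y ob' ar' := by
  have hx1 : IsLocallyConstant fun p : galoisGroup L K × galoisGroup L K × galoisGroup L K =>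
      gal p.1 x :=
    IsLocallyConstant.gal continuous_fst (IsLocallyConstant.const x) fun _ => Fx.alg_ob
  have hx2 : IsLocallyConstant fun p : galoisGroup L K × galoisGroup L K × galoisGroup L K =>
      gal p.1 y :=
    IsLocallyConstant.gal continuous_fst (IsLocallyConstant.const y) fun _ => Fy.alg_ob
  have hu1 : IsLocallyConstant fun p : galoisGroup L K × galoisGroup L K × galoisGroup L K =>
      gal p.1 (u p.2.1) :=
    IsLocallyConstant.gal continuous_fst (Fx.isLocallyConstant.comp_continuous
      (continuous_fst.comp continuous_snd)) fun _ => Fx.alg _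
  have hv1 : IsLocallyConstant fun p : galoisGroup L K × galoisGroup L K × galoisGroup L K =>
      gal p.1 (v p.2.1) :=
    IsLocallyConstant.gal continuous_fst (Fy.isLocallyConstant.comp_continuous
      (continuous_fst.comp continuous_snd)) fun _ => Fy.alg _
  have hX (σ τ : galoisGroup L K) : Alg L K (gal σ x, gal σ (u τ)) :=
    (Fx.alg_ob.map_gal σ).pair ((Fx.alg τ).map_gal σ)
  have hY (σ τ : galoisGroup L K) : Alg L K (gal σ y, gal σ (v τ)) :=
    (Fy.alg_ob.map_gal σ).pair ((Fy.alg τ).map_gal σ)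
  obtain ⟨E, e, c, F, -, htr, hdef, hc, hF, hce, hFe⟩ := exists_descent_cocycle h
    (f := fun p => ((gal p.1 x, gal p.1 (u p.2.1)), (gal p.1 y, gal p.1 (v p.2.1))))
    ((hx1.prodMk hu1).prodMk (hx2.prodMk hv1)) (fun p => (hX _ _).pair (hY _ _))
    fun g σ τ ρ => by
      rw [gal_pair _ (hX _ _) (hY _ _), gal_pair _ (Fx.alg_ob.map_gal σ) ((Fx.alg τ).map_gal σ),
        gal_pair _ (Fy.alg_ob.map_gal σ) ((Fy.alg τ).map_gal σ), gal_mul _ _ Fx.alg_ob,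
        gal_mul _ _ Fy.alg_ob, gal_mul _ _ (Fx.alg τ), gal_mul _ _ (Fy.alg τ)]
  -- The descended families involve only one or two of the group variables, so restriction to
  -- diagonals recovers maps on `E` and on `E × E`.
  have h1 : DefFun L K fun a : E => F a a a := hF.comp (DefFun.id.pair (DefFun.id.pair DefFun.id))
  have h2 : DefFun L K fun p : E × E => F p.1 p.2 p.2 :=
    hF.comp (DefFun.fst.pair (DefFun.snd.pair DefFun.snd))
  refine ⟨E, e, c, fun a => (F a a a).1.1, fun a b => (F a b b).1.2, fun a => (F a a a).2.1,
    fun a b => (F a b b).2.2, htr, hdef, hc, hce, ?_, ?_⟩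
  · exact Diagram.of_frame Fx hu htr (DefFun.fst.comp (DefFun.fst.comp h1))
      (DefFun.snd.comp (DefFun.fst.comp h2)) hce (fun σ => by rw [hFe]) fun σ τ => by rw [hFe]
  · exact Diagram.of_frame Fy hv htr (DefFun.fst.comp (DefFun.snd.comp h1))
      (DefFun.snd.comp (DefFun.snd.comp h2)) hce (fun σ => by rw [hFe]) fun σ τ => by rw [hFe]

/-- Shifting the frame by a cochain whose coboundary is `h' - h` replaces `h` by `h'` on the nose.
-/
theorem BoundedGroupoid.Frame.exists_of_class_eq {X : BoundedGroupoid A} {x : X.Ob}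
    {u : galoisGroup L K → X.Ar} (F : X.Frame x u)
    {h h' : contTwoCocycles (galoisGroup L K) A.Pts}
    (hu : ∀ σ τ, X.mul (gal σ (u τ)) (u σ) = X.sh (h.1 (σ, τ)).1 (u (σ * τ)))
    (e : (QuotientAddGroup.mk h : contH2 (galoisGroup L K) A.Pts) = QuotientAddGroup.mk h') :
    ∃ u', X.Frame x u' ∧
      ∀ σ τ, X.mul (gal σ (u' τ)) (u' σ) = X.sh (h'.1 (σ, τ)).1 (u' (σ * τ)) := by
  obtain ⟨g, hg, hgh⟩ := QuotientAddGroup.eq.1 e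
  have halg (σ) : Alg L K (g σ).1 := (g σ).2
  refine ⟨_, F.sh (hg.comp Subtype.val) halg, fun σ τ => ?_⟩
  have key : gal σ (g τ).1 + (g σ).1 + (h.1 (σ, τ)).1 = (h'.1 (σ, τ)).1 + (g (σ * τ)).1 := by
    have h1 : -(h.1 (σ, τ)).1 + (h'.1 (σ, τ)).1 = (σ • g τ : A.Pts).1 - (g (σ * τ)).1 + (g σ).1 :=
      congrArg Subtype.val (hgh σ τ)
    rw [A.smul_val, neg_add_eq_iff_eq_add] at h1
    rw [h1]
    abel
  exact (F.mul_sh halg σ τ).trans (by rw [hu, sh_sh, sh_sh, key]; rfl)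

/-- Once a frame of `X` is corrected to have the cocycle of `Y`, both frames descend together over
one index set `E` with one cocycle `c`. -/
theorem moritaEquivalent_of_class_eq {X Y : BoundedGroupoid A} (hX : X.Connected)
    (hY : Y.Connected) {h h' : contTwoCocycles (galoisGroup L K) A.Pts}
    (hh : IsAttachedCocycle X h) (hh' : IsAttachedCocycle Y h')
    (e : (QuotientAddGroup.mk h : contH2 (galoisGroup L K) A.Pts) = QuotientAddGroup.mk h') :
    MoritaEquivalent X Y := by
  obtain ⟨x, u, Fx, hu⟩ := isAttachedCocycle_iff.1 hh
  obtain ⟨y, v, Fy, hv⟩ := isAttachedCocycle_iff.1 hh'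
  obtain ⟨u', Fx', hu'⟩ := Fx.exists_of_class_eq hu e
  obtain ⟨E, a, c, ob, ar, ob', ar', -, hdef, hc, -, D, D'⟩ := exists_diagrams Fx' Fy hu' hv
  have : Nonempty E := ⟨a⟩
  exact D.moritaEquivalent D' hX hY hdef hc

end ModelGalois

/-! ### Torsors from vanishing classes, and the classification -/

namespace ModelGalois

variable {L : FirstOrder.Language.{u, v}} {U : Type w} [L.Structure U] {K : Set U}
  {A : DefAbGroup L K}

open DefGroupoid BoundedGroupoid

/-- A groupoid with a strictly commutative diagram has a torsor: the colimit of the torsors of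
arrows out of the objects of the diagram. -/
theorem Diagram.eliminableOver (hEI : EliminatesImaginaries L U) {E : DefSet L K} [Nonempty E]
    {X : BoundedGroupoid A} {ob : E → X.Ob} {ar : E → E → X.Ar}
    (D : Diagram (fun _ _ _ => (0 : A)) X ob ar) : X.EliminableOver K := by
  have hmul (x y z : E) : X.mul (ar y z) (ar x y) = ar x z := by rw [D.mul, sh_zero]
  have hid (x : E) : ar x x = X.id (ob x) := by
    refine mul_left_cancel (g := ar x x) (D.src_eq_tgt x x x) ?_ ?_
    · rw [D.src, X.tgt_id]
    · rw [hmul, mul_id (D.src x x)]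
  let S := {t : E × X.Ar // X.src t.2 = ob t.1}
  have hS : DefPred L K fun t : E × X.Ar => X.src t.2 = ob t.1 :=
    DefPred.eq (X.src_defFun.comp DefFun.snd) (D.ob_defFun.comp DefFun.fst)
  have : DefDom L K S := hS.defDom
  have hval : DefFun L K fun s : S => s.1 := DefFun.val
  have hpt : DefFun L K fun s : S => s.1.1 := DefFun.fst.comp hval
  have har : DefFun L K fun s : S => s.1.2 := DefFun.snd.comp hval
  -- Transport of an arrow out of one object of the diagram to an arrow out of another. Two elements
  -- of `S` are identified when all their transports agree. For each `y` the quotient is a copy of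
  -- the arrows out of `ob y`, yet it is `K`-definable because no `y` has to be chosen.
  let tr : S → E → X.Ar := fun s y => X.mul s.1.2 (ar y s.1.1)
  have hst (s : S) (y : E) : X.src s.1.2 = X.tgt (ar y s.1.1) := by rw [s.2, D.tgt]
  have htr_src (s : S) (y : E) : X.src (tr s y) = ob y := by rw [src_mul (hst s y), D.src]
  have htr_tgt (s : S) (y : E) : X.tgt (tr s y) = X.tgt s.1.2 := tgt_mul (hst s y)
  have htr_self (s : S) : tr s s.1.1 = s.1.2 := by
    show X.mul _ _ = _
    rw [hid, mul_id s.2]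
  have htr_mul (s : S) (x y : E) : X.mul (tr s y) (ar x y) = tr s x := by
    show X.mul (X.mul _ _) _ = _
    rw [DefGroupoid.mul_assoc (hst s y) (D.src_eq_tgt _ _ _), hmul]
  let r : S → S → Prop := fun s t => s.1.2 = tr t s.1.1
  have hr_iff {s t : S} : r s t ↔ ∀ x, tr s x = tr t x :=
    ⟨fun h x => by rw [← htr_mul t x s.1.1, ← h], fun h => by
      show s.1.2 = _
      rw [← h, htr_self]⟩
  have hr : Equivalence r := ⟨fun s => (htr_self s).symm, fun h => hr_iff.2 fun x =>
    (hr_iff.1 h x).symm, fun h h' => hr_iff.2 fun x => (hr_iff.1 h x).trans (hr_iff.1 h' x)⟩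
  have htr_def : DefFun L K fun p : S × E => tr p.1 p.2 :=
    DefFun.comp₂ (h := X.mul) X.mul_defFun (har.comp DefFun.fst)
      (DefFun.comp₂ (h := ar) D.ar_defFun DefFun.snd (hpt.comp DefFun.fst))
  have hr_def : DefPred L K fun p : S × S => r p.1 p.2 :=
    DefPred.eq (har.comp DefFun.fst)
      (DefFun.comp₂ (h := tr) htr_def DefFun.snd (hpt.comp DefFun.fst))
  obtain ⟨Q, q, hq, hsurj, hqr⟩ := hEI.exists_quotient hr hr_def
  have hqr' {s t : S} : q s = q t ↔ ∀ x, tr s x = tr t x := (hqr s t).trans hr_iff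
  let rep : Q → S := Function.surjInv hsurj
  have hrep (p : Q) : q (rep p) = p := Function.surjInv_eq hsurj p
  have hrep_tr (s : S) (x : E) : tr (rep (q s)) x = tr s x := hqr'.1 (hrep _) x
  have htgt_rep (s : S) : X.tgt (rep (q s)).1.2 = X.tgt s.1.2 := by
    rw [← htr_tgt _ s.1.1, hrep_tr, htr_tgt]
  let act : ∀ (m : X.Ar) (p : Q), X.src m = X.tgt (rep p).1.2 → Q := fun m p h =>
    q ⟨((rep p).1.1, X.mul m (rep p).1.2), (src_mul h).trans (rep p).2⟩
  have hanchor (m : X.Ar) (p : Q) (h : X.src m = X.tgt (rep p).1.2) :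
      X.tgt (rep (act m p h)).1.2 = X.tgt m := (htgt_rep _).trans (tgt_mul h)
  have htr_act (m : X.Ar) (s : S) (h : X.src m = X.tgt s.1.2) (x : E) :
      tr ⟨(s.1.1, X.mul m s.1.2), (src_mul h).trans s.2⟩ x = X.mul m (tr s x) :=
    DefGroupoid.mul_assoc h (hst s x)
  have hact (m : X.Ar) (p : Q) (h : X.src m = X.tgt (rep p).1.2) (x : E) :
      tr (rep (act m p h)) x = X.mul m (tr (rep p) x) := by
    rw [hrep_tr, htr_act m (rep p) h]
  have hext {p p' : Q} (x : E) (h : tr (rep p) x = tr (rep p') x) : p = p' := by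
    rw [← hrep p, ← hrep p', hqr']
    intro y
    rw [← htr_mul _ y x, h, htr_mul]
  have hact_iff {m : X.Ar} {p p' : Q} (x : E) : (∃ h, act m p h = p') ↔
      X.src m = X.tgt (tr (rep p) x) ∧ X.mul m (tr (rep p) x) = tr (rep p') x := by
    constructor
    · rintro ⟨h, rfl⟩
      exact ⟨h.trans (htr_tgt _ _).symm, (hact m p h x).symm⟩
    · rintro ⟨h, h'⟩
      have h1 := h.trans (htr_tgt _ _)
      exact ⟨h1, hext x ((hact m p h1 x).trans h')⟩
  have htrq_def : DefFun L K fun p : Q × E => tr (rep p.1) p.2 :=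
    DefFun.of_surjective (f := fun p : S × E => (q p.1, p.2))
      ((hq.comp DefFun.fst).pair DefFun.snd)
      (fun p => ⟨(rep p.1, p.2), Prod.ext (hrep _) rfl⟩)
      (htr_def.congr fun p => (hrep_tr p.1 p.2).symm)
  obtain ⟨e⟩ := ‹Nonempty E›
  refine ⟨{
    P := Q
    nonempty := ⟨q ⟨(e, X.id (ob e)), X.src_id _⟩⟩
    anchor := fun p => X.tgt (rep p).1.2
    act := act
    anchor_act := hanchor
    id_act := fun p => hext e ((hact _ _ (X.src_id _) e).trans (id_mul (htr_tgt _ _)))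
    comp_act := fun g f p h h' => hext e (by
      rw [hact _ _ ((X.src_comp g f h).trans h'), hact g _ (h.trans (hanchor f p h').symm),
        hact f p h', comp_eq_mul, DefGroupoid.mul_assoc h (h'.trans (htr_tgt _ _).symm)])
    principal := fun p p' => by
      have e1 : X.src (tr (rep p') e) = X.src (tr (rep p) e) :=
        (htr_src _ _).trans (htr_src _ _).symm
      have e2 : X.src (tr (rep p') e) = X.tgt (X.inv (tr (rep p) e)) :=
        e1.trans (X.tgt_inv _).symm
      refine ⟨X.mul (tr (rep p') e) (X.inv (tr (rep p) e)), ?_, fun m hm => ?_⟩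
      · exact (hact_iff e).2 ⟨(src_mul e2).trans (X.src_inv _), mul_inv_cancel_right e1⟩
      · obtain ⟨h, h'⟩ := (hact_iff e).1 hm
        refine mul_right_cancel h ((src_mul e2).trans (X.src_inv _)) ?_
        rw [h', mul_inv_cancel_right e1]
    anchor_def := isDefMap_iff.2 (DefFun.of_surjective hq hsurj
      ((X.tgt_defFun.comp har).congr fun s => (htgt_rep s).symm))
    act_def := (definable_partial_iff
      (Q := fun z : X.Ar × Q => X.src z.1 = X.tgt (rep z.2).1.2)
      (f := fun z h => act z.1 z.2 h)).2 ?_ }⟩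
  -- The point `e` need not be definable over `K`, so the graph of the action is described by
  -- quantifying over all points of `E`; by `hact_iff` any of them gives the same relation.
  have hm : DefFun L K fun p : ((X.Ar × Q) × Q) × E => p.1.1.1 :=
    DefFun.fst.comp (DefFun.fst.comp DefFun.fst)
  have h1 : DefFun L K fun p : ((X.Ar × Q) × Q) × E => tr (rep p.1.1.2) p.2 :=
    DefFun.comp₂ (h := fun p x => tr (rep p) x) htrq_def
      (DefFun.snd.comp (DefFun.fst.comp DefFun.fst)) DefFun.snd
  have h2 : DefFun L K fun p : ((X.Ar × Q) × Q) × E => tr (rep p.1.2) p.2 :=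
    DefFun.comp₂ (h := fun p x => tr (rep p) x) htrq_def (DefFun.snd.comp DefFun.fst) DefFun.snd
  exact (((DefPred.eq (X.src_defFun.comp hm) (X.tgt_defFun.comp h1)).and
    (DefPred.eq (DefFun.comp₂ (h := X.mul) X.mul_defFun hm h1) h2)).exists).congr fun p =>
      ⟨fun ⟨x, hx⟩ => (hact_iff x).2 hx, fun h => ⟨e, (hact_iff e).1 h⟩⟩

/-- The frame can be corrected to have cocycle `0`; the diagram it descends to then commutes
strictly. -/
theorem eliminableOver_of_class_eq_zero (hEI : EliminatesImaginaries L U) {X : BoundedGroupoid A}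
    {h : contTwoCocycles (galoisGroup L K) A.Pts} (hh : IsAttachedCocycle X h)
    (e : (QuotientAddGroup.mk h : contH2 (galoisGroup L K) A.Pts) = 0) : X.EliminableOver K := by
  obtain ⟨x, u, F, hu⟩ := isAttachedCocycle_iff.1 hh
  obtain ⟨u', F', hu'⟩ := F.exists_of_class_eq (h' := 0) hu e
  obtain ⟨E, a, c, ob, ar, -, -, htr, -, -, hc, D, -⟩ := exists_diagrams F' F' hu' hu'
  have : Nonempty E := ⟨a⟩
  have hc0 : c = fun _ _ _ => 0 := by
    funext x y z
    obtain ⟨σ, rfl⟩ := htr x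
    obtain ⟨τ, rfl⟩ := htr y
    obtain ⟨ρ, rfl⟩ := htr z
    rw [hc]
    exact A.gal_zero σ
  subst hc0
  exact D.eliminableOver hEI

namespace SplitGroupoid

/-- The cohomology class of a connected groupoid with a split torsor over `acl(K)`. -/
noncomputable def cohomologyClass (hA : A.TorsorsSplit) (X : SplitGroupoid A) :
    contH2 (galoisGroup L K) A.Pts :=
  QuotientAddGroup.mk (X.exists_attached hA).choose

theorem cohomologyClass_eq_of_moritaMorphism (hEI : EliminatesImaginaries L U)
    (hA : A.TorsorsSplit) {X Y : SplitGroupoid A} {Z : BoundedGroupoid A}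
    (F : MoritaMorphism Z X.1) (G : MoritaMorphism Z Y.1) :
    X.cohomologyClass hA = Y.cohomologyClass hA :=
  class_eq_of_moritaMorphism hEI hA F G Y.2.1 (X.exists_attached hA).choose_spec
    (Y.exists_attached hA).choose_spec

/-- Independence of the object, the arrows and the cocycle is Morita invariance for two identity
morphisms. -/
theorem cohomologyClass_eq (hEI : EliminatesImaginaries L U) (hA : A.TorsorsSplit)
    (X : SplitGroupoid A) {h : contTwoCocycles (galoisGroup L K) A.Pts}
    (hh : IsAttachedCocycle X.1 h) : X.cohomologyClass hA = QuotientAddGroup.mk h :=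
  class_eq_of_moritaMorphism hEI hA (MoritaMorphism.refl X.1) (MoritaMorphism.refl X.1) X.2.1
    (X.exists_attached hA).choose_spec hh

end SplitGroupoid

end ModelGalois

open ModelGalois in
theorem mainTheorem1 {L : FirstOrder.Language.{u, v}} {U : Type w} [L.Structure U]
    (hEI : EliminatesImaginaries L U) (K : Set U) (A : DefAbGroup L K) (hA : A.TorsorsSplit) :
    (∀ X : SplitGroupoid A, ∃ h, IsAttachedCocycle X.1 h) ∧
    ∃ Φ : MoritaClasses A ≃ contH2 (galoisGroup L K) A.Pts,
      (∀ (X : SplitGroupoid A) (h : contTwoCocycles (galoisGroup L K) A.Pts),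
        IsAttachedCocycle X.1 h → Φ X.moritaClass = QuotientAddGroup.mk h) ∧
      ∀ X : SplitGroupoid A, X.1.EliminableOver K ↔ Φ X.moritaClass = 0 := by
  have hatt : ∀ X : SplitGroupoid A, ∃ h, IsAttachedCocycle X.1 h := fun X => X.exists_attached hA
  let Φ : MoritaClasses A → contH2 (galoisGroup L K) A.Pts :=
    -- Invariance under a single Morita equivalence suffices here, and injectivity below produces a
    -- single one, so transitivity of the relation is never needed.
    Quot.lift (fun X => X.cohomologyClass hA) fun X Y ⟨_, ⟨F⟩, ⟨G⟩⟩ =>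
      SplitGroupoid.cohomologyClass_eq_of_moritaMorphism hEI hA F G
  have hΦ (X : SplitGroupoid A) (h : contTwoCocycles (galoisGroup L K) A.Pts)
      (hh : IsAttachedCocycle X.1 h) : Φ X.moritaClass = QuotientAddGroup.mk h :=
    X.cohomologyClass_eq hEI hA hh
  have hbij : Function.Bijective Φ := by
    refine ⟨fun p q => ?_, fun c => ?_⟩
    · induction p using Quot.ind with | mk X
      induction q using Quot.ind with | mk Y
      obtain ⟨h, hh⟩ := hatt X
      obtain ⟨h', hh'⟩ := hatt Y
      intro e
      exact Quot.sound (moritaEquivalent_of_class_eq X.2.1 Y.2.1 hh hh'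
        ((hΦ X h hh).symm.trans (e.trans (hΦ Y h' hh'))))
    · obtain ⟨h, rfl⟩ := QuotientAddGroup.mk_surjective c
      obtain ⟨X, hX⟩ := exists_splitGroupoid h
      exact ⟨X.moritaClass, hΦ X h hX⟩
  refine ⟨hatt, Equiv.ofBijective Φ hbij, hΦ, fun X => ⟨fun ⟨T⟩ => ?_, fun e => ?_⟩⟩
  · obtain ⟨x, hx⟩ := X.exists_alg_ob
    exact hΦ X 0 (BoundedGroupoid.isAttachedCocycle_zero_of_torsor hA X.2.1 T hx)
  · obtain ⟨h, hh⟩ := hatt X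
    exact eliminableOver_of_class_eq_zero hEI hh ((hΦ X h hh).symm.trans e)
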